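/- **Finite chains.** A finite Markov chain is given by a finite set $\Omega$ and a transition rate matrix $Q\in\mathbb R^{\Omega\times\Omega}$ with non-negative off-diagonal entries and rows summing to $0$; put $P_t=e^{tQ}$ and $G(t)=\sum_{\omega}P_t(\omega,\omega)$. A probability distribution $\pi$ on $\Omega$ is stationary if $\sum_\omega \pi(\omega)Q(\omega,\omega')=0$ for every $\omega'$. The chain is *reversible* if some stationary $\pi$ satisfies $\pi(\omega)Q(\omega,\omega')=\pi(\omega')Q(\omega',\omega)$ for all $\omega,\omega'$; *irreducible* if all entries of $P_t$ are strictly positive for every (equivalently, some) $t>0$; *normalized* if $G(1)=2$. A *bounded sequence* is a sequence of irreducible, reversible, normalized finite Markov chains $(\Omega_{(n)},Q_{(n)})$ such that for every $t>0$ there is $B_t$ with $G_{(n)}(t)\le B_t$ for all $n$. The *density array* of a reversible irreducible finite chain with (unique) stationary distribution $\pi$ is the family $X_{i,j}(t)=P_t(\omega_i,\omega_j)/\pi(\omega_j)$ ($i,j\in\mathbb N$, $t>0$), where $(\omega_i)_{i\in\mathbb N}$ is i.i.d. with law $\pi$. **Markov chain density arrays.** A *Markov chain density array* is an array $(X_{i,j})_{i,j\in\mathbb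 N}$ of random variables on a probability space with values in $(\mathbb R^{>0})^{\mathbb R^{>0}}$ (with the product $\sigma$-algebra) such that, where in every expectation below the random variable is integrable: - for each $n$ and each permutation $\sigma$ of $\{0,\dots,n\}$, $(X_{i,j})_{i,j\le n}$ and $(X_{\sigma(i),\sigma(j)})_{i,j\le n}$ have the same joint law; - for disjoint $S,T\subseteq\mathbb N$, $(X_{i,j})_{i,j\in S}$ and $(X_{i,j})_{i,j\in T}$ are independent; - for every $n$, $(X_{i,j})_{i,j<n}$ and $(X_{i,j})_{i,j\ge n}$ are independent; - for all $t>0$, $\mathbb E\big(2X_{0,1}(t)-X_{0,1}(t)X_{0,2}(t)\big)=1$; - for all $t>0$, $X_{0,1}(t)=X_{1,0}(t)$ almost surely; - for all $s,t>0$, $\mathbb E\big(X_{0,1}(s+t)^2-2X_{0,1}(s+t)X_{0,2}(s)X_{2,1}(t)+X_{0,2}(s)X_{0,3}(s)X_{2,1}(t)X_{3,1}(t)\big)=0$; - for all $s,t>0$, $\mathbb E\big(X_{0,0}(s+t)^2-2X_{0,0}(s+t)X_{0,2}(s)X_{2,0}(t)+X_{0,2}(s)X_{0,3}(s)X_{2,0}(t)X_{3,0}(t)\big)=0$;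 - $\mathbb E(X_{0,0}(t))<\infty$ for all $t>0$, and $\mathbb E(X_{0,0}(1))=2$; - for every $t>0$, $\lim_{s\to t}\mathbb E\big((X_{0,1}(t)-X_{0,1}(s))^2\big)=0$. Arrays $(X_{(n),i,j})$ *converge in distribution* to $(X_{i,j})$ if for every $k$ the matrices $(X_{(n),i,j})_{i,j<k}$ converge in distribution to $(X_{i,j})_{i,j<k}$ in the sense of finite-dimensional distributions, i.e. for every finite set $T$ of positive times the random vectors $(X_{(n),i,j}(t))_{i,j<k,\,t\in T}$ converge in distribution to $(X_{i,j}(t))_{i,j<k,\,t\in T}$. **Theorem.** Let $(X_{*,i,j})_{i,j\in\mathbb N}$ be a Markov chain density array. Then there is a bounded sequence of finite Markov chains $(\Omega_{(n)},Q_{(n)})$ whose density arrays $(X_{(n),i,j})$ converge in distribution to $(X_{*,i,j})$. -/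

import Mathlib

open MeasureTheory ProbabilityTheory Filter Topology

noncomputable section

namespace MarkovLimit

/-- The set of positive real numbers, used as the set of times. -/
abbrev PosReal : Type := {t : ℝ // 0 < t}

/-! ### Finite Markov chains -/

/-- A finite state continuous time homogeneous Markov chain, given by its finite state space and
its transition rate matrix (the generator, which determines the law of the chain from each initial
state). -/
structure FiniteMarkovChain where
  State : Type
  [fintypeState : Fintype State]
  [decidableEqState : DecidableEq State]
  /-- The transition rate matrix. -/
  Q : Matrix State State ℝ
  Q_nonneg : ∀ x y, x ≠ y → 0 ≤ Q x y
  Q_row_sum : ∀ x, ∑ y, Q x y = 0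

namespace FiniteMarkovChain

instance (C : FiniteMarkovChain) : Fintype C.State := C.fintypeState

instance (C : FiniteMarkovChain) : DecidableEq C.State := C.decidableEqState

/-- All subsets of the state space are measurable. -/
instance (C : FiniteMarkovChain) : MeasurableSpace C.State := ⊤

variable (C : FiniteMarkovChain)

/-- The transition probability matrix `P_t = e ^ (t Q)`. -/
def P (t : ℝ) : Matrix C.State C.State ℝ := NormedSpace.exp (t • C.Q)

/-- `π` is a stationary distribution: `π Q = 0`. -/
def IsStationary (π : PMF C.State) : Prop :=
  ∀ y, ∑ x, (π x).toReal * C.Q x y = 0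

/-- The detailed balance equations. -/
def DetailedBalance (π : PMF C.State) : Prop :=
  ∀ x y, (π x).toReal * C.Q x y = (π y).toReal * C.Q y x

/-- The chain is reversible. -/
def IsReversible : Prop := ∃ π : PMF C.State, C.IsStationary π ∧ C.DetailedBalance π

/-- The chain is irreducible (positivity for one `t > 0` is equivalent to positivity for every
`t > 0`). -/
def IsIrreducible : Prop := ∀ t : ℝ, 0 < t → ∀ x y, 0 < C.P t x y

/-- The mixing at time `t`. -/
def G (t : ℝ) : ℝ := ∑ x, C.P t x x

/-- The chain is normalized. -/
def IsNormalized : Prop := C.G 1 = 2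

/-- The probability density of `P_t` with respect to `π`. -/
def density (π : PMF C.State) (t : ℝ) (x y : C.State) : ℝ := C.P t x y / (π y).toReal

/-- The law of an i.i.d. sequence of states with distribution `π`. -/
def sampleMeasure (π : PMF C.State) : Measure (ℕ → C.State) :=
  Measure.infinitePi (fun _ : ℕ => π.toMeasure)

instance (π : PMF C.State) : IsProbabilityMeasure (C.sampleMeasure π) := by
  unfold sampleMeasure; infer_instance

/-- The density array: the random variables `p_t(ω_i, ω_j)`, on the probability space
`sampleMeasure π` of i.i.d. sequences `(ω_i)`. -/
def densityArray (π : PMF C.State) (i j : ℕ) (ω : ℕ → C.State) (t : PosReal) : ℝ :=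
  C.density π t (ω i) (ω j)

end FiniteMarkovChain

/-- A bounded sequence of finite Markov chains. -/
structure IsBoundedSequence (C : ℕ → FiniteMarkovChain) : Prop where
  irreducible : ∀ n, (C n).IsIrreducible
  reversible : ∀ n, (C n).IsReversible
  normalized : ∀ n, (C n).IsNormalized
  bounded : ∀ t : ℝ, 0 < t → ∃ B : ℝ, ∀ n, (C n).G t ≤ B

/-! ### Markov chain density arrays -/

/-- The random variable `Y` has a finite expectation, and it equals `c`. -/
def HasExpectation {Ω : Type*} [MeasurableSpace Ω] (μ : Measure Ω) (Y : Ω → ℝ) (c : ℝ) : Prop :=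
  Integrable Y μ ∧ ∫ ω, Y ω ∂μ = c

/-- `X` is a Markov chain density array: an array of random functions `X i j` from the positive
reals to the positive reals, with the listed properties. The joint laws are taken for the product
`σ`-algebra on functions of time. -/
structure IsDensityArray {Ω : Type*} [MeasurableSpace Ω] (μ : Measure Ω)
    (X : ℕ → ℕ → Ω → PosReal → ℝ) : Prop where
  measurable : ∀ i j, Measurable (X i j)
  pos : ∀ i j ω t, 0 < X i j ω t
  exchangeable : ∀ (n : ℕ) (σ : Equiv.Perm (Fin (n + 1))),
    IdentDistrib (fun ω (i j : Fin (n + 1)) => X i j ω)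
      (fun ω (i j : Fin (n + 1)) => X (σ i) (σ j) ω) μ μ
  dissociated : ∀ S T : Set ℕ, Disjoint S T →
    IndepFun (fun ω (i j : S) => X i j ω) (fun ω (i j : T) => X i j ω) μ
  independence : ∀ n : ℕ,
    IndepFun (fun ω (i j : Set.Iio n) => X i j ω) (fun ω (i j : Set.Ici n) => X i j ω) μ
  stochastic : ∀ t, HasExpectation μ (fun ω => 2 * X 0 1 ω t - X 0 1 ω t * X 0 2 ω t) 1
  symmetric : ∀ t, ∀ᵐ ω ∂μ, X 0 1 ω t = X 1 0 ω t
  chapmanKolmogorov : ∀ s t, HasExpectation μ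
    (fun ω => X 0 1 ω (s + t) ^ 2 - 2 * X 0 1 ω (s + t) * X 0 2 ω s * X 2 1 ω t
      + X 0 2 ω s * X 0 3 ω s * X 2 1 ω t * X 3 1 ω t) 0
  diagonalChapmanKolmogorov : ∀ s t, HasExpectation μ
    (fun ω => X 0 0 ω (s + t) ^ 2 - 2 * X 0 0 ω (s + t) * X 0 2 ω s * X 2 0 ω t
      + X 0 2 ω s * X 0 3 ω s * X 2 0 ω t * X 3 0 ω t) 0
  bounded : ∀ t, Integrable (fun ω => X 0 0 ω t) μ
  normal : HasExpectation μ (fun ω => X 0 0 ω 1) 2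
  continuous : ∀ t, Tendsto
    (fun s => ∫⁻ ω, ENNReal.ofReal ((X 0 1 ω t - X 0 1 ω s) ^ 2) ∂μ) (𝓝 t) (𝓝 0)

/-- Convergence in distribution of a sequence of arrays of random functions of time: for every
`k`, the `k × k` matrices of random functions converge in distribution, in the sense of their
finite dimensional distributions. -/
def ArrayTendstoInDistribution {Ω : ℕ → Type*} [∀ n, MeasurableSpace (Ω n)]
    (μ : ∀ n, Measure (Ω n)) [∀ n, IsProbabilityMeasure (μ n)]
    (X : ∀ n, ℕ → ℕ → Ω n → PosReal → ℝ)
    {Ω' : Type*} [MeasurableSpace Ω'] (μ' : Measure Ω') [IsProbabilityMeasure μ']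
    (Z : ℕ → ℕ → Ω' → PosReal → ℝ) : Prop :=
  ∀ (k : ℕ) (T : Finset PosReal), TendstoInDistribution
    (fun n (ω : Ω n) (i j : Fin k) (t : T) => X n i j ω t) atTop
    (fun (ω : Ω') (i j : Fin k) (t : T) => Z i j ω t) μ μ'

end MarkovLimit

end

/-!
A Markov chain density array is represented by a symmetric Markov semigroup on a probability space,
and the semigroup is approximated by finite chains in the Hilbert-Schmidt sense.

**Representation.** Restrict the array to a countable set of times which is closed under sums and
halving, for instance the rational ones. Regard the indices of even number as sample points and
those of odd number as reference points. By exchangeability and the Chapman-Kolmogorov identity,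
which is an identity between second moments, the entry `X i j t` is the conditional mean of the
products `X i r (t / 2) * X r j (t / 2)`, which are exchangeable in the reference point `r`; hence
it is a measurable function of them (`IsExchangeableOver.exists_measurable_eq`). The sample points,
as seen from the reference points, are conditionally independent given the array of the reference
points (`map_refArray_refPoints`), since nested conditional probabilities with the same second
moment agree. By dissociation one may fix the reference array. Thus the array is given by kernels
`p t` and diagonals `d t` evaluated at independent points of a probability space `(S, ν)`
(`exists_kernel_representation`), and the axioms say that `p` is a symmetric Markov semigroup of
densities for which `d` has finite integrals (`Represents.isKernelSemigroup`). So the operators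
`T t` on `L² ν` are Hilbert-Schmidt and `∫ d t` is their trace.

**Finite chains.** Given a partition of `S` into finitely many cells and a time `ε`, the compression
of `T ε` to the functions which are constant on cells is the transition matrix of a reversible chain
on the set of cells with positive transition probabilities. Let this chain jump at rate `1 / ε`. If
the cells are adapted to finitely many vectors `T (s + j τ) f` and their difference quotients, then
the semigroup of the chain is close to `T` on the vectors `T s f`
(`IsSymmSemigroup.abs_sum_exp_sub_le`); here the analyticity of symmetric contraction semigroups
(`IsSymmSemigroup.norm_sub_pow_le`) bounds the second difference quotients. The number of vectors
does not depend on `ε`, so that the number of cells is polynomial in `1 / ε`. On the other hand the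
trace of the chain at a time exceeds the trace of `T` at an earlier time at most by the number of
cells times a quantity which is exponentially small in `1 / ε` (`IsSymmSemigroup.sum_exp_le`).
This gives a sequence of chains (`IsKernelSemigroup.exists_seq_approximation`) whose quadratic forms
converge and whose traces do not exceed that of `T` in the limit.

**Convergence.** Weak convergence together with convergence of norms is convergence in norm: the
densities of the chains converge to `p t` in `L² (ν × ν)`, and their diagonals converge in `L¹`
(`IsKernelSemigroup.tendsto_integral_ker_sub_sq`,
`IsKernelSemigroup.tendsto_integral_abs_ker_diag_sub`). The trace is strictly decreasing at time
`1`, where it is `2`, because it could be constant only with the value `1`. So the chains are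
normalized by a change of speed which tends to `1` (`exists_speed`). The traces are continuous in
time, which carries the convergence from rational times to all times and makes the change of speed
harmless (`IsKernelSemigroup.eventually_L1Le_ker`). Finally `L¹` convergence of the matrix entries,
evaluated at independent points of `S`, implies convergence in distribution.
-/

open MeasureTheory ProbabilityTheory Filter Topology

noncomputable section

namespace MarkovLimit

/-! ### Second moment identities -/

/-- The second moment identity for a constant `a`. The function `b` is integrable since
`b x * (b y - 2 a)` is an integrable function of `x` for almost every `y`. -/
lemma integrable_and_integral_eq_sq {E : Type*} [MeasurableSpace E] (κ : Measure E)
    [IsProbabilityMeasure κ] {b : E → ℝ} {a : ℝ}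
    (h : Integrable (fun z : E × E => a ^ 2 - 2 * a * b z.1 + b z.1 * b z.2) (κ.prod κ)) :
    Integrable b κ ∧
      ∫ z : E × E, (a ^ 2 - 2 * a * b z.1 + b z.1 * b z.2) ∂(κ.prod κ) = (a - ∫ x, b x ∂κ) ^ 2 := by
  have hint : Integrable b κ := by
    by_cases hc : ∀ᵐ y ∂κ, b y = 2 * a
    · exact (integrable_const (2 * a)).congr (hc.mono fun y hy => hy.symm)
    · have h1 := h.prod_left_ae
      have : ∃ y, b y ≠ 2 * a ∧
          Integrable (fun x => a ^ 2 - 2 * a * b x + b x * b y) κ := by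
        by_contra hne
        push Not at hne
        exact hc (h1.mono fun y hy => by_contra fun hy' => hne y hy' hy)
      obtain ⟨y, hy, hi⟩ := this
      have hi2 := (hi.sub (integrable_const (a ^ 2))).div_const (b y - 2 * a)
      refine hi2.congr (Eventually.of_forall fun x => ?_)
      have : b y - 2 * a ≠ 0 := sub_ne_zero.mpr hy
      simp only [Pi.sub_apply]
      rw [div_eq_iff this]
      ring
  refine ⟨hint, ?_⟩
  have hf : Integrable (fun z : E × E => b z.1) (κ.prod κ) := hint.comp_fst κ
  have hfg : Integrable (fun z : E × E => b z.1 * b z.2) (κ.prod κ) := hint.mul_prod hint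
  have hc : Integrable (fun _ : E × E => a ^ 2) (κ.prod κ) := integrable_const _
  have hs : Integrable (fun z : E × E => a ^ 2 - 2 * a * b z.1) (κ.prod κ) :=
    hc.sub (hf.const_mul _)
  rw [integral_add hs hfg, integral_sub hc (hf.const_mul _), integral_const_mul,
    integral_prod_mul]
  have : ∫ z : E × E, b z.1 ∂(κ.prod κ) = ∫ x, b x ∂κ := by
    rw [integral_prod _ hf]; simp
  rw [this]
  simp
  ring

/-- If `b` has the same conditional law twice, conditionally independently, then the vanishing of
the expectation of `a ^ 2 - 2 a b + b b'` says that `a` is the conditional mean of `b`. Neither term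
of the combination has to be integrable by itself. -/
lemma ae_eq_integral_of_integral_sq_eq_zero {Γ E : Type*} [MeasurableSpace Γ] [MeasurableSpace E]
    (m : Measure Γ) [IsProbabilityMeasure m] (κ : Kernel Γ E) [IsMarkovKernel κ]
    {b : Γ → E → ℝ} {a : Γ → ℝ}
    (h : HasExpectation (m ⊗ₘ (κ ×ₖ κ))
      (fun z => a z.1 ^ 2 - 2 * a z.1 * b z.1 z.2.1 + b z.1 z.2.1 * b z.1 z.2.2) 0) :
    ∀ᵐ γ ∂m, Integrable (b γ) (κ γ) ∧ a γ = ∫ x, b γ x ∂(κ γ) := by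
  obtain ⟨hi, h0⟩ := h
  have h1 := ((Measure.integrable_compProd_iff hi.aestronglyMeasurable).1 hi).1
  rw [Measure.integral_compProd hi] at h0
  have h2 : ∀ᵐ γ ∂m, Integrable (b γ) (κ γ) ∧
      ∫ z, (a γ ^ 2 - 2 * a γ * b γ z.1 + b γ z.1 * b γ z.2) ∂((κ ×ₖ κ) γ)
        = (a γ - ∫ x, b γ x ∂(κ γ)) ^ 2 := by
    filter_upwards [h1] with γ hγ
    rw [Kernel.prod_apply] at hγ ⊢
    exact integrable_and_integral_eq_sq (κ γ) hγ
  have h3 : (fun γ => (a γ - ∫ x, b γ x ∂(κ γ)) ^ 2) =ᵐ[m] 0 := by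
    have hi2 : Integrable (fun γ => (a γ - ∫ x, b γ x ∂(κ γ)) ^ 2) m := by
      rw [Measure.compProd] at hi
      have hi' := hi.integral_compProd
      simp only [Kernel.const_apply, Kernel.prodMkLeft_apply] at hi'
      exact hi'.congr (h2.mono fun γ hγ => hγ.2)
    rw [← integral_eq_zero_iff_of_nonneg (fun γ => sq_nonneg _) hi2, ← h0]
    exact integral_congr_ae (h2.mono fun γ hγ => hγ.2.symm)
  filter_upwards [h2, h3] with γ hγ hγ'
  exact ⟨hγ.1, sub_eq_zero.1 (pow_eq_zero_iff two_ne_zero |>.1 hγ')⟩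

/-! ### Conditional independence -/

/-- If `z` and `w` have the same inner products `⟪z, z⟫ = ⟪z, w⟫ = ⟪w, w⟫`, then they agree. -/
lemma ae_eq_of_lintegral_mul_eq {Ω : Type*} [MeasurableSpace Ω] {μ : Measure Ω}
    [IsProbabilityMeasure μ] {z w : Ω → ENNReal} (hz : Measurable z) (hw : Measurable w)
    (hz1 : ∀ ω, z ω ≤ 1) (hw1 : ∀ ω, w ω ≤ 1)
    (hzz : ∫⁻ ω, z ω * z ω ∂μ = ∫⁻ ω, z ω * w ω ∂μ)
    (hww : ∫⁻ ω, w ω * w ω ∂μ = ∫⁻ ω, z ω * w ω ∂μ) : z =ᵐ[μ] w := by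
  have hzt : ∀ ω, z ω ≠ ⊤ := fun ω => ((hz1 ω).trans_lt ENNReal.one_lt_top).ne
  have hwt : ∀ ω, w ω ≠ ⊤ := fun ω => ((hw1 ω).trans_lt ENNReal.one_lt_top).ne
  have key : ∀ f g : Ω → ENNReal, Measurable f → Measurable g → (∀ ω, f ω ≤ 1) → (∀ ω, g ω ≤ 1) →
      Integrable (fun ω => (f ω).toReal * (g ω).toReal) μ ∧
      ∫ ω, (f ω).toReal * (g ω).toReal ∂μ = (∫⁻ ω, f ω * g ω ∂μ).toReal := by
    intro f g hf hg hf1 hg1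
    have hle : ∀ ω, f ω * g ω ≤ 1 := fun ω => mul_le_one' (hf1 ω) (hg1 ω)
    constructor
    · refine Integrable.of_bound (C := 1) (by fun_prop) (Eventually.of_forall fun ω => ?_)
      rw [← ENNReal.toReal_mul, Real.norm_of_nonneg ENNReal.toReal_nonneg]
      exact ENNReal.toReal_le_of_le_ofReal zero_le_one (by simpa using hle ω)
    · rw [← integral_toReal (by fun_prop)
        (Eventually.of_forall fun ω => (hle ω).trans_lt ENNReal.one_lt_top)]
      simp only [ENNReal.toReal_mul]
  obtain ⟨i1, e1⟩ := key z z hz hz hz1 hz1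
  obtain ⟨i2, e2⟩ := key z w hz hw hz1 hw1
  obtain ⟨i3, e3⟩ := key w w hw hw hw1 hw1
  have : ∫ ω, ((z ω).toReal - (w ω).toReal) ^ 2 ∂μ = 0 := by
    have : ∀ ω, ((z ω).toReal - (w ω).toReal) ^ 2 = ((z ω).toReal * (z ω).toReal
      - (z ω).toReal * (w ω).toReal) + ((w ω).toReal * (w ω).toReal
      - (z ω).toReal * (w ω).toReal) := fun ω => by ring
    simp_rw [this]
    have j1 : Integrable (fun ω => (z ω).toReal * (z ω).toReal - (z ω).toReal * (w ω).toReal) μ :=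
      i1.sub i2
    have j2 : Integrable (fun ω => (w ω).toReal * (w ω).toReal - (z ω).toReal * (w ω).toReal) μ :=
      i3.sub i2
    rw [integral_add j1 j2, integral_sub i1 i2, integral_sub i3 i2, e1, e2, e3,
      hzz, hww]
    ring
  rw [integral_eq_zero_iff_of_nonneg (fun ω => sq_nonneg _)] at this
  · filter_upwards [this] with ω hω
    have : (z ω).toReal = (w ω).toReal := sub_eq_zero.1 (pow_eq_zero_iff two_ne_zero |>.1 hω)
    exact (ENNReal.toReal_eq_toReal_iff' (hzt ω) (hwt ω)).1 this
  · refine ((i1.sub i2).add (i3.sub i2)).congr (Eventually.of_forall fun ω => ?_)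
    simp only [Pi.add_apply, Pi.sub_apply]; ring

section condIndep

variable {Ω Γ Γ' E : Type*} [MeasurableSpace Ω] [MeasurableSpace Γ] [MeasurableSpace Γ']
  [MeasurableSpace E] [StandardBorelSpace E] [Nonempty E] {μ : Measure Ω} [IsProbabilityMeasure μ]

lemma lintegral_indicator_mul_eq_condDistrib {ξ : Ω → E} {G : Ω → Γ} (hξ : Measurable ξ)
    (hG : Measurable G) {A : Set E} (hA : MeasurableSet A) {φ : Γ → ENNReal} (hφ : Measurable φ) :
    ∫⁻ ω, (ξ ⁻¹' A).indicator 1 ω * φ (G ω) ∂μ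
      = ∫⁻ ω, condDistrib ξ G μ (G ω) A * φ (G ω) ∂μ := by
  have hm : Measurable fun p : Γ × E => A.indicator 1 p.2 * φ p.1 :=
    ((measurable_const.indicator hA).comp measurable_snd).mul (hφ.comp measurable_fst)
  have h1 : ∫⁻ p, A.indicator 1 p.2 * φ p.1 ∂(μ.map fun ω => (G ω, ξ ω))
      = ∫⁻ ω, (ξ ⁻¹' A).indicator 1 ω * φ (G ω) ∂μ := by
    rw [lintegral_map hm (by fun_prop)]
    rfl
  rw [← h1, ← compProd_map_condDistrib hξ.aemeasurable, Measure.lintegral_compProd hm,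
    lintegral_map _ hG]
  · refine lintegral_congr fun ω => ?_
    have hA1 : Measurable (A.indicator (1 : E → ENNReal)) := measurable_one.indicator hA
    simp only
    rw [lintegral_mul_const _ hA1, lintegral_indicator_one hA]
  · exact hm.lintegral_kernel_prod_right'

/-- Two nested conditional probabilities with the same second moment agree: if conditioning `ξ` on
`G'` has no larger second moment than conditioning it on a function `G` of `G'`, then `ξ` is
conditionally independent of `G'` given `G`. -/
lemma condDistrib_ae_eq_of_lintegral_sq_eq {ξ : Ω → E} {G : Ω → Γ} {G' : Ω → Γ'}
    (hξ : Measurable ξ) (hG : Measurable G) (hG' : Measurable G') {θ : Γ' → Γ} (hθ : Measurable θ)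
    (hθG : ∀ ω, G ω = θ (G' ω)) {A : Set E} (hA : MeasurableSet A)
    (h : ∫⁻ ω, condDistrib ξ G' μ (G' ω) A * condDistrib ξ G' μ (G' ω) A ∂μ
      = ∫⁻ ω, condDistrib ξ G μ (G ω) A * condDistrib ξ G μ (G ω) A ∂μ) :
    (fun ω => condDistrib ξ G' μ (G' ω) A) =ᵐ[μ] fun ω => condDistrib ξ G μ (G ω) A := by
  have hκ : Measurable fun γ => condDistrib ξ G μ γ A := Kernel.measurable_coe _ hA
  have hκ' : Measurable fun γ => condDistrib ξ G' μ γ A := Kernel.measurable_coe _ hA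
  have e1 := lintegral_indicator_mul_eq_condDistrib (μ := μ) hξ hG hA hκ
  have e2 := lintegral_indicator_mul_eq_condDistrib (μ := μ) hξ hG' hA (hκ.comp hθ)
  simp only [Function.comp_apply, ← hθG] at e2
  have e3 := e1.symm.trans e2
  refine ae_eq_of_lintegral_mul_eq (hκ'.comp hG') (hκ.comp hG) (fun _ => prob_le_one)
    (fun _ => prob_le_one) (h.trans e3) e3

lemma measure_inter_eq_of_condDistrib_ae_eq {ξ : Ω → E} {G' : Ω → Γ'}
    (hξ : Measurable ξ) (hG' : Measurable G') {A : Set E} (hA : MeasurableSet A) {w : Ω → ENNReal}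
    (h : (fun ω => condDistrib ξ G' μ (G' ω) A) =ᵐ[μ] w) {C : Set Γ'} (hC : MeasurableSet C) :
    μ (G' ⁻¹' C ∩ ξ ⁻¹' A) = ∫⁻ ω in G' ⁻¹' C, w ω ∂μ := by
  rw [← setLIntegral_preimage_condDistrib hG' hξ.aemeasurable hA hC]
  exact lintegral_congr_ae (ae_restrict_of_ae h)

end condIndep

section exchangeable

variable {Ω Γ E : Type*} [MeasurableSpace Ω] [MeasurableSpace Γ] [MeasurableSpace E]
  {μ : Measure Ω}

/-- The sequence `b` is exchangeable over `a`: its joint law with `a` does not change when one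
passes to a subsequence, in any order. -/
def IsExchangeableOver (μ : Measure Ω) (a : Ω → Γ) (b : ℕ → Ω → E) : Prop :=
  ∀ ρ : ℕ → ℕ, Function.Injective ρ →
    μ.map (fun ω => (a ω, fun r => b (ρ r) ω)) = μ.map (fun ω => (a ω, fun r => b r ω))

variable {a : Ω → Γ} {b : ℕ → Ω → E}

lemma IsExchangeableOver.map_eq (h : IsExchangeableOver μ a b) (ha : Measurable a)
    (hb : ∀ r, Measurable (b r)) {ρ τ : ℕ → ℕ} (hρ : Function.Injective ρ)
    (hτ : Function.Injective τ) {F : Type*} [MeasurableSpace F] {f : Γ × (ℕ → E) → F}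
    (hf : Measurable f) :
    μ.map (fun ω => f (a ω, fun r => b (ρ r) ω))
      = μ.map (fun ω => f (a ω, fun r => b (τ r) ω)) := by
  have := congrArg (Measure.map f) ((h ρ hρ).trans (h τ hτ).symm)
  rwa [Measure.map_map hf (by fun_prop), Measure.map_map hf (by fun_prop)] at this

lemma injective_natCases {n k : ℕ} (h : n < k) :
    Function.Injective (fun r : ℕ => Nat.casesOn r n (fun r => r + k) : ℕ → ℕ) := by
  rintro (_ | r) (_ | s) hrs <;> simp at hrs ⊢ <;> omega

variable [StandardBorelSpace E] [Nonempty E] [IsProbabilityMeasure μ]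

/-- Given `a` and the terms `b 2, b 3, …`, the term `b 0` is conditionally independent of
`b 1`. -/
lemma IsExchangeableOver.condDistrib_tail_ae_eq (h : IsExchangeableOver μ a b) (ha : Measurable a)
    (hb : ∀ r, Measurable (b r)) {A : Set E} (hA : MeasurableSet A) :
    (fun ω => condDistrib (b 0) (fun ω => (a ω, fun r => b (r + 1) ω)) μ
      (a ω, fun r => b (r + 1) ω) A) =ᵐ[μ]
    fun ω => condDistrib (b 0) (fun ω => (a ω, fun r => b (r + 2) ω)) μ
      (a ω, fun r => b (r + 2) ω) A := by
  have hG : Measurable fun ω => (a ω, fun r => b (r + 2) ω) := by fun_prop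
  have hG' : Measurable fun ω => (a ω, fun r => b (r + 1) ω) := by fun_prop
  have hlaw : μ.map (fun ω => ((a ω, fun r => b (r + 1) ω), b 0 ω))
      = μ.map (fun ω => ((a ω, fun r => b (r + 2) ω), b 0 ω)) :=
    h.map_eq ha hb (injective_natCases (n := 0) (k := 1) (by norm_num))
      (injective_natCases (n := 0) (k := 2) (by norm_num))
      (f := fun p => ((p.1, fun r => p.2 (r + 1)), p.2 0)) (by fun_prop)
  have hlaw1 : μ.map (fun ω => (a ω, fun r => b (r + 1) ω))
      = μ.map (fun ω => (a ω, fun r => b (r + 2) ω)) :=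
    h.map_eq ha hb (ρ := fun r => r + 1) (τ := fun r => r + 2) (add_left_injective 1)
      (add_left_injective 2) measurable_id
  have hk : condDistrib (b 0) (fun ω => (a ω, fun r => b (r + 1) ω)) μ
      = condDistrib (b 0) (fun ω => (a ω, fun r => b (r + 2) ω)) μ := by
    simp only [condDistrib, hlaw]
  -- the two conditional laws are the same kernel, evaluated at sequences with the same law
  refine condDistrib_ae_eq_of_lintegral_sq_eq (hb 0) hG hG'
    (θ := fun p => (p.1, fun r => p.2 (r + 1))) (by fun_prop) (fun ω => rfl) hA ?_
  rw [hk]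
  set κ := condDistrib (b 0) (fun ω => (a ω, fun r => b (r + 2) ω)) μ
  have hκ : Measurable fun γ => κ γ A * κ γ A :=
    (Kernel.measurable_coe _ hA).mul (Kernel.measurable_coe _ hA)
  rw [← lintegral_map hκ hG', hlaw1, lintegral_map hκ hG]

/-- The second moment of the conditional probability that `b 0` lies in `A` is the probability that
`b 0` and `b 1` lie in `A`. In particular it does not involve `a`. -/
lemma IsExchangeableOver.measure_inter_eq (h : IsExchangeableOver μ a b) (ha : Measurable a)
    (hb : ∀ r, Measurable (b r)) {A : Set E} (hA : MeasurableSet A) :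
    μ (b 1 ⁻¹' A ∩ b 0 ⁻¹' A) =
      ∫⁻ ω, condDistrib (b 0) (fun ω => (a ω, fun r => b (r + 2) ω)) μ
          (a ω, fun r => b (r + 2) ω) A
        * condDistrib (b 0) (fun ω => (a ω, fun r => b (r + 2) ω)) μ
          (a ω, fun r => b (r + 2) ω) A ∂μ := by
  have hG : Measurable fun ω => (a ω, fun r => b (r + 2) ω) := by fun_prop
  have hG' : Measurable fun ω => (a ω, fun r => b (r + 1) ω) := by fun_prop
  have h1 := measure_inter_eq_of_condDistrib_ae_eq (hb 0) hG' hA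
    (h.condDistrib_tail_ae_eq ha hb hA) (C := {p | p.2 0 ∈ A})
    ((measurable_pi_apply 0).comp measurable_snd hA)
  have hlaw : μ.map (fun ω => ((a ω, fun r => b (r + 2) ω), b 1 ω))
      = μ.map (fun ω => ((a ω, fun r => b (r + 2) ω), b 0 ω)) :=
    h.map_eq ha hb (injective_natCases (n := 1) (k := 2) (by norm_num))
      (injective_natCases (n := 0) (k := 2) (by norm_num))
      (f := fun p => ((p.1, fun r => p.2 (r + 1)), p.2 0)) (by fun_prop)
  have hκ : Measurable fun γ => condDistrib (b 0) (fun ω => (a ω, fun r => b (r + 2) ω)) μ γ A :=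
    Kernel.measurable_coe _ hA
  rw [← lintegral_indicator_mul_eq_condDistrib (hb 0) hG hA hκ]
  refine h1.trans ?_
  set κ := condDistrib (b 0) (fun ω => (a ω, fun r => b (r + 2) ω)) μ
  have hm : Measurable fun p : (Γ × (ℕ → E)) × E => A.indicator 1 p.2 * κ p.1 A :=
    ((measurable_const.indicator hA).comp measurable_snd).mul (hκ.comp measurable_fst)
  have h2 := lintegral_map (μ := μ) hm (hG.prodMk (hb 1))
  have h3 := lintegral_map (μ := μ) hm (hG.prodMk (hb 0))
  rw [hlaw, h3] at h2
  refine Eq.trans ?_ h2.symm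
  refine (lintegral_indicator (hb 1 hA) _).symm.trans ?_
  refine lintegral_congr fun ω => ?_
  by_cases hω : b 1 ω ∈ A <;> simp [Set.indicator, hω]

/-- An exchangeable sequence determines its own directing measure: the conditional law of `b 0`
given `a` and the tail depends on the tail only. -/
lemma IsExchangeableOver.condDistrib_ae_eq_unit (h : IsExchangeableOver μ a b) (ha : Measurable a)
    (hb : ∀ r, Measurable (b r)) {A : Set E} (hA : MeasurableSet A) :
    (fun ω => condDistrib (b 0) (fun ω => (a ω, fun r => b (r + 2) ω)) μ
      (a ω, fun r => b (r + 2) ω) A) =ᵐ[μ]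
    fun ω => condDistrib (b 0) (fun ω => ((), fun r => b (r + 2) ω)) μ
      ((), fun r => b (r + 2) ω) A := by
  have hu : IsExchangeableOver μ (fun _ => ()) b := fun ρ hρ =>
    h.map_eq ha hb hρ Function.injective_id (f := fun p => ((), p.2)) (by fun_prop)
  have e1 := h.measure_inter_eq ha hb hA
  rw [hu.measure_inter_eq measurable_const hb hA] at e1
  exact condDistrib_ae_eq_of_lintegral_sq_eq (hb 0) (by fun_prop) (by fun_prop)
    (θ := fun p : Γ × (ℕ → E) => ((), p.2)) (by fun_prop) (fun ω => rfl) hA e1.symm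

/-- The directing kernel of an exchangeable sequence: the conditional law of `b 0` given
`b 2, b 3, …`, regarded as a kernel on the values of `(a, b 2, b 3, …)` which ignores `a`. -/
def directingKernel (Γ : Type*) [MeasurableSpace Γ] (μ : Measure Ω) [IsProbabilityMeasure μ]
    (b : ℕ → Ω → E) : Kernel (Γ × (ℕ → E)) E :=
  (condDistrib (b 0) (fun ω => ((), fun r => b (r + 2) ω)) μ).comap
    (fun p : Γ × (ℕ → E) => ((), p.2)) (by fun_prop)

instance : IsMarkovKernel (directingKernel Γ μ b) := by
  unfold directingKernel; infer_instance

/-- Given `a` and the tail, `b 0` and `b 1` are independent with the law given by the directing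
kernel. -/
lemma IsExchangeableOver.map_eq_compProd (h : IsExchangeableOver μ a b) (ha : Measurable a)
    (hb : ∀ r, Measurable (b r)) :
    μ.map (fun ω => ((a ω, fun r => b (r + 2) ω), (b 0 ω, b 1 ω))) =
      μ.map (fun ω => (a ω, fun r => b (r + 2) ω))
        ⊗ₘ (directingKernel Γ μ b ×ₖ directingKernel Γ μ b) := by
  have hG : Measurable fun ω => (a ω, fun r => b (r + 2) ω) := by fun_prop
  have hG' : Measurable fun ω => (a ω, fun r => b (r + 1) ω) := by fun_prop
  set κ := directingKernel Γ μ b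
  have hκ : ∀ {A : Set E}, MeasurableSet A → Measurable fun γ => κ γ A :=
    fun hA => Kernel.measurable_coe _ hA
  have hlaw : μ.map (fun ω => ((a ω, fun r => b (r + 2) ω), b 1 ω))
      = μ.map (fun ω => ((a ω, fun r => b (r + 2) ω), b 0 ω)) :=
    h.map_eq ha hb (injective_natCases (n := 1) (k := 2) (by norm_num))
      (injective_natCases (n := 0) (k := 2) (by norm_num))
      (f := fun p => ((p.1, fun r => p.2 (r + 1)), p.2 0)) (by fun_prop)
  have : IsProbabilityMeasure (μ.map fun ω => (a ω, fun r => b (r + 2) ω)) :=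
    Measure.isProbabilityMeasure_map hG.aemeasurable
  have : IsProbabilityMeasure
      (μ.map fun ω => ((a ω, fun r => b (r + 2) ω), (b 0 ω, b 1 ω))) :=
    Measure.isProbabilityMeasure_map (by fun_prop)
  refine Measure.ext_prod₃ fun {C A A'} hC hA hA' => ?_
  rw [Measure.map_apply (by fun_prop) (hC.prod (hA.prod hA')),
    Measure.compProd_apply_prod hC (hA.prod hA'), setLIntegral_map hC
      (Kernel.measurable_coe _ (hA.prod hA')) hG]
  simp only [Kernel.prod_apply, Measure.prod_prod]
  have e1 : (fun ω => condDistrib (b 0) (fun ω => (a ω, fun r => b (r + 1) ω)) μ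
      (a ω, fun r => b (r + 1) ω) A) =ᵐ[μ] fun ω => κ (a ω, fun r => b (r + 2) ω) A :=
    (h.condDistrib_tail_ae_eq ha hb hA).trans (h.condDistrib_ae_eq_unit ha hb hA)
  have hC' : MeasurableSet {p : Γ × (ℕ → E) | p.2 0 ∈ A' ∧ (p.1, fun r => p.2 (r + 1)) ∈ C} :=
    ((measurable_pi_apply 0).comp measurable_snd hA').inter
      ((show Measurable fun p : Γ × (ℕ → E) => (p.1, fun r => p.2 (r + 1)) by fun_prop) hC)
  have e2 := measure_inter_eq_of_condDistrib_ae_eq (hb 0) hG' hA e1 hC'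
  have hm : Measurable fun p : (Γ × (ℕ → E)) × E =>
      A'.indicator 1 p.2 * C.indicator (fun γ => κ γ A) p.1 :=
    ((measurable_const.indicator hA').comp measurable_snd).mul
      (((hκ hA).indicator hC).comp measurable_fst)
  have h2 := lintegral_map (μ := μ) hm (hG.prodMk (hb 1))
  have h3 := lintegral_map (μ := μ) hm (hG.prodMk (hb 0))
  rw [hlaw, h3] at h2
  have h4 := lintegral_indicator_mul_eq_condDistrib (μ := μ) (hb 0) hG hA' ((hκ hA).indicator hC)
  have e3 := h.condDistrib_ae_eq_unit ha hb hA'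
  calc μ ((fun ω => ((a ω, fun r => b (r + 2) ω), (b 0 ω, b 1 ω))) ⁻¹' C ×ˢ A ×ˢ A')
      = μ ((fun ω => (a ω, fun r => b (r + 1) ω)) ⁻¹'
          {p : Γ × (ℕ → E) | p.2 0 ∈ A' ∧ (p.1, fun r => p.2 (r + 1)) ∈ C} ∩ b 0 ⁻¹' A) := by
        congr 1
        ext ω
        simp
        tauto
    _ = ∫⁻ ω, A'.indicator 1 (b 1 ω) *
          C.indicator (fun γ => κ γ A) (a ω, fun r => b (r + 2) ω) ∂μ := by
        refine e2.trans ((lintegral_indicator (hG' hC') _).symm.trans (lintegral_congr fun ω => ?_))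
        by_cases h1 : b 1 ω ∈ A' <;> by_cases h2 : (a ω, fun r => b (r + 2) ω) ∈ C <;>
          simp [Set.indicator, h1, h2]
    _ = ∫⁻ ω, A'.indicator 1 (b 0 ω) *
          C.indicator (fun γ => κ γ A) (a ω, fun r => b (r + 2) ω) ∂μ := h2.symm
    _ = ∫⁻ ω, κ (a ω, fun r => b (r + 2) ω) A' *
          C.indicator (fun γ => κ γ A) (a ω, fun r => b (r + 2) ω) ∂μ := by
        refine h4.trans (lintegral_congr_ae ?_)
        filter_upwards [e3] with ω hω
        rw [hω]
        rfl
    _ = _ := by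
        refine Eq.trans (lintegral_congr fun ω => ?_) (lintegral_indicator (hG hC) _)
        by_cases h2 : (a ω, fun r => b (r + 2) ω) ∈ C <;> simp [Set.indicator, h2, mul_comm]

/-- If `a` is square-close to the products of an exchangeable sequence over `a`, in the sense of the
second moment identity, then `a` is the conditional mean of `b 0` given the tail, so that it is a
function of the sequence `b`. -/
theorem IsExchangeableOver.exists_measurable_eq {a : Ω → ℝ} {b : ℕ → Ω → ℝ}
    (h : IsExchangeableOver μ a b) (ha : Measurable a) (hb : ∀ r, Measurable (b r))
    (h0 : HasExpectation μ (fun ω => a ω ^ 2 - 2 * a ω * b 0 ω + b 0 ω * b 1 ω) 0) :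
    ∃ F : (ℕ → ℝ) → ℝ, Measurable F ∧ ∀ᵐ ω ∂μ, a ω = F (fun r => b r ω) := by
  have hG : Measurable fun ω => (a ω, fun r => b (r + 2) ω) := by fun_prop
  have : IsProbabilityMeasure (μ.map fun ω => (a ω, fun r => b (r + 2) ω)) :=
    Measure.isProbabilityMeasure_map hG.aemeasurable
  have hm : Measurable fun z : (ℝ × (ℕ → ℝ)) × ℝ × ℝ =>
      z.1.1 ^ 2 - 2 * z.1.1 * z.2.1 + z.2.1 * z.2.2 := by fun_prop
  have key := ae_eq_integral_of_integral_sq_eq_zero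
    (μ.map fun ω => (a ω, fun r => b (r + 2) ω)) (directingKernel ℝ μ b)
    (b := fun _ x => x) (a := fun γ => γ.1) (by
      rw [← h.map_eq_compProd ha hb]
      refine ⟨(integrable_map_measure hm.aestronglyMeasurable (by fun_prop)).2 h0.1, ?_⟩
      rw [integral_map (by fun_prop) hm.aestronglyMeasurable]
      exact h0.2)
  refine ⟨fun x => ∫ y, y ∂(condDistrib (b 0) (fun ω => ((), fun r => b (r + 2) ω)) μ
    ((), fun r => x (r + 2))), ?_, ?_⟩
  · have h1 : StronglyMeasurable fun p : Unit × (ℕ → ℝ) =>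
        ∫ y, y ∂(condDistrib (b 0) (fun ω => ((), fun r => b (r + 2) ω)) μ p) :=
      (stronglyMeasurable_id.comp_measurable measurable_snd).integral_kernel_prod_right'
    exact h1.measurable.comp (by fun_prop)
  · filter_upwards [ae_of_ae_map hG.aemeasurable key] with ω hω
    exact hω.2

end exchangeable

/-! ### Exchangeability of density arrays under injections -/

section exchange

/-- An injection of `ℕ` agrees on the first `m` numbers with a finite permutation. -/
lemma exists_perm_extending (ρ : ℕ → ℕ) (hρ : Function.Injective ρ) (m : ℕ) :
    ∃ (N : ℕ) (hN : m ≤ N + 1) (σ : Equiv.Perm (Fin (N + 1))),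
      ∀ (i : ℕ) (hi : i < m), ((σ ⟨i, hi.trans_le hN⟩ : Fin (N + 1)) : ℕ) = ρ i := by
  obtain ⟨N, hN, hρN⟩ : ∃ N, m ≤ N + 1 ∧ ∀ i < m, ρ i < N + 1 := by
    refine ⟨m + (Finset.range m).sup ρ, by omega, fun i hi => ?_⟩
    have := Finset.le_sup (f := ρ) (Finset.mem_range.2 hi)
    omega
  have himg : Finset.image (fun i : Fin (N + 1) => ρ i)
      (Finset.univ.filter fun i : Fin (N + 1) => (i : ℕ) < m) ⊆ Finset.range (N + 1) := by
    intro x hx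
    simp only [Finset.mem_image, Finset.mem_filter, Finset.mem_univ, true_and] at hx
    obtain ⟨i, hi, rfl⟩ := hx
    exact Finset.mem_range.2 (hρN _ hi)
  obtain ⟨g, hg⟩ := Finset.exists_equiv_extend_of_card_eq (α := Fin (N + 1))
    (t := Finset.range (N + 1)) (by simp) himg
    (fun i _ j _ hij => Fin.ext (hρ hij))
  refine ⟨N, hN, g.trans ⟨fun x => ⟨x, Finset.mem_range.1 x.2⟩,
    fun i => ⟨i, Finset.mem_range.2 i.2⟩, fun x => rfl, fun x => rfl⟩, fun i hi => ?_⟩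
  exact hg ⟨i, hi.trans_le hN⟩ (by simpa using hi)

variable {Ω : Type*} [MeasurableSpace Ω] {μ : Measure Ω}
  {X : ℕ → ℕ → Ω → PosReal → ℝ}

lemma IsDensityArray.measurable_apply (hX : IsDensityArray μ X) (i j : ℕ) (t : PosReal) :
    Measurable fun ω => X i j ω t :=
  (measurable_pi_apply t).comp (hX.measurable i j)

lemma IsDensityArray.measurable_array (hX : IsDensityArray μ X) (ρ : ℕ → ℕ) :
    Measurable fun ω (i j : ℕ) => X (ρ i) (ρ j) ω :=
  measurable_pi_lambda _ fun _ => measurable_pi_lambda _ fun _ => hX.measurable _ _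

variable [IsProbabilityMeasure μ]

/-- The law of a density array does not change when one passes to a subsequence of the indices,
in any order. -/
lemma IsDensityArray.map_injective (hX : IsDensityArray μ X) {ρ : ℕ → ℕ}
    (hρ : Function.Injective ρ) :
    μ.map (fun ω (i j : ℕ) => X (ρ i) (ρ j) ω) = μ.map (fun ω (i j : ℕ) => X i j ω) := by
  have hm : ∀ ρ : ℕ → ℕ, Measurable fun ω (p : ℕ × ℕ) => X (ρ p.1) (ρ p.2) ω :=
    fun ρ => measurable_pi_lambda _ fun p => hX.measurable _ _
  have hm1 : Measurable fun ω (p : ℕ × ℕ) => X p.1 p.2 ω := hm id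
  have key : μ.map (fun ω (p : ℕ × ℕ) => X (ρ p.1) (ρ p.2) ω)
      = μ.map (fun ω (p : ℕ × ℕ) => X p.1 p.2 ω) := by
    have hpm : IsProbabilityMeasure (μ.map (fun ω (p : ℕ × ℕ) => X p.1 p.2 ω)) :=
      Measure.isProbabilityMeasure_map hm1.aemeasurable
    refine IsProjectiveLimit.unique
      (P := fun I => (μ.map (fun ω (p : ℕ × ℕ) => X p.1 p.2 ω)).map I.restrict) ?_ fun I => rfl
    intro I
    obtain ⟨m, hmI⟩ : ∃ m, ∀ p ∈ I, p.1 < m ∧ p.2 < m := by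
      refine ⟨I.sup (fun p => p.1 + p.2) + 1, fun p hp => ?_⟩
      have := Finset.le_sup (f := fun p : ℕ × ℕ => p.1 + p.2) hp
      omega
    obtain ⟨N, hN, σ, hσ⟩ := exists_perm_extending ρ hρ m
    have hI : ∀ p : I, p.1.1 < m ∧ p.1.2 < m := fun p => hmI p.1 p.2
    have hf : Measurable fun (x : Fin (N + 1) → Fin (N + 1) → PosReal → ℝ) (p : I) =>
        x ⟨p.1.1, (hI p).1.trans_le hN⟩ ⟨p.1.2, (hI p).2.trans_le hN⟩ :=
      measurable_pi_lambda _ fun p => (measurable_pi_apply _).comp (measurable_pi_apply _)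
    have h1 := ((hX.exchangeable N σ).comp hf).map_eq
    rw [Measure.map_map (Finset.measurable_restrict I) (hm ρ)]
    refine Eq.trans ?_ (Measure.map_map (Finset.measurable_restrict I) hm1).symm
    refine Eq.trans ?_ h1.symm
    congr 1
    ext ω p t
    simp only [Function.comp_apply, Finset.restrict, hσ _ (hI p).1, hσ _ (hI p).2]
  have hc : Measurable fun (x : ℕ × ℕ → PosReal → ℝ) (i j : ℕ) => x (i, j) :=
    measurable_pi_lambda _ fun i => measurable_pi_lambda _ fun j => measurable_pi_apply _
  have := congrArg (Measure.map fun (x : ℕ × ℕ → PosReal → ℝ) (i j : ℕ) => x (i, j)) key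
  rwa [Measure.map_map hc (hm ρ), Measure.map_map hc hm1] at this

lemma IsDensityArray.map_comp_eq (hX : IsDensityArray μ X) {ρ τ : ℕ → ℕ}
    (hρ : Function.Injective ρ) (hτ : Function.Injective τ) {F : Type*} [MeasurableSpace F]
    {f : (ℕ → ℕ → PosReal → ℝ) → F} (hf : Measurable f) :
    μ.map (fun ω => f fun i j => X (ρ i) (ρ j) ω)
      = μ.map (fun ω => f fun i j => X (τ i) (τ j) ω) := by
  have := congrArg (Measure.map f) ((hX.map_injective hρ).trans (hX.map_injective hτ).symm)
  rwa [Measure.map_map hf (hX.measurable_array ρ),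
    Measure.map_map hf (hX.measurable_array τ)] at this

lemma IsDensityArray.ae_of_ae (hX : IsDensityArray μ X) {ρ : ℕ → ℕ}
    (hρ : Function.Injective ρ) {P : (ℕ → ℕ → PosReal → ℝ) → Prop} (hP : MeasurableSet {x | P x})
    (h : ∀ᵐ ω ∂μ, P fun i j => X i j ω) : ∀ᵐ ω ∂μ, P fun i j => X (ρ i) (ρ j) ω := by
  have h1 : ∀ᵐ x ∂(μ.map fun ω (i j : ℕ) => X i j ω), P x :=
    (ae_map_iff (hX.measurable_array id).aemeasurable hP).2 h
  rw [← hX.map_injective hρ] at h1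
  exact (ae_map_iff (hX.measurable_array ρ).aemeasurable hP).1 h1

/-! ### The entries of the array as functions of the reference columns -/

/-- Half of a time. -/
def half (t : PosReal) : PosReal := ⟨t / 2, half_pos t.2⟩

lemma half_add_half (t : PosReal) : half t + half t = t :=
  Subtype.ext (add_halves (t : ℝ))

lemma measurable_eval3 (i j : ℕ) (t : PosReal) :
    Measurable fun x : ℕ → ℕ → PosReal → ℝ => x i j t :=
  (measurable_pi_apply t).comp ((measurable_pi_apply j).comp (measurable_pi_apply i))

/-- The products `X 0 r * X r j` at half of the time `t`, whose conditional mean is `X 0 j` at time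
`t` by the Chapman-Kolmogorov equation, form an exchangeable sequence over `X 0 j`. The indices
`r` are shifted by `2`, which leaves out the two indices `0` and `j ≤ 1`. -/
lemma isExchangeableOver_products (hX : IsDensityArray μ X) (t : PosReal) (j : ℕ) (hj : j < 2) :
    IsExchangeableOver μ (fun ω => X 0 j ω t)
      (fun r ω => X 0 (r + 2) ω (half t) * X (r + 2) j ω (half t)) := by
  intro ρ hρ
  have hinj : Function.Injective (fun r : ℕ => if r < 2 then r else ρ (r - 2) + 2) := by
    intro r s hrs
    by_cases h1 : r < 2 <;> by_cases h2 : s < 2 <;> simp [h1, h2] at hrs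
    · exact hrs
    · omega
    · omega
    · have := hρ hrs
      omega
  have := hX.map_comp_eq hinj Function.injective_id
    (f := fun x => (x 0 j t, fun r => x 0 (r + 2) (half t) * x (r + 2) j (half t)))
    ((measurable_eval3 _ _ _).prodMk (measurable_pi_lambda _ fun r =>
      (measurable_eval3 _ _ _).mul (measurable_eval3 _ _ _)))
  simpa [hj] using this

/-- The enumeration `2 i, 2 j, 1, 3, 5, …`: two sample points of even index, followed by the
reference points, which have odd index. -/
def pairEmb (i j : ℕ) (r : ℕ) : ℕ :=
  if r = 0 then 2 * i else if r = 1 then 2 * j else 2 * (r - 2) + 1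

lemma pairEmb_injective {i j : ℕ} (h : i ≠ j) : Function.Injective (pairEmb i j) := by
  intro r s hrs
  unfold pairEmb at hrs
  split_ifs at hrs <;> omega

/-- The entry at two distinct sample points is a function of their entries against the reference
points, at half of the time. -/
lemma exists_offDiagonal_function (hX : IsDensityArray μ X) (t : PosReal) :
    ∃ F : (ℕ → ℝ) → ℝ, Measurable F ∧ ∀ i j : ℕ, i ≠ j → ∀ᵐ ω ∂μ,
      X (2 * i) (2 * j) ω t
        = F fun r => X (2 * i) (2 * r + 1) ω (half t) * X (2 * r + 1) (2 * j) ω (half t) := by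
  have hm := fun i j t => hX.measurable_apply i j t
  obtain ⟨F, hF, hFe⟩ := (isExchangeableOver_products hX t 1 (by norm_num)).exists_measurable_eq
    (hm _ _ _) (fun r => (hm _ _ _).mul (hm _ _ _)) (by
      convert hX.chapmanKolmogorov (half t) (half t) using 1
      ext ω
      rw [half_add_half]
      ring)
  refine ⟨F, hF, fun i j hij => ?_⟩
  have := hX.ae_of_ae (pairEmb_injective hij)
    (P := fun x => x 0 1 t = F fun r => x 0 (r + 2) (half t) * x (r + 2) 1 (half t))
    (measurableSet_eq_fun (measurable_eval3 _ _ _) (hF.comp (measurable_pi_lambda _ fun r =>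
      (measurable_eval3 _ _ _).mul (measurable_eval3 _ _ _)))) hFe
  simpa [pairEmb] using this

/-- The diagonal entry at a sample point is a function of its entries against the reference points,
at half of the time. -/
lemma exists_diagonal_function (hX : IsDensityArray μ X) (t : PosReal) :
    ∃ F : (ℕ → ℝ) → ℝ, Measurable F ∧ ∀ i : ℕ, ∀ᵐ ω ∂μ,
      X (2 * i) (2 * i) ω t
        = F fun r => X (2 * i) (2 * r + 1) ω (half t) * X (2 * r + 1) (2 * i) ω (half t) := by
  have hm := fun i j t => hX.measurable_apply i j t
  obtain ⟨F, hF, hFe⟩ := (isExchangeableOver_products hX t 0 (by norm_num)).exists_measurable_eq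
    (hm _ _ _) (fun r => (hm _ _ _).mul (hm _ _ _)) (by
      convert hX.diagonalChapmanKolmogorov (half t) (half t) using 1
      ext ω
      rw [half_add_half]
      ring)
  refine ⟨F, hF, fun i => ?_⟩
  have := hX.ae_of_ae (pairEmb_injective (Nat.succ_ne_self i).symm)
    (P := fun x => x 0 0 t = F fun r => x 0 (r + 2) (half t) * x (r + 2) 0 (half t))
    (measurableSet_eq_fun (measurable_eval3 _ _ _) (hF.comp (measurable_pi_lambda _ fun r =>
      (measurable_eval3 _ _ _).mul (measurable_eval3 _ _ _)))) hFe
  simpa [pairEmb] using this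

end exchange

/-! ### Sample points are conditionally independent given the reference array -/

section sample

variable {Ω : Type*} [MeasurableSpace Ω] {μ : Measure Ω} {X : ℕ → ℕ → Ω → PosReal → ℝ}
  {D : Set PosReal}

/-- A point as it is seen from the reference points: its entries against the reference sequence,
in both orders, at the times in `D`. -/
abbrev RefPoint (D : Set PosReal) : Type := ℕ → D → ℝ × ℝ

/-- The sample point with index `2 i`, seen from the reference points, which have odd indices. -/
def refPoint (X : ℕ → ℕ → Ω → PosReal → ℝ) (D : Set PosReal) (i : ℕ) (ω : Ω) : RefPoint D :=
  fun r t => (X (2 * i) (2 * r + 1) ω t, X (2 * r + 1) (2 * i) ω t)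

/-- The array of the reference points. -/
def refArray (X : ℕ → ℕ → Ω → PosReal → ℝ) (D : Set PosReal) (ω : Ω) : ℕ → ℕ → D → ℝ :=
  fun r s t => X (2 * r + 1) (2 * s + 1) ω t

lemma measurable_refPoint (hX : IsDensityArray μ X) (i : ℕ) : Measurable (refPoint X D i) :=
  measurable_pi_lambda _ fun _ => measurable_pi_lambda _ fun _ =>
    (hX.measurable_apply _ _ _).prodMk (hX.measurable_apply _ _ _)

lemma measurable_refArray (hX : IsDensityArray μ X) : Measurable (refArray X D) :=
  measurable_pi_lambda _ fun _ => measurable_pi_lambda _ fun _ => measurable_pi_lambda _ fun _ =>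
    hX.measurable_apply _ _ _

/-- An enumeration of the odd numbers and of the first `k` even numbers which lists the first `r₀`
odd numbers first. -/
def mixEnum (k r₀ r : ℕ) : ℕ :=
  if r < r₀ then 2 * r + 1 else if r < r₀ + k then 2 * (r - r₀) else 2 * (r - k) + 1

lemma mixEnum_injective (k r₀ : ℕ) : Function.Injective (mixEnum k r₀) := by
  intro r s h
  unfold mixEnum at h
  split_ifs at h <;> omega

/-- The position of the odd number `2 r + 1` in `mixEnum k r₀`. -/
def mixPos (k r₀ r : ℕ) : ℕ := if r < r₀ then r else r + k

lemma mixEnum_mixPos (k r₀ r : ℕ) : mixEnum k r₀ (mixPos k r₀ r) = 2 * r + 1 := by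
  unfold mixEnum mixPos
  split_ifs <;> omega

lemma mixEnum_add (k r₀ i : ℕ) (hi : i < k) : mixEnum k r₀ (r₀ + i) = 2 * i := by
  unfold mixEnum
  split_ifs <;> omega

/-- An injection which sends `0` to `n`, followed by `e`. -/
def consEnum (n : ℕ) (e : ℕ → ℕ) (r : ℕ) : ℕ := Nat.casesOn r n e

lemma consEnum_injective {n : ℕ} {e : ℕ → ℕ} (he : Function.Injective e) (hn : ∀ r, e r ≠ n) :
    Function.Injective (consEnum n e) := by
  rintro (_ | r) (_ | s) h
  · rfl
  · exact absurd h.symm (hn s)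
  · exact absurd h (hn r)
  · exact congrArg _ (he h)

variable [IsProbabilityMeasure μ]

lemma map_refArray_refPoint (hX : IsDensityArray μ X) (i : ℕ) :
    μ.map (fun ω => (refArray X D ω, refPoint X D i ω))
      = μ.map (fun ω => (refArray X D ω, refPoint X D 0 ω)) := by
  have hinj : ∀ i, Function.Injective (consEnum (2 * i) fun r => 2 * r + 1) := fun i =>
    consEnum_injective (fun r s h => by simpa using h) fun r => by omega
  exact hX.map_comp_eq (hinj i) (hinj 0)
    (f := fun x => ((fun r s (t : D) => x (r + 1) (s + 1) t, fun r (t : D) =>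
      (x 0 (r + 1) t, x (r + 1) 0 t)) : (ℕ → ℕ → D → ℝ) × RefPoint D))
    (Measurable.prodMk
      (measurable_pi_lambda _ fun _ => measurable_pi_lambda _ fun _ =>
        measurable_pi_lambda _ fun _ => measurable_eval3 _ _ _)
      (measurable_pi_lambda _ fun _ => measurable_pi_lambda _ fun _ =>
        (measurable_eval3 _ _ _).prodMk (measurable_eval3 _ _ _)))

lemma standardBorelSpace_pi_pi (ι : Type*) [Countable ι] (D : Set PosReal) [Countable D] :
    StandardBorelSpace (ι → D → ℝ × ℝ) :=
  StandardBorelSpace.pi_countable (α := fun _ : ι => D → ℝ × ℝ)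

instance (D : Set PosReal) [Countable D] : StandardBorelSpace (RefPoint D) :=
  standardBorelSpace_pi_pi ℕ D

variable [Countable D]

/-- The conditional law of a sample point given the reference array. -/
def refKernel (μ : Measure Ω) [IsProbabilityMeasure μ] (X : ℕ → ℕ → Ω → PosReal → ℝ)
    (D : Set PosReal) [Countable D] : Kernel (ℕ → ℕ → D → ℝ) (RefPoint D) :=
  condDistrib (refPoint X D 0) (refArray X D) μ

instance : IsMarkovKernel (refKernel μ X D) := by
  unfold refKernel; infer_instance

lemma condDistrib_refPoint (hX : IsDensityArray μ X) (i : ℕ) :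
    condDistrib (refPoint X D i) (refArray X D) μ = refKernel μ X D := by
  simp only [refKernel, condDistrib, map_refArray_refPoint hX i]

/-- The sample point `k` is conditionally independent of the previous sample points given the
reference array: the case of events which see finitely many reference points only, those before
`r₀`. The first `k` sample points are inserted after the position `r₀` of the reference sequence.
By exchangeability, the enlarged reference sequence and the part of the sample point `k` seen by
the event have the same joint law as before, so that the conditional probabilities have the same
second moment. -/
lemma measure_inter_cylinder (hX : IsDensityArray μ X) (k : ℕ)
    {C : Set ((ℕ → ℕ → D → ℝ) × (Fin k → RefPoint D))} (hC : MeasurableSet C)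
    {A : Set (RefPoint D)} (hA : A ∈ measurableCylinders fun _ : ℕ => D → ℝ × ℝ) :
    μ ((fun ω => (refArray X D ω, fun i : Fin k => refPoint X D i ω)) ⁻¹' C ∩
        refPoint X D k ⁻¹' A)
      = ∫⁻ ω in (fun ω => (refArray X D ω, fun i : Fin k => refPoint X D i ω)) ⁻¹' C,
          refKernel μ X D (refArray X D ω) A ∂μ := by
  obtain ⟨s, S, hS, rfl⟩ := (mem_measurableCylinders A).1 hA
  obtain ⟨r₀, hr₀⟩ : ∃ r₀, ∀ r ∈ s, r < r₀ :=
    ⟨s.sup id + 1, fun r hr => Nat.lt_succ_of_le (Finset.le_sup (f := id) hr)⟩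
  have := standardBorelSpace_pi_pi s D
  -- the reference array, enlarged by the first `k` sample points
  let G' : Ω → ℕ → ℕ → D → ℝ := fun ω r r' t => X (mixEnum k r₀ r) (mixEnum k r₀ r') ω t
  have hG' : Measurable G' :=
    measurable_pi_lambda _ fun _ => measurable_pi_lambda _ fun _ => measurable_pi_lambda _ fun _ =>
      hX.measurable_apply _ _ _
  have hG := measurable_refArray (D := D) hX
  let ξ : Ω → s → D → ℝ × ℝ := fun ω => s.restrict (refPoint X D k ω)
  have hξ : Measurable ξ := (Finset.measurable_restrict s).comp (measurable_refPoint hX k)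
  let f : (ℕ → ℕ → PosReal → ℝ) → (ℕ → ℕ → D → ℝ) × (s → D → ℝ × ℝ) := fun x =>
    (fun r s t => x (r + 1) (s + 1) t, fun r t => (x 0 (r + 1) t, x (r + 1) 0 t))
  have hf : Measurable f := Measurable.prodMk
      (measurable_pi_lambda _ fun _ => measurable_pi_lambda _ fun _ =>
        measurable_pi_lambda _ fun _ => measurable_eval3 _ _ _)
      (measurable_pi_lambda _ fun _ => measurable_pi_lambda _ fun _ =>
        (measurable_eval3 _ _ _).prodMk (measurable_eval3 _ _ _))
  have hlaw : μ.map (fun ω => (G' ω, ξ ω)) = μ.map (fun ω => (refArray X D ω, ξ ω)) := by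
    have h1 := hX.map_comp_eq
      (ρ := consEnum (2 * k) (mixEnum k r₀)) (τ := consEnum (2 * k) fun r => 2 * r + 1)
      (consEnum_injective (mixEnum_injective k r₀) fun r => by
        unfold mixEnum; split_ifs <;> omega)
      (consEnum_injective (fun r s h => by simpa using h) fun r => by omega) hf
    refine Eq.trans ?_ h1
    congr 1
    ext ω : 1
    refine Prod.ext rfl ?_
    ext r t : 2
    have : mixEnum k r₀ r = 2 * r + 1 := if_pos (hr₀ r r.2)
    simp only [f, ξ, consEnum, refPoint, Finset.restrict, this]
    rfl
  have hlaw1 : μ.map G' = μ.map (refArray X D) := by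
    have := congrArg (Measure.map Prod.fst) hlaw
    rwa [Measure.map_map measurable_fst (hG'.prodMk hξ),
      Measure.map_map measurable_fst (hG.prodMk hξ)] at this
  have hk : condDistrib ξ G' μ = condDistrib ξ (refArray X D) μ := by
    simp only [condDistrib, hlaw]
  have e1 : (fun ω => condDistrib ξ G' μ (G' ω) S) =ᵐ[μ]
      fun ω => condDistrib ξ (refArray X D) μ (refArray X D ω) S := by
    refine condDistrib_ae_eq_of_lintegral_sq_eq hξ hG hG'
      (θ := fun x r r' => x (mixPos k r₀ r) (mixPos k r₀ r'))
      (measurable_pi_lambda _ fun _ => measurable_pi_lambda _ fun _ =>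
        (measurable_pi_apply _).comp (measurable_pi_apply _)) (fun ω => ?_) hS ?_
    · simp only [G', mixEnum_mixPos]
      rfl
    · rw [hk]
      set κ := condDistrib ξ (refArray X D) μ
      have hκ : Measurable fun γ => κ γ S * κ γ S :=
        (Kernel.measurable_coe _ hS).mul (Kernel.measurable_coe _ hS)
      rw [← lintegral_map hκ hG', hlaw1, lintegral_map hκ hG]
  have e2 : (fun ω => condDistrib ξ (refArray X D) μ (refArray X D ω) S) =ᵐ[μ]
      fun ω => refKernel μ X D (refArray X D ω) (cylinder s S) := by
    have h1 := condDistrib_comp (μ := μ) (mβ := inferInstance) (refArray X D)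
      (measurable_refPoint (D := D) hX k).aemeasurable
      (Finset.measurable_restrict (X := fun _ : ℕ => D → ℝ × ℝ) s)
    rw [condDistrib_refPoint hX] at h1
    filter_upwards [ae_of_ae_map hG.aemeasurable h1] with ω hω
    have : ξ = s.restrict ∘ refPoint X D k := rfl
    rw [this, hω, Kernel.map_apply' _ (Finset.measurable_restrict s) _ hS]
    rfl
  let θ : (ℕ → ℕ → D → ℝ) → (ℕ → ℕ → D → ℝ) × (Fin k → RefPoint D) := fun x =>
    (fun r r' => x (mixPos k r₀ r) (mixPos k r₀ r'),
      fun i r t => (x (r₀ + i) (mixPos k r₀ r) t, x (mixPos k r₀ r) (r₀ + i) t))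
  have hθ : Measurable θ := by
    have h3 : ∀ i j (t : D), Measurable fun x : ℕ → ℕ → D → ℝ => x i j t := fun i j t =>
      (measurable_pi_apply t).comp ((measurable_pi_apply j).comp (measurable_pi_apply i))
    refine Measurable.prodMk ?_ ?_
    · exact measurable_pi_lambda _ fun _ => measurable_pi_lambda _ fun _ =>
        measurable_pi_lambda _ fun _ => h3 _ _ _
    · exact measurable_pi_lambda _ fun _ => measurable_pi_lambda _ fun _ =>
        measurable_pi_lambda _ fun _ => (h3 _ _ _).prodMk (h3 _ _ _)
  have hθG : (fun ω => (refArray X D ω, fun i : Fin k => refPoint X D i ω)) = θ ∘ G' := by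
    ext ω : 1
    simp only [Function.comp_apply, θ, G', mixEnum_mixPos]
    refine Prod.ext rfl ?_
    ext i r t : 3
    simp only [mixEnum_add k r₀ i i.2]
    rfl
  have := measure_inter_eq_of_condDistrib_ae_eq hξ hG' hS (e1.trans e2) (hθ hC)
  rw [hθG]
  exact this

/-- The sample point `k` is conditionally independent of the previous sample points given the
reference array. -/
lemma measure_inter_refPoint (hX : IsDensityArray μ X) (k : ℕ)
    {C : Set ((ℕ → ℕ → D → ℝ) × (Fin k → RefPoint D))} (hC : MeasurableSet C)
    {A : Set (RefPoint D)} (hA : MeasurableSet A) :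
    μ ((fun ω => (refArray X D ω, fun i : Fin k => refPoint X D i ω)) ⁻¹' C ∩
        refPoint X D k ⁻¹' A)
      = ∫⁻ ω in (fun ω => (refArray X D ω, fun i : Fin k => refPoint X D i ω)) ⁻¹' C,
          refKernel μ X D (refArray X D ω) A ∂μ := by
  set P := (fun ω => (refArray X D ω, fun i : Fin k => refPoint X D i ω)) ⁻¹' C
  have hP : MeasurableSet P := ((measurable_refArray hX).prodMk
    (measurable_pi_lambda _ fun i : Fin k => measurable_refPoint hX (i : ℕ))) hC
  have hξ := measurable_refPoint (D := D) hX k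
  have hk : Measurable fun ω => refKernel μ X D (refArray X D ω) :=
    (refKernel μ X D).measurable.comp (measurable_refArray hX)
  have key : ((μ.restrict P).map (refPoint X D k))
      = (μ.restrict P).bind fun ω => refKernel μ X D (refArray X D ω) := by
    have hval : ∀ A : Set (RefPoint D), MeasurableSet A →
        ((μ.restrict P).map (refPoint X D k)) A = μ (P ∩ refPoint X D k ⁻¹' A) ∧
        ((μ.restrict P).bind fun ω => refKernel μ X D (refArray X D ω)) A
          = ∫⁻ ω in P, refKernel μ X D (refArray X D ω) A ∂μ := fun A hA => by
      rw [Measure.map_apply hξ hA, Measure.restrict_apply (hξ hA), Set.inter_comm,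
        Measure.bind_apply hA hk.aemeasurable]
      exact ⟨rfl, rfl⟩
    refine ext_of_generate_finite _ generateFrom_measurableCylinders.symm
      isPiSystem_measurableCylinders (fun A hA => ?_) ?_
    · obtain ⟨h1, h2⟩ := hval A (by
        obtain ⟨s, S, hS, rfl⟩ := (mem_measurableCylinders A).1 hA
        exact MeasurableSet.cylinder s hS)
      rw [h1, h2]
      exact measure_inter_cylinder hX k hC hA
    · obtain ⟨h1, h2⟩ := hval Set.univ MeasurableSet.univ
      rw [h1, h2]
      simp
  have h := congrArg (fun m => m A) key
  simp only [Measure.map_apply hξ hA, Measure.restrict_apply (hξ hA),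
    Measure.bind_apply hA hk.aemeasurable] at h
  rw [Set.inter_comm]
  exact h

end sample

/-! ### Representation of a density array by kernels -/

section piKernel

variable {Γ E : Type*} [MeasurableSpace Γ] [MeasurableSpace E]

/-- The kernel of `k` independent samples from a kernel. -/
def piKernel (κ : Kernel Γ E) [IsMarkovKernel κ] (k : ℕ) : Kernel Γ (Fin k → E) where
  toFun γ := Measure.pi fun _ => κ γ
  measurable' := by
    refine Measurable.measure_of_isPiSystem_of_isProbabilityMeasure generateFrom_pi.symm
      isPiSystem_pi ?_
    rintro _ ⟨A, hA, rfl⟩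
    simp only [Measure.pi_pi]
    exact Finset.measurable_prod _ fun i _ => Kernel.measurable_coe _ (hA i (Set.mem_univ i))

lemma piKernel_apply (κ : Kernel Γ E) [IsMarkovKernel κ] (k : ℕ) (γ : Γ) :
    piKernel κ k γ = Measure.pi fun _ => κ γ := rfl

instance (κ : Kernel Γ E) [IsMarkovKernel κ] (k : ℕ) : IsMarkovKernel (piKernel κ k) :=
  ⟨fun γ => by rw [piKernel_apply]; infer_instance⟩

lemma ext_prod_pi {k : ℕ} {m m' : Measure (Γ × (Fin k → E))} [IsFiniteMeasure m]
    (h : ∀ (B : Set Γ) (A : Fin k → Set E), MeasurableSet B → (∀ i, MeasurableSet (A i)) →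
      m (B ×ˢ Set.univ.pi A) = m' (B ×ˢ Set.univ.pi A)) : m = m' := by
  refine Measure.ext_prod fun {B A} hB hA => ?_
  have hval : ∀ (m : Measure (Γ × (Fin k → E))) (A : Set (Fin k → E)), MeasurableSet A →
      ((m.restrict (Prod.fst ⁻¹' B)).map Prod.snd) A = m (B ×ˢ A) := fun m A hA => by
    rw [Measure.map_apply measurable_snd hA, Measure.restrict_apply (measurable_snd hA)]
    congr 1
    ext p
    simp [and_comm]
  rw [← hval m A hA, ← hval m' A hA]
  congr 1
  refine ext_of_generate_finite _ generateFrom_pi.symm isPiSystem_pi ?_ ?_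
  · rintro _ ⟨A, hA, rfl⟩
    have hA' : ∀ i, MeasurableSet (A i) := fun i => hA i (Set.mem_univ i)
    rw [hval _ _ (MeasurableSet.univ_pi hA'), hval _ _ (MeasurableSet.univ_pi hA')]
    exact h B A hB hA'
  · rw [hval _ _ MeasurableSet.univ, hval _ _ MeasurableSet.univ]
    have := h B (fun _ => Set.univ) hB fun _ => MeasurableSet.univ
    rwa [Set.pi_univ] at this

end piKernel

section representation

variable {Ω : Type*} [MeasurableSpace Ω] {μ : Measure Ω} [IsProbabilityMeasure μ]
  {X : ℕ → ℕ → Ω → PosReal → ℝ} {D : Set PosReal} [Countable D]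

/-- Given the reference array, the sample points are independent and identically distributed. -/
lemma map_refArray_refPoints (hX : IsDensityArray μ X) (k : ℕ) :
    μ.map (fun ω => (refArray X D ω, fun i : Fin k => refPoint X D i ω))
      = μ.map (refArray X D) ⊗ₘ piKernel (refKernel μ X D) k := by
  have hY := measurable_refArray (D := D) hX
  have hξ : ∀ k, Measurable fun ω => fun i : Fin k => refPoint X D i ω := fun k =>
    measurable_pi_lambda _ fun i : Fin k => measurable_refPoint hX (i : ℕ)
  have hp : IsProbabilityMeasure (μ.map (refArray X D)) :=
    Measure.isProbabilityMeasure_map hY.aemeasurable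
  have hp' : ∀ k, IsProbabilityMeasure
      (μ.map (fun ω => (refArray X D ω, fun i : Fin k => refPoint X D i ω))) := fun k =>
    Measure.isProbabilityMeasure_map (hY.prodMk (hξ k)).aemeasurable
  induction k with
  | zero =>
    refine ext_prod_pi fun B A hB hA => ?_
    rw [Measure.map_apply (hY.prodMk (hξ 0)) (hB.prod (MeasurableSet.univ_pi hA)),
      Measure.compProd_apply_prod hB (MeasurableSet.univ_pi hA)]
    simp only [piKernel_apply, Measure.pi_pi]
    simp only [Finset.univ_eq_empty, Finset.prod_empty, setLIntegral_one]
    rw [Measure.map_apply hY hB]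
    congr 1
    ext ω
    simp
  | succ k ih =>
    refine ext_prod_pi fun B A hB hA => ?_
    have hbox : MeasurableSet (Set.univ.pi fun i : Fin k => A i.castSucc) :=
      MeasurableSet.univ_pi fun i => hA _
    have hκ : Measurable fun p : (ℕ → ℕ → D → ℝ) × (Fin k → RefPoint D) =>
        refKernel μ X D p.1 (A (Fin.last k)) :=
      (Kernel.measurable_coe _ (hA _)).comp measurable_fst
    rw [Measure.map_apply (hY.prodMk (hξ _)) (hB.prod (MeasurableSet.univ_pi hA)),
      Measure.compProd_apply_prod hB (MeasurableSet.univ_pi hA)]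
    have h1 := measure_inter_refPoint (D := D) hX k (hB.prod hbox) (hA (Fin.last k))
    have h2 : ∫⁻ ω in (fun ω => (refArray X D ω, fun i : Fin k => refPoint X D i ω)) ⁻¹'
          (B ×ˢ Set.univ.pi fun i : Fin k => A i.castSucc),
          refKernel μ X D (refArray X D ω) (A (Fin.last k)) ∂μ
        = ∫⁻ p in B ×ˢ Set.univ.pi fun i : Fin k => A i.castSucc,
          refKernel μ X D p.1 (A (Fin.last k))
            ∂(μ.map (fun ω => (refArray X D ω, fun i : Fin k => refPoint X D i ω))) := by
      rw [setLIntegral_map (hB.prod hbox) hκ (hY.prodMk (hξ k))]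
    rw [h2, ih, Measure.setLIntegral_compProd hκ hB hbox] at h1
    refine Eq.trans ?_ (h1.trans ?_)
    · congr 1
      ext ω
      simp only [Set.mem_preimage, Set.mem_prod, Set.mem_univ_pi, Set.mem_inter_iff,
        Fin.forall_fin_succ']
      rw [and_assoc]
      rfl
    · refine lintegral_congr fun γ => ?_
      simp only [setLIntegral_const, piKernel_apply, Measure.pi_pi]
      rw [Fin.prod_univ_castSucc, mul_comm]

/-- A density array, at a countable set of times, is obtained by evaluating kernels at independent
random points. The reason is that every entry is determined by how its two indices see an infinite
reference sequence, and that given the reference sequence the sample points are independent and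
identically distributed. Dissociation allows to fix the reference sequence. -/
theorem exists_kernel_representation (hX : IsDensityArray μ X) (hD : ∀ t ∈ D, half t ∈ D) :
    ∃ (S : Type) (_ : MeasurableSpace S) (_ : StandardBorelSpace S) (ν : Measure S)
      (p : PosReal → S → S → ℝ) (d : PosReal → S → ℝ),
      IsProbabilityMeasure ν ∧ (∀ t, Measurable (Function.uncurry (p t))) ∧
      (∀ t, Measurable (d t)) ∧ ∀ k : ℕ,
        (Measure.pi fun _ : Fin k => ν).map
          (fun u i j (t : D) => if i = j then d t (u i) else p t (u i) (u j))
        = μ.map (fun ω (i j : Fin k) (t : D) => X i j ω t) := by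
  choose F hF hFX using exists_offDiagonal_function hX
  choose F' hF' hFX' using exists_diagonal_function hX
  have hY := measurable_refArray (D := D) hX
  have hξ : ∀ k, Measurable fun ω => fun i : Fin k => refPoint X D i ω := fun k =>
    measurable_pi_lambda _ fun i : Fin k => measurable_refPoint hX (i : ℕ)
  have hp : IsProbabilityMeasure (μ.map (refArray X D)) :=
    Measure.isProbabilityMeasure_map hY.aemeasurable
  classical
  -- the value of a point at half of a time, which is read off only for times in `D`
  let ev : PosReal → RefPoint D → ℕ → ℝ × ℝ := fun t x r =>
    if h : half t ∈ D then x r ⟨half t, h⟩ else 0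
  have hev : ∀ t r, Measurable fun x => ev t x r := by
    intro t r
    by_cases h : half t ∈ D
    · simp only [ev, dif_pos h]
      exact (measurable_pi_apply _).comp (measurable_pi_apply r)
    · simp only [ev, dif_neg h]
      exact measurable_const
  let p : PosReal → RefPoint D → RefPoint D → ℝ := fun t x y =>
    F t fun r => (ev t x r).1 * (ev t y r).2
  let d : PosReal → RefPoint D → ℝ := fun t x => F' t fun r => (ev t x r).1 * (ev t x r).2
  have hpm : ∀ t, Measurable (Function.uncurry (p t)) := fun t =>
    (hF t).comp (measurable_pi_lambda _ fun r =>
      ((hev t r).comp measurable_fst).fst.mul ((hev t r).comp measurable_snd).snd)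
  have hdm : ∀ t, Measurable (d t) := fun t =>
    (hF' t).comp (measurable_pi_lambda _ fun r => (hev t r).fst.mul (hev t r).snd)
  let M : ∀ k : ℕ, (Fin k → RefPoint D) → Fin k → Fin k → D → ℝ := fun k u i j t =>
    if i = j then d t (u i) else p t (u i) (u j)
  have hM : ∀ k, Measurable (M k) := by
    intro k
    refine measurable_pi_lambda _ fun i => measurable_pi_lambda _ fun j =>
      measurable_pi_lambda _ fun t => ?_
    by_cases h : i = j
    · simp only [M, if_pos h]
      exact (hdm t).comp (measurable_pi_apply i)
    · simp only [M, if_neg h]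
      exact (hpm t).comp (g := Function.uncurry (p t))
        (f := fun u : Fin k → RefPoint D => (u i, u j)) (by fun_prop)
  have hXe : ∀ k : ℕ, Measurable fun ω (i j : Fin k) (t : D) => X (2 * i) (2 * j) ω t := fun k =>
    measurable_pi_lambda _ fun _ => measurable_pi_lambda _ fun _ =>
      measurable_pi_lambda _ fun _ => hX.measurable_apply _ _ _
  have hMX : ∀ k : ℕ, ∀ᵐ ω ∂μ, M k (fun i : Fin k => refPoint X D i ω)
      = fun (i j : Fin k) (t : D) => X (2 * i) (2 * j) ω t := by
    intro k
    have h1 : ∀ᵐ ω ∂μ, ∀ (i j : Fin k) (t : D), M k (fun i : Fin k => refPoint X D i ω) i j t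
        = X (2 * i) (2 * j) ω t := by
      refine ae_all_iff.2 fun i => ae_all_iff.2 fun j => ae_all_iff.2 fun t => ?_
      by_cases h : i = j
      · subst h
        filter_upwards [hFX' t i] with ω hω
        simp only [M, if_true, d, ev, dif_pos (hD t t.2)]
        exact hω.symm
      · filter_upwards [hFX t i j (fun h' => h (Fin.ext h'))] with ω hω
        simp only [M, if_neg h, p, ev, dif_pos (hD t t.2)]
        exact hω.symm
    filter_upwards [h1] with ω hω
    ext i j t
    exact hω i j t
  -- by dissociation, conditioning on the reference array does not change the law of the array of
  -- sample points
  have hlaw : ∀ k : ℕ, ∀ᵐ γ ∂(μ.map (refArray X D)),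
      (Measure.pi fun _ : Fin k => refKernel μ X D γ).map (M k)
        = μ.map fun ω (i j : Fin k) (t : D) => X (2 * i) (2 * j) ω t := by
    intro k
    have hind : IndepFun (refArray X D)
        (fun ω (i j : Fin k) (t : D) => X (2 * i) (2 * j) ω t) μ := by
      have h0 := hX.dissociated {n | n % 2 = 1} {n | n % 2 = 0} (by
        rw [Set.disjoint_left]
        intro n h1 h2
        simp only [Set.mem_ofPred_eq] at h1 h2
        omega)
      exact h0.comp
        (φ := fun x r s (t : D) => x ⟨2 * r + 1, by simp [Nat.add_mod]⟩
          ⟨2 * s + 1, by simp [Nat.add_mod]⟩ t)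
        (ψ := fun x (i j : Fin k) (t : D) => x ⟨2 * i, by simp⟩ ⟨2 * j, by simp⟩ t)
        (measurable_pi_lambda _ fun _ => measurable_pi_lambda _ fun _ =>
          measurable_pi_lambda _ fun _ => (measurable_pi_apply _).comp
            ((measurable_pi_apply _).comp (measurable_pi_apply _)))
        (measurable_pi_lambda _ fun _ => measurable_pi_lambda _ fun _ =>
          measurable_pi_lambda _ fun _ => (measurable_pi_apply _).comp
            ((measurable_pi_apply _).comp (measurable_pi_apply _)))
    have hprod := (indepFun_iff_map_prod_eq_prod_map_map hY.aemeasurable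
      (hXe k).aemeasurable).1 hind
    have hpe : IsProbabilityMeasure
        (μ.map fun ω (i j : Fin k) (t : D) => X (2 * i) (2 * j) ω t) :=
      Measure.isProbabilityMeasure_map (hXe k).aemeasurable
    have h2 : μ.map (refArray X D) ⊗ₘ ((piKernel (refKernel μ X D) k).map (M k))
        = μ.map (refArray X D) ⊗ₘ Kernel.const _
          (μ.map fun ω (i j : Fin k) (t : D) => X (2 * i) (2 * j) ω t) := by
      rw [Measure.compProd_const, ← hprod, Measure.compProd_map (hM k),
        ← map_refArray_refPoints hX k, Measure.map_map (by fun_prop) (hY.prodMk (hξ k))]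
      refine Measure.map_congr ?_
      filter_upwards [hMX k] with ω hω
      simp only [Function.comp_apply, Prod.map, id, hω]
    have : IsMarkovKernel ((piKernel (refKernel μ X D) k).map (M k)) :=
      Kernel.IsMarkovKernel.map _ (hM k)
    have hcg : MeasurableSpace.CountablyGenerated (Fin k → Fin k → D → ℝ) := inferInstance
    filter_upwards [Kernel.ae_eq_of_compProd_eq h2] with γ hγ
    rwa [Kernel.map_apply _ (hM k), Kernel.const_apply] at hγ
  obtain ⟨γ, hγ⟩ := (ae_all_iff.2 hlaw).exists
  refine ⟨RefPoint D, inferInstance, inferInstance, refKernel μ X D γ, p, d, inferInstance, hpm,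
    hdm, fun k => (hγ k).trans ?_⟩
  exact hX.map_comp_eq (ρ := fun i => 2 * i) (τ := id)
    (fun i j h => by simpa using h) Function.injective_id
    (f := fun x (i j : Fin k) (t : D) => x i j t)
    (measurable_pi_lambda _ fun _ => measurable_pi_lambda _ fun _ =>
      measurable_pi_lambda _ fun _ => measurable_eval3 _ _ _)

end representation

/-! ### The kernels form a symmetric Markov semigroup -/

section semigroup

variable {S : Type*} [MeasurableSpace S]

/-- The functions `p t`, for times `t` in `D`, are the densities of a symmetric Markov semigroup
on a probability space, with `d t` the values on the diagonal, which have finite integrals. -/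
structure IsKernelSemigroup (ν : Measure S) (p : PosReal → S → S → ℝ) (d : PosReal → S → ℝ)
    (D : Set PosReal) : Prop where
  measurable : ∀ t, Measurable (Function.uncurry (p t))
  measurable_diag : ∀ t, Measurable (d t)
  pos : ∀ t ∈ D, ∀ᵐ z ∂(ν.prod ν), 0 < p t z.1 z.2
  symm : ∀ t ∈ D, ∀ᵐ z ∂(ν.prod ν), p t z.1 z.2 = p t z.2 z.1
  row : ∀ t ∈ D, ∀ᵐ x ∂ν, Integrable (p t x) ν ∧ ∫ y, p t x y ∂ν = 1
  comp : ∀ s ∈ D, ∀ t ∈ D, ∀ᵐ z ∂(ν.prod ν), Integrable (fun w => p s z.1 w * p t w z.2) ν ∧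
    p (s + t) z.1 z.2 = ∫ w, p s z.1 w * p t w z.2 ∂ν
  diag : ∀ s ∈ D, ∀ t ∈ D, ∀ᵐ x ∂ν, Integrable (fun w => p s x w * p t w x) ν ∧
    d (s + t) x = ∫ w, p s x w * p t w x ∂ν
  integrable_diag : ∀ t ∈ D, Integrable (d t) ν

variable {ν : Measure S} [IsProbabilityMeasure ν]

lemma pi_eq_map_prod (σ : Equiv.Perm (Fin 4)) :
    ((ν.prod ν).prod (ν.prod ν)).map
      (fun q i => (![q.1.1, q.1.2, q.2.1, q.2.2] : Fin 4 → S) (σ i))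
    = Measure.pi fun _ : Fin 4 => ν := by
  have hm : Measurable fun (q : (S × S) × (S × S)) i =>
      (![q.1.1, q.1.2, q.2.1, q.2.2] : Fin 4 → S) (σ i) := by
    refine measurable_pi_lambda _ fun i => ?_
    generalize σ i = j
    fin_cases j <;> simp <;> fun_prop
  symm
  refine Measure.pi_eq fun A hA => ?_
  rw [Measure.map_apply hm (MeasurableSet.univ_pi hA)]
  have : (fun (q : (S × S) × (S × S)) i =>
      (![q.1.1, q.1.2, q.2.1, q.2.2] : Fin 4 → S) (σ i)) ⁻¹' (Set.univ.pi A)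
      = (A (σ.symm 0) ×ˢ A (σ.symm 1)) ×ˢ (A (σ.symm 2) ×ˢ A (σ.symm 3)) := by
    ext q
    simp only [Set.mem_preimage, Set.mem_univ_pi, Set.mem_prod]
    rw [← σ.symm.forall_congr_right]
    simp [Fin.forall_fin_succ, and_assoc]
  rw [this, Measure.prod_prod, Measure.prod_prod, Measure.prod_prod,
    ← Equiv.prod_comp σ.symm, Fin.prod_univ_four]
  ring

lemma pi_two_eq_map_prod :
    (ν.prod ν).map (fun q => (![q.1, q.2] : Fin 2 → S)) = Measure.pi fun _ : Fin 2 => ν := by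
  have hm : Measurable fun (q : S × S) => (![q.1, q.2] : Fin 2 → S) := by
    refine measurable_pi_lambda _ fun i => ?_
    fin_cases i <;> simp <;> fun_prop
  symm
  refine Measure.pi_eq fun A hA => ?_
  rw [Measure.map_apply hm (MeasurableSet.univ_pi hA)]
  have : (fun (q : S × S) => (![q.1, q.2] : Fin 2 → S)) ⁻¹' (Set.univ.pi A) = A 0 ×ˢ A 1 := by
    ext q
    simp [Fin.forall_fin_succ]
  rw [this, Measure.prod_prod, Fin.prod_univ_two]

lemma hasExpectation_map {Ω E : Type*} [MeasurableSpace Ω] [MeasurableSpace E] {μ : Measure Ω}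
    {g : Ω → E} (hg : Measurable g) {f : E → ℝ} (hf : Measurable f) {c : ℝ} :
    HasExpectation (μ.map g) f c ↔ HasExpectation μ (f ∘ g) c := by
  unfold HasExpectation
  rw [integrable_map_measure hf.aestronglyMeasurable hg.aemeasurable,
    integral_map hg.aemeasurable hf.aestronglyMeasurable]
  rfl

end semigroup

section

variable {Ω : Type*} [MeasurableSpace Ω] {μ : Measure Ω}
  {X : ℕ → ℕ → Ω → PosReal → ℝ} {D : Set PosReal}
  {S : Type*} [MeasurableSpace S] {ν : Measure S} [IsProbabilityMeasure ν]
  {p : PosReal → S → S → ℝ} {d : PosReal → S → ℝ}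

/-- The matrix of kernel values at the points `u i`. -/
def kernelMatrix (p : PosReal → S → S → ℝ) (d : PosReal → S → ℝ) (D : Set PosReal) (k : ℕ)
    (u : Fin k → S) (i j : Fin k) (t : D) : ℝ :=
  if i = j then d t (u i) else p t (u i) (u j)

lemma measurable_kernelMatrix (hp : ∀ t, Measurable (Function.uncurry (p t)))
    (hd : ∀ t, Measurable (d t)) (k : ℕ) : Measurable (kernelMatrix p d D k) := by
  refine measurable_pi_lambda _ fun i => measurable_pi_lambda _ fun j =>
    measurable_pi_lambda _ fun t => ?_
  by_cases h : i = j
  · simp only [kernelMatrix, if_pos h]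
    exact (hd t).comp (measurable_pi_apply i)
  · simp only [kernelMatrix, if_neg h]
    exact (hp t).comp (g := Function.uncurry (p t))
      (f := fun u : Fin k → S => (u i, u j)) (by fun_prop)

/-- The kernels and the array have the same joint laws at times in `D`. -/
def Represents (ν : Measure S) (p : PosReal → S → S → ℝ) (d : PosReal → S → ℝ)
    (D : Set PosReal) (μ : Measure Ω) (X : ℕ → ℕ → Ω → PosReal → ℝ) : Prop :=
  ∀ k : ℕ, (Measure.pi fun _ : Fin k => ν).map (kernelMatrix p d D k)
    = μ.map (fun ω (i j : Fin k) (t : D) => X i j ω t)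

/-- The kernels which represent a density array form a symmetric Markov semigroup: each axiom of
density arrays is a second moment identity, which becomes an almost sure identity. -/
theorem Represents.isKernelSemigroup [IsProbabilityMeasure μ] (h : Represents ν p d D μ X)
    (hX : IsDensityArray μ X) (hp : ∀ t, Measurable (Function.uncurry (p t)))
    (hd : ∀ t, Measurable (d t))
    (hadd : ∀ s ∈ D, ∀ t ∈ D, s + t ∈ D) : IsKernelSemigroup ν p d D := by
  have hXm : ∀ k : ℕ, Measurable fun ω (i j : Fin k) (t : D) => X i j ω t := fun k =>
    measurable_pi_lambda _ fun _ => measurable_pi_lambda _ fun _ =>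
      measurable_pi_lambda _ fun _ => hX.measurable_apply _ _ _
  have hM := fun k => measurable_kernelMatrix (D := D) hp hd k
  have hev : ∀ (k : ℕ) (i j : Fin k) (t : D),
      Measurable fun x : Fin k → Fin k → D → ℝ => x i j t := fun k i j t =>
    (measurable_pi_apply t).comp ((measurable_pi_apply j).comp (measurable_pi_apply i))
  have hm4 : ∀ σ : Equiv.Perm (Fin 4), Measurable fun (q : (S × S) × (S × S)) i =>
      (![q.1.1, q.1.2, q.2.1, q.2.2] : Fin 4 → S) (σ i) := by
    intro σ
    refine measurable_pi_lambda _ fun i => ?_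
    generalize σ i = j
    fin_cases j <;> simp <;> fun_prop
  have hm2 : Measurable fun (q : S × S) => (![q.1, q.2] : Fin 2 → S) := by
    refine measurable_pi_lambda _ fun i => ?_
    fin_cases i <;> simp <;> fun_prop
  -- transfer of expectations to the product of four copies of the space
  have hexp : ∀ (σ : Equiv.Perm (Fin 4)) {f : (Fin 4 → Fin 4 → D → ℝ) → ℝ} (_ : Measurable f)
      {c : ℝ}, HasExpectation μ (fun ω => f fun i j t => X i j ω t) c →
      HasExpectation ((ν.prod ν).prod (ν.prod ν)) (fun q => f (kernelMatrix p d D 4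
        fun i => (![q.1.1, q.1.2, q.2.1, q.2.2] : Fin 4 → S) (σ i))) c := by
    intro σ f hf c hc
    have h1 := (hasExpectation_map (hXm 4) hf).2 hc
    rw [← h 4, hasExpectation_map (hM 4) hf, ← pi_eq_map_prod σ,
      hasExpectation_map (hm4 σ) (hf.comp (hM 4))] at h1
    exact h1
  have hae2 : ∀ {P : (Fin 2 → Fin 2 → D → ℝ) → Prop}, MeasurableSet {x | P x} →
      (∀ᵐ ω ∂μ, P fun i j t => X i j ω t) →
      ∀ᵐ z ∂(ν.prod ν), P (kernelMatrix p d D 2 ![z.1, z.2]) := by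
    intro P hP hc
    have h1 := (ae_map_iff (hXm 2).aemeasurable hP).2 hc
    rw [← h 2, ae_map_iff (hM 2).aemeasurable hP, ← pi_two_eq_map_prod] at h1
    exact ae_of_ae_map hm2.aemeasurable h1
  have hconst : ∀ {b : S × S → S → ℝ} {a : S × S → ℝ},
      HasExpectation ((ν.prod ν).prod (ν.prod ν)) (fun q => a q.1 ^ 2 - 2 * a q.1 * b q.1 q.2.1
        + b q.1 q.2.1 * b q.1 q.2.2) 0 →
      ∀ᵐ z ∂(ν.prod ν), Integrable (b z) ν ∧ a z = ∫ w, b z w ∂ν := by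
    intro b a hab
    have h1 := ae_eq_integral_of_integral_sq_eq_zero (ν.prod ν) (Kernel.const (S × S) ν)
      (b := b) (a := a) (by
        have : (Kernel.const (S × S) ν ×ₖ Kernel.const (S × S) ν)
            = Kernel.const (S × S) (ν.prod ν) := by
          ext1 z
          rw [Kernel.prod_apply]
          rfl
        rw [this, Measure.compProd_const]
        exact hab)
    simpa only [Kernel.const_apply] using h1
  have hfst : ∀ {P : S → Prop}, (∀ᵐ z ∂(ν.prod ν), P z.1) → ∀ᵐ x ∂ν, P x := by
    intro P hP
    filter_upwards [Measure.ae_ae_of_ae_prod hP] with x hx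
    exact hx.exists.choose_spec
  refine ⟨hp, hd, ?_, ?_, ?_, ?_, ?_, ?_⟩
  · intro t ht
    have := hae2 (P := fun x => 0 < x 0 1 ⟨t, ht⟩)
      (measurableSet_lt measurable_const (hev 2 0 1 ⟨t, ht⟩))
      (Eventually.of_forall fun ω => hX.pos _ _ _ _)
    simpa [kernelMatrix] using this
  · intro t ht
    have := hae2 (P := fun x => x 0 1 ⟨t, ht⟩ = x 1 0 ⟨t, ht⟩)
      (measurableSet_eq_fun (hev 2 0 1 ⟨t, ht⟩) (hev 2 1 0 ⟨t, ht⟩)) (hX.symmetric t)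
    simpa [kernelMatrix] using this
  · intro t ht
    have h0 := hX.stochastic t
    have h1 : HasExpectation μ (fun ω => 1 - 2 * X 0 1 ω t + X 0 1 ω t * X 0 2 ω t) 0 := by
      have := (integrable_const (1 : ℝ)).sub h0.1
      refine ⟨this.congr (Eventually.of_forall fun ω => ?_), ?_⟩
      · simp only [Pi.sub_apply]; ring
      · have h2 := integral_sub (integrable_const (1 : ℝ)) h0.1
        rw [h0.2] at h2
        simp only [integral_const, probReal_univ, smul_eq_mul, mul_one, sub_self] at h2
        rw [← h2]
        refine integral_congr_ae (Eventually.of_forall fun ω => ?_)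
        simp only
        ring
    -- the points `0, 3, 1, 2` of the array are the four coordinates
    let σ : Equiv.Perm (Fin 4) :=
      ⟨![0, 2, 3, 1], ![0, 3, 1, 2], by decide, by decide⟩
    have h2 := hexp σ
      (f := fun x => 1 - 2 * x 0 1 ⟨t, ht⟩ + x 0 1 ⟨t, ht⟩ * x 0 2 ⟨t, ht⟩)
      ((measurable_const.sub ((hev 4 _ _ _).const_mul 2)).add ((hev 4 _ _ _).mul (hev 4 _ _ _))) h1
    have h3 := hconst (a := fun _ => 1) (b := fun z w => p t z.1 w) (by
      convert h2 using 1
      ext q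
      simp [kernelMatrix, σ])
    exact (hfst (P := fun x => Integrable (p t x) ν ∧ 1 = ∫ w, p t x w ∂ν) h3).mono
      fun x hx => ⟨hx.1, hx.2.symm⟩
  · intro s hs t ht
    have h2 := hexp 1
      (f := fun x => x 0 1 ⟨s + t, hadd s hs t ht⟩ ^ 2
        - 2 * x 0 1 ⟨s + t, hadd s hs t ht⟩ * x 0 2 ⟨s, hs⟩ * x 2 1 ⟨t, ht⟩
        + x 0 2 ⟨s, hs⟩ * x 0 3 ⟨s, hs⟩ * x 2 1 ⟨t, ht⟩ * x 3 1 ⟨t, ht⟩)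
      ((((hev 4 _ _ _).pow_const 2).sub ((((hev 4 _ _ _).const_mul 2).mul (hev 4 _ _ _)).mul
        (hev 4 _ _ _))).add ((((hev 4 _ _ _).mul (hev 4 _ _ _)).mul (hev 4 _ _ _)).mul
        (hev 4 _ _ _))) (hX.chapmanKolmogorov s t)
    refine hconst (a := fun z => p (s + t) z.1 z.2) (b := fun z w => p s z.1 w * p t w z.2) ?_
    convert h2 using 1
    ext q
    simp [kernelMatrix]
    ring
  · intro s hs t ht
    have h2 := hexp 1
      (f := fun x => x 0 0 ⟨s + t, hadd s hs t ht⟩ ^ 2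
        - 2 * x 0 0 ⟨s + t, hadd s hs t ht⟩ * x 0 2 ⟨s, hs⟩ * x 2 0 ⟨t, ht⟩
        + x 0 2 ⟨s, hs⟩ * x 0 3 ⟨s, hs⟩ * x 2 0 ⟨t, ht⟩ * x 3 0 ⟨t, ht⟩)
      ((((hev 4 _ _ _).pow_const 2).sub ((((hev 4 _ _ _).const_mul 2).mul (hev 4 _ _ _)).mul
        (hev 4 _ _ _))).add ((((hev 4 _ _ _).mul (hev 4 _ _ _)).mul (hev 4 _ _ _)).mul
        (hev 4 _ _ _))) (hX.diagonalChapmanKolmogorov s t)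
    refine hfst (hconst (a := fun z => d (s + t) z.1) (b := fun z w => p s z.1 w * p t w z.1) ?_)
    convert h2 using 1
    ext q
    simp [kernelMatrix]
    ring
  · intro t ht
    have h2 := hexp 1 (f := fun x => x 0 0 ⟨t, ht⟩) (hev 4 _ _ _) ⟨hX.bounded t, rfl⟩
    have h3 : Integrable (fun q : (S × S) × (S × S) => d t q.1.1) ((ν.prod ν).prod (ν.prod ν)) := by
      simpa [kernelMatrix] using h2.1
    have h4 : Integrable (d t) (((ν.prod ν).prod (ν.prod ν)).map fun q => q.1.1) := by
      rw [integrable_map_measure (hd t).aestronglyMeasurable (by fun_prop)]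
      exact h3
    have h5 : ((ν.prod ν).prod (ν.prod ν)).map (fun q : (S × S) × (S × S) => q.1.1) = ν := by
      have : (fun q : (S × S) × (S × S) => q.1.1) = Prod.fst ∘ Prod.fst := rfl
      rw [this, ← Measure.map_map measurable_fst measurable_fst]
      simp
    rwa [h5] at h4

lemma Represents.map_diag (h : Represents ν p d D μ X)
    (hX : ∀ i j t, Measurable fun ω => X i j ω t)
    (hp : ∀ t, Measurable (Function.uncurry (p t))) (hd : ∀ t, Measurable (d t)) :
    ν.map (fun x (t : D) => d t x) = μ.map (fun ω (t : D) => X 0 0 ω t) := by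
  have hXm : Measurable fun ω (i j : Fin 1) (t : D) => X i j ω t :=
    measurable_pi_lambda _ fun _ => measurable_pi_lambda _ fun _ =>
      measurable_pi_lambda _ fun _ => hX _ _ _
  have hM := measurable_kernelMatrix (D := D) hp hd 1
  have hev : Measurable fun x : Fin 1 → Fin 1 → D → ℝ => x 0 0 :=
    (measurable_pi_apply _).comp (measurable_pi_apply _)
  have e1 := congrArg (Measure.map fun x : Fin 1 → Fin 1 → D → ℝ => x 0 0) (h 1)
  rw [Measure.map_map hev hM, Measure.map_map hev hXm] at e1
  refine Eq.trans ?_ e1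
  have hmp := (measurePreserving_eval (fun _ : Fin 1 => ν) 0).map_eq
  nth_rewrite 1 [← hmp]
  rw [Measure.map_map (measurable_pi_lambda _ fun t => hd _) (measurable_pi_apply 0)]
  congr 1

end

/-! ### Hilbert–Schmidt operators on `L²` -/

section L2

variable {S : Type*} [MeasurableSpace S] {ν : Measure S}

local notation "⟪" x ", " y "⟫" => inner ℝ x y

lemma inner_eq_integral_mul (f g : Lp ℝ 2 ν) : ⟪f, g⟫ = ∫ x, f x * g x ∂ν := by
  rw [L2.inner_def]
  refine integral_congr_ae (Eventually.of_forall fun x => ?_)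
  simp [mul_comm]

lemma inner_toLp_eq {f : S → ℝ} (hf : MemLp f 2 ν) (g : Lp ℝ 2 ν) :
    ⟪hf.toLp f, g⟫ = ∫ x, f x * g x ∂ν := by
  rw [inner_eq_integral_mul]
  refine integral_congr_ae ?_
  filter_upwards [hf.coeFn_toLp] with x hx
  rw [hx]

lemma inner_toLp_toLp {f g : S → ℝ} (hf : MemLp f 2 ν) (hg : MemLp g 2 ν) :
    ⟪hf.toLp f, hg.toLp g⟫ = ∫ x, f x * g x ∂ν := by
  rw [inner_toLp_eq]
  refine integral_congr_ae ?_
  filter_upwards [hg.coeFn_toLp] with x hx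
  rw [hx]

lemma norm_sq_eq_integral (f : Lp ℝ 2 ν) : ‖f‖ ^ 2 = ∫ x, f x ^ 2 ∂ν := by
  rw [← real_inner_self_eq_norm_sq, inner_eq_integral_mul]
  simp only [sq]

lemma norm_sq_toLp {f : S → ℝ} (hf : MemLp f 2 ν) : ‖hf.toLp f‖ ^ 2 = ∫ x, f x ^ 2 ∂ν := by
  rw [← real_inner_self_eq_norm_sq, inner_toLp_toLp]
  simp only [sq]

lemma sq_integral_mul_le {f g : S → ℝ} (hf : MemLp f 2 ν) (hg : MemLp g 2 ν) :
    (∫ x, f x * g x ∂ν) ^ 2 ≤ (∫ x, f x ^ 2 ∂ν) * ∫ x, g x ^ 2 ∂ν := by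
  rw [← inner_toLp_toLp hf hg, ← norm_sq_toLp hf, ← norm_sq_toLp hg, ← mul_pow]
  exact sq_le_sq' (by
    have := neg_le_of_abs_le (abs_real_inner_le_norm (hf.toLp f) (hg.toLp g))
    linarith) (real_inner_le_norm _ _)

variable {k : S → S → ℝ}

lemma integrable_sq_kernel (hk : MemLp (Function.uncurry k) 2 (ν.prod ν)) :
    Integrable (fun z : S × S => k z.1 z.2 ^ 2) (ν.prod ν) :=
  hk.integrable_sq

lemma memLp_prod_mul {f g : S → ℝ} (hf : MemLp f 2 ν) (hg : MemLp g 2 ν) :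
    MemLp (fun z : S × S => f z.1 * g z.2) 2 (ν.prod ν) := by
  rw [memLp_two_iff_integrable_sq]
  · simp only [mul_pow]
    exact hf.integrable_sq.mul_prod hg.integrable_sq
  · exact hf.aestronglyMeasurable.comp_fst.mul hg.aestronglyMeasurable.comp_snd

lemma integrable_kernel_mul (hk : MemLp (Function.uncurry k) 2 (ν.prod ν)) {f g : S → ℝ}
    (hf : MemLp f 2 ν) (hg : MemLp g 2 ν) :
    Integrable (fun z : S × S => k z.1 z.2 * (f z.1 * g z.2)) (ν.prod ν) :=
  hk.integrable_mul (memLp_prod_mul hf hg)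

variable [SFinite ν]

lemma ae_memLp_section (hm : Measurable (Function.uncurry k))
    (hk : MemLp (Function.uncurry k) 2 (ν.prod ν)) : ∀ᵐ x ∂ν, MemLp (k x) 2 ν := by
  filter_upwards [(integrable_sq_kernel hk).prod_right_ae] with x hx
  rw [memLp_two_iff_integrable_sq]
  · exact hx
  · exact (hm.comp measurable_prodMk_left).aestronglyMeasurable

lemma memLp_integral_kernel (hm : Measurable (Function.uncurry k))
    (hk : MemLp (Function.uncurry k) 2 (ν.prod ν)) {f : S → ℝ} (hf : MemLp f 2 ν) :
    MemLp (fun x => ∫ y, k x y * f y ∂ν) 2 ν ∧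
      ∫ x, (∫ y, k x y * f y ∂ν) ^ 2 ∂ν
        ≤ (∫ z, k z.1 z.2 ^ 2 ∂(ν.prod ν)) * ∫ y, f y ^ 2 ∂ν := by
  have hms : AEStronglyMeasurable (fun x => ∫ y, k x y * f y ∂ν) ν :=
    (hm.aestronglyMeasurable.mul hf.aestronglyMeasurable.comp_snd).integral_prod_right'
  have hle : ∀ᵐ x ∂ν, (∫ y, k x y * f y ∂ν) ^ 2 ≤ (∫ y, k x y ^ 2 ∂ν) * ∫ y, f y ^ 2 ∂ν :=
    (ae_memLp_section hm hk).mono fun x hx => sq_integral_mul_le hx hf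
  have hint : Integrable (fun x => (∫ y, k x y ^ 2 ∂ν) * ∫ y, f y ^ 2 ∂ν) ν :=
    (integrable_sq_kernel hk).integral_prod_left.mul_const _
  have hi : Integrable (fun x => (∫ y, k x y * f y ∂ν) ^ 2) ν := by
    refine hint.mono' (hms.pow 2) ?_
    filter_upwards [hle] with x hx
    rwa [Real.norm_of_nonneg (sq_nonneg _)]
  refine ⟨(memLp_two_iff_integrable_sq hms).2 hi, ?_⟩
  refine (integral_mono_ae hi hint hle).trans_eq ?_
  rw [integral_mul_const, integral_prod _ (integrable_sq_kernel hk)]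

/-- The integral operator of a square integrable kernel. -/
def kernelOp (ν : Measure S) [SFinite ν] (k : S → S → ℝ) (hm : Measurable (Function.uncurry k))
    (hk : MemLp (Function.uncurry k) 2 (ν.prod ν)) : Lp ℝ 2 ν →L[ℝ] Lp ℝ 2 ν :=
  LinearMap.mkContinuous
    { toFun := fun f => (memLp_integral_kernel hm hk (Lp.memLp f)).1.toLp _
      map_add' := fun f g => by
        rw [← MemLp.toLp_add]
        refine MemLp.toLp_congr _ _ ?_
        filter_upwards [ae_memLp_section hm hk] with x hx
        have h1 : ∀ f : Lp ℝ 2 ν, Integrable (fun y => k x y * f y) ν := fun f =>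
          hx.integrable_mul (Lp.memLp f)
        rw [Pi.add_apply, ← integral_add (h1 f) (h1 g)]
        refine integral_congr_ae ?_
        filter_upwards [Lp.coeFn_add f g] with y hy
        rw [hy, Pi.add_apply, mul_add]
      map_smul' := fun c f => by
        rw [RingHom.id_apply, ← MemLp.toLp_const_smul]
        refine MemLp.toLp_congr _ _ (Eventually.of_forall fun x => ?_)
        rw [Pi.smul_apply, smul_eq_mul, ← integral_const_mul]
        refine integral_congr_ae ?_
        filter_upwards [Lp.coeFn_smul c f] with y hy
        rw [hy, Pi.smul_apply, smul_eq_mul]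
        ring }
    (Real.sqrt (∫ z, k z.1 z.2 ^ 2 ∂(ν.prod ν))) fun f => by
      have h := (memLp_integral_kernel hm hk (Lp.memLp f)).2
      rw [← norm_sq_eq_integral, ← norm_sq_toLp (memLp_integral_kernel hm hk (Lp.memLp f)).1] at h
      have h0 : 0 ≤ ∫ z, k z.1 z.2 ^ 2 ∂(ν.prod ν) := integral_nonneg fun z => sq_nonneg _
      refine (Real.le_sqrt (norm_nonneg _) (by positivity)).2 h |>.trans_eq ?_
      rw [Real.sqrt_mul h0, Real.sqrt_sq (norm_nonneg _)]

variable (hm : Measurable (Function.uncurry k)) (hk : MemLp (Function.uncurry k) 2 (ν.prod ν))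

lemma kernelOp_coeFn (f : Lp ℝ 2 ν) :
    kernelOp ν k hm hk f =ᵐ[ν] fun x => ∫ y, k x y * f y ∂ν :=
  (memLp_integral_kernel hm hk (Lp.memLp f)).1.coeFn_toLp

lemma inner_kernelOp (f g : Lp ℝ 2 ν) :
    ⟪f, kernelOp ν k hm hk g⟫ = ∫ z, k z.1 z.2 * (f z.1 * g z.2) ∂(ν.prod ν) := by
  rw [integral_prod _ (integrable_kernel_mul hk (Lp.memLp f) (Lp.memLp g)),
    inner_eq_integral_mul]
  refine integral_congr_ae ?_
  filter_upwards [kernelOp_coeFn hm hk g] with x hx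
  rw [hx, ← integral_const_mul]
  refine integral_congr_ae (Eventually.of_forall fun y => ?_)
  simp only
  ring

lemma inner_kernelOp_comm (hs : ∀ᵐ z ∂(ν.prod ν), k z.1 z.2 = k z.2 z.1) (f g : Lp ℝ 2 ν) :
    ⟪f, kernelOp ν k hm hk g⟫ = ⟪kernelOp ν k hm hk f, g⟫ := by
  rw [real_inner_comm g, inner_kernelOp, inner_kernelOp, ← integral_prod_swap]
  refine integral_congr_ae ?_
  filter_upwards [hs] with z hz
  simp only [Prod.fst_swap, Prod.snd_swap]
  rw [hz]
  ring

lemma kernelOp_comp {k' k'' : S → S → ℝ} (hm' : Measurable (Function.uncurry k'))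
    (hk' : MemLp (Function.uncurry k') 2 (ν.prod ν)) (hm'' : Measurable (Function.uncurry k''))
    (hk'' : MemLp (Function.uncurry k'') 2 (ν.prod ν))
    (h : ∀ᵐ z ∂(ν.prod ν), k'' z.1 z.2 = ∫ w, k z.1 w * k' w z.2 ∂ν) (f : Lp ℝ 2 ν) :
    kernelOp ν k'' hm'' hk'' f = kernelOp ν k hm hk (kernelOp ν k' hm' hk' f) := by
  refine Lp.ext ?_
  filter_upwards [kernelOp_coeFn hm'' hk'' f, kernelOp_coeFn hm hk (kernelOp ν k' hm' hk' f),
    ae_memLp_section hm hk, Measure.ae_ae_of_ae_prod h] with x h1 h2 h3 h4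
  rw [h1, h2]
  have hF := integrable_kernel_mul hk' h3 (Lp.memLp f)
  have e1 : ∫ w, k x w * (kernelOp ν k' hm' hk' f) w ∂ν
      = ∫ w, ∫ y, k' w y * (k x w * f y) ∂ν ∂ν := by
    refine integral_congr_ae ?_
    filter_upwards [kernelOp_coeFn hm' hk' f] with w hw
    rw [hw, ← integral_const_mul]
    refine integral_congr_ae (Eventually.of_forall fun y => ?_)
    simp only
    ring
  rw [e1, integral_integral_swap hF]
  refine integral_congr_ae ?_
  filter_upwards [h4] with y hy
  rw [hy, ← integral_mul_const]
  refine integral_congr_ae (Eventually.of_forall fun w => ?_)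
  simp only
  ring

/-- Parseval's identity: the Hilbert–Schmidt norm of an integral operator is the `L²` norm of its
kernel. -/
lemma hasSum_norm_sq_kernelOp {ι : Type*} [Countable ι] (b : HilbertBasis ι ℝ (Lp ℝ 2 ν)) :
    HasSum (fun i => ‖kernelOp ν k hm hk (b i)‖ ^ 2) (∫ z, k z.1 z.2 ^ 2 ∂(ν.prod ν)) := by
  have hpt : ∀ᵐ x ∂ν, HasSum (fun i => (kernelOp ν k hm hk (b i)) x ^ 2) (∫ y, k x y ^ 2 ∂ν) := by
    filter_upwards [ae_memLp_section hm hk,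
      ae_all_iff.2 fun i => kernelOp_coeFn hm hk (b i)] with x hx hi
    have h1 := b.hasSum_inner_mul_inner (hx.toLp _) (hx.toLp _)
    rw [real_inner_self_eq_norm_sq, norm_sq_toLp] at h1
    have h2 : (fun i => (kernelOp ν k hm hk (b i)) x ^ 2)
        = fun i => ⟪hx.toLp (k x), b i⟫ * ⟪b i, hx.toLp (k x)⟫ := by
      ext1 i
      rw [hi, real_inner_comm (hx.toLp _) (b i), inner_toLp_eq hx, sq]
    rw [h2]
    exact h1
  have hnn : 0 ≤ ∫ z, k z.1 z.2 ^ 2 ∂(ν.prod ν) := integral_nonneg fun z => sq_nonneg _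
  have key : ∑' i, ENNReal.ofReal (‖kernelOp ν k hm hk (b i)‖ ^ 2)
      = ENNReal.ofReal (∫ z, k z.1 z.2 ^ 2 ∂(ν.prod ν)) := by
    have h1 : ∀ i, ENNReal.ofReal (‖kernelOp ν k hm hk (b i)‖ ^ 2)
        = ∫⁻ x, ENNReal.ofReal ((kernelOp ν k hm hk (b i)) x ^ 2) ∂ν := fun i => by
      rw [norm_sq_eq_integral, ofReal_integral_eq_lintegral_ofReal (Lp.memLp _).integrable_sq
        (Eventually.of_forall fun x => sq_nonneg _)]
    simp_rw [h1]
    rw [← lintegral_tsum, integral_prod _ (integrable_sq_kernel hk),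
      ofReal_integral_eq_lintegral_ofReal (integrable_sq_kernel hk).integral_prod_left
        (Eventually.of_forall fun x => integral_nonneg fun y => sq_nonneg _)]
    · refine lintegral_congr_ae ?_
      filter_upwards [hpt] with x hx
      rw [← ENNReal.ofReal_tsum_of_nonneg (fun i => sq_nonneg _) hx.summable, hx.tsum_eq]
    · exact fun i => ((Lp.aestronglyMeasurable _).pow 2).aemeasurable.ennreal_ofReal
  have hs : Summable fun i => ‖kernelOp ν k hm hk (b i)‖ ^ 2 := by
    have := ENNReal.summable_toReal (f := fun i => ENNReal.ofReal (‖kernelOp ν k hm hk (b i)‖ ^ 2))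
      (by rw [key]; exact ENNReal.ofReal_ne_top)
    simpa only [ENNReal.toReal_ofReal (sq_nonneg _)] using this
  rw [← ENNReal.ofReal_tsum_of_nonneg (fun i => sq_nonneg _) hs,
    ENNReal.ofReal_eq_ofReal_iff (tsum_nonneg fun i => sq_nonneg _) hnn] at key
  rw [← key]
  exact hs.hasSum

end L2

/-! ### Symmetric contraction semigroups on a Hilbert space -/

section hilbert

local notation "⟪" x ", " y "⟫" => inner ℝ x y

variable {H : Type*} [NormedAddCommGroup H] [InnerProductSpace ℝ H]

/-- A semigroup of symmetric contractions, indexed by positive rational times. The bound on the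
quadratic form is equivalent to contractivity. -/
structure IsSymmSemigroup (T : ℚ → H →L[ℝ] H) : Prop where
  symm : ∀ t, 0 < t → ∀ f g, ⟪f, T t g⟫ = ⟪T t f, g⟫
  add : ∀ s t, 0 < s → 0 < t → ∀ f, T (s + t) f = T s (T t f)
  inner_le : ∀ t, 0 < t → ∀ f, ⟪f, T t f⟫ ≤ ‖f‖ ^ 2

namespace IsSymmSemigroup

variable {T : ℚ → H →L[ℝ] H} (hT : IsSymmSemigroup T)

include hT

lemma half_half {t : ℚ} (ht : 0 < t) (f : H) : T t f = T (t / 2) (T (t / 2) f) := by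
  rw [← hT.add _ _ (half_pos ht) (half_pos ht), add_halves]

lemma inner_self {t : ℚ} (ht : 0 < t) (f : H) : ⟪f, T t f⟫ = ‖T (t / 2) f‖ ^ 2 := by
  rw [hT.half_half ht, hT.symm _ (half_pos ht), real_inner_self_eq_norm_sq]

lemma norm_le {t : ℚ} (ht : 0 < t) (f : H) : ‖T t f‖ ≤ ‖f‖ := by
  have h := hT.inner_le (t + t) (by positivity) f
  rw [hT.add _ _ ht ht, hT.symm _ ht, real_inner_self_eq_norm_sq] at h
  exact (sq_le_sq₀ (norm_nonneg _) (norm_nonneg _)).1 h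

lemma pow_apply {t : ℚ} (ht : 0 < t) (n : ℕ) (f : H) :
    (T t ^ (n + 1)) f = T ((n + 1 : ℕ) * t) f := by
  induction n generalizing f with
  | zero => simp
  | succ n ih =>
    rw [pow_succ, mul_apply_eq_comp, ih, ← hT.add _ _ (by positivity) ht]
    congr 2
    push_cast
    ring

lemma norm_pow_le {t : ℚ} (ht : 0 < t) (n : ℕ) (f : H) : ‖(T t ^ n) f‖ ≤ ‖f‖ := by
  induction n generalizing f with
  | zero => simp
  | succ n ih =>
    rw [pow_succ, mul_apply_eq_comp]
    exact (ih _).trans (hT.norm_le ht f)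

lemma symm_pow {t : ℚ} (ht : 0 < t) (n : ℕ) (f g : H) : ⟪f, (T t ^ n) g⟫ = ⟪(T t ^ n) f, g⟫ := by
  induction n generalizing f g with
  | zero => simp
  | succ n ih =>
    rw [pow_succ, mul_apply_eq_comp, ih, hT.symm _ ht, ← mul_apply_eq_comp,
      ← pow_succ', pow_succ]

/-- Analyticity of symmetric contraction semigroups: the difference quotients of `T` are bounded
after time `n ε` by `1 / (n ε)`. With `K = T ε`, the sequences `⟪K ^ j (1 - K) v, v⟫` and
`⟪K ^ j (1 - K) ^ 2 v, v⟫` are nonincreasing, and their sums telescope. -/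
lemma norm_sub_pow_le {ε : ℚ} (hε : 0 < ε) (n : ℕ) (v : H) :
    n * ‖(T ε ^ n) (T ε v - v)‖ ≤ ‖v‖ := by
  set R := T (ε / 2) with hR
  have hε2 : 0 < ε / 2 := half_pos hε
  have hK : T ε = R ^ 2 := by
    ext f
    rw [hT.half_half hε, pow_two]
    rfl
  have hRsymm : ∀ n f g, ⟪f, (R ^ n) g⟫ = ⟪(R ^ n) f, g⟫ := fun n => hT.symm_pow hε2 n
  let e : ℕ → ℝ := fun j => ‖(R ^ j) v‖ ^ 2
  let d : ℕ → ℝ := fun j => e j - e (j + 1)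
  let c : ℕ → ℝ := fun j => ‖(R ^ j) (v - T ε v)‖ ^ 2
  have he : ∀ i j, ⟪(R ^ i) v, (R ^ (i + 2 * j)) v⟫ = e (i + j) := by
    intro i j
    have : i + 2 * j = j + (i + j) := by ring
    rw [this, pow_add, mul_apply_eq_comp, hRsymm j, ← mul_apply_eq_comp,
      ← pow_add, add_comm j i, real_inner_self_eq_norm_sq]
  have hc : ∀ j, c j = d j - d (j + 1) := by
    intro j
    have h1 : (R ^ j) (v - T ε v) = (R ^ j) v - (R ^ (j + 2 * 1)) v := by
      rw [map_sub, hK, ← mul_apply_eq_comp, ← pow_add]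
    have h2 := he j 1
    have h3 : e (j + 1 + 1) = ‖(R ^ (j + 2 * 1)) v‖ ^ 2 := rfl
    simp only [c, d, h1, norm_sub_sq_real]
    rw [h2, h3]
    simp only [e]
    ring
  have hcanti : Antitone c := antitone_nat_of_succ_le fun j => by
    have h : (R ^ (j + 1)) (v - T ε v) = R ((R ^ j) (v - T ε v)) := by rw [pow_succ']; rfl
    have := hT.norm_le hε2 ((R ^ j) (v - T ε v))
    simp only [c, h]
    gcongr
  have hdanti : Antitone d := antitone_nat_of_succ_le fun j => by
    have : 0 ≤ c j := sq_nonneg _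
    linarith [hc j]
  have hd0 : ∀ j, 0 ≤ d j := fun j => by
    have h : (R ^ (j + 1)) v = R ((R ^ j) v) := by rw [pow_succ']; rfl
    have := hT.norm_le hε2 ((R ^ j) v)
    simp only [d, e, h, sub_nonneg]
    gcongr
  have h1 : n * d n ≤ ‖v‖ ^ 2 := by
    have h2 : ∑ j ∈ Finset.range n, d j = e 0 - e n := Finset.sum_range_sub' e n
    have h3 : n * d n ≤ ∑ j ∈ Finset.range n, d j := by
      rw [← nsmul_eq_mul, ← Finset.card_range n, ← Finset.sum_const, Finset.card_range]
      exact Finset.sum_le_sum fun j hj => hdanti (Finset.mem_range.1 hj).le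
    have h4 : 0 ≤ e n := sq_nonneg _
    have h5 : e 0 = ‖v‖ ^ 2 := by simp [e]
    linarith
  have h2 : n * c (2 * n) ≤ d n := by
    have h3 : ∑ j ∈ Finset.range n, c (n + j) = d n - d (n + n) := by
      have h := Finset.sum_range_sub' (fun j => d (n + j)) n
      simp only [add_zero] at h
      rw [← h]
      exact Finset.sum_congr rfl fun j _ => hc (n + j)
    have h4 : n * c (2 * n) ≤ ∑ j ∈ Finset.range n, c (n + j) := by
      rw [← nsmul_eq_mul, ← Finset.card_range n, ← Finset.sum_const, Finset.card_range]
      exact Finset.sum_le_sum fun j hj => hcanti (by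
        have := Finset.mem_range.1 hj
        omega)
    linarith [hd0 (n + n)]
  have h3 : (n * ‖(T ε ^ n) (T ε v - v)‖) ^ 2 ≤ ‖v‖ ^ 2 := by
    have h4 : ‖(T ε ^ n) (T ε v - v)‖ ^ 2 = c (2 * n) := by
      simp only [c]
      rw [hK, ← pow_mul, ← norm_neg, ← map_neg, neg_sub]
    rw [mul_pow, h4]
    calc (n : ℝ) ^ 2 * c (2 * n) = n * (n * c (2 * n)) := by ring
      _ ≤ n * d n := by gcongr
      _ ≤ _ := h1
  exact (sq_le_sq₀ (by positivity) (norm_nonneg _)).1 h3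

/-- Log-convexity of `t ↦ ⟪f, T t f⟫`, as the inequality of Jensen for powers. -/
lemma inner_pow_le {ε : ℚ} (hε : 0 < ε) {f : H} (hf : ‖f‖ = 1) (n : ℕ) :
    ⟪f, T ε f⟫ ^ n ≤ ⟪f, (T ε ^ n) f⟫ := by
  set R := T (ε / 2) with hR
  have hε2 : 0 < ε / 2 := half_pos hε
  have hK : T ε = R ^ 2 := by
    ext f
    rw [hT.half_half hε, pow_two]
    rfl
  let a : ℕ → ℝ := fun j => ‖(R ^ j) f‖ ^ 2
  have ha : ∀ j, ⟪f, (T ε ^ j) f⟫ = a j := by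
    intro j
    rw [hK, ← pow_mul, two_mul, pow_add, mul_apply_eq_comp, hT.symm_pow hε2,
      real_inner_self_eq_norm_sq]
  have ha0 : ∀ j, 0 ≤ a j := fun j => sq_nonneg _
  have hlc : ∀ j, a (j + 1) ^ 2 ≤ a j * a (j + 2) := by
    intro j
    have h1 : a (j + 1) = ⟪(R ^ j) f, (R ^ (j + 2)) f⟫ := by
      have : j + 2 = 1 + (j + 1) := by ring
      rw [this, pow_add R 1, mul_apply_eq_comp, hT.symm_pow hε2,
        ← mul_apply_eq_comp, ← pow_add, add_comm 1 j, real_inner_self_eq_norm_sq]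
    have h2 := abs_real_inner_le_norm ((R ^ j) f) ((R ^ (j + 2)) f)
    rw [← h1, abs_of_nonneg (ha0 _)] at h2
    calc a (j + 1) ^ 2 ≤ (‖(R ^ j) f‖ * ‖(R ^ (j + 2)) f‖) ^ 2 := by
          have := ha0 (j + 1)
          gcongr
      _ = a j * a (j + 2) := by simp only [a]; ring
  have hstep : ∀ j, a 1 * a j ≤ a (j + 1) := by
    intro j
    induction j with
    | zero =>
      have : a 0 = 1 := by simp [a, hf]
      rw [this, mul_one]
    | succ j ih =>
      rcases (ha0 (j + 1)).eq_or_lt with h0 | h0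
      · rw [← h0, mul_zero]
        exact ha0 _
      · have hj : 0 < a j := by
          rcases (ha0 j).eq_or_lt with h | h
          · have := hlc j
            rw [← h, zero_mul] at this
            nlinarith
          · exact h
        have h1 := hlc j
        have h2 : a 1 * a (j + 1) * a j ≤ a (j + 2) * a j := by
          nlinarith
        exact le_of_mul_le_mul_right h2 hj
  have h1 : ⟪f, T ε f⟫ = a 1 := by simpa using ha 1
  rw [ha, h1]
  induction n with
  | zero => simp [a, hf]
  | succ n ih =>
    rw [pow_succ']
    exact (mul_le_mul_of_nonneg_left ih (ha0 1)).trans (hstep n)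

end IsSymmSemigroup

end hilbert

/-! ### Ritz approximation of a symmetric semigroup -/

section ritz

local notation "⟪" x ", " y "⟫" => inner ℝ x y

variable {H : Type*} [NormedAddCommGroup H] [InnerProductSpace ℝ H] {A : Type*}

/-- The coefficients `⟪ψ i, v⟫` of a vector with respect to a finite family `ψ`. -/
def coef (ψ : A → H) : H →ₗ[ℝ] EuclideanSpace ℝ A where
  toFun v := WithLp.toLp 2 fun i => ⟪ψ i, v⟫
  map_add' v w := by ext i; simp [inner_add_right]
  map_smul' c v := by ext i; simp [inner_smul_right]

@[simp]
lemma coef_apply (ψ : A → H) (v : H) (i : A) : coef ψ v i = ⟪ψ i, v⟫ := rfl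

/-- Coordinatewise multiplication by a function. -/
def diagMul (f : A → ℝ) (c : EuclideanSpace ℝ A) : EuclideanSpace ℝ A :=
  WithLp.toLp 2 fun i => f i * c i

@[simp]
lemma diagMul_apply (f : A → ℝ) (c : EuclideanSpace ℝ A) (i : A) : diagMul f c i = f i * c i := rfl

variable [Fintype A]

lemma norm_le_of_abs_le {a b : EuclideanSpace ℝ A} (h : ∀ i, |a i| ≤ |b i|) : ‖a‖ ≤ ‖b‖ := by
  rw [← sq_le_sq₀ (norm_nonneg _) (norm_nonneg _), EuclideanSpace.norm_sq_eq,
    EuclideanSpace.norm_sq_eq]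
  refine Finset.sum_le_sum fun i _ => ?_
  have := h i
  simp only [Real.norm_eq_abs]
  gcongr

lemma norm_diagMul_le {f : A → ℝ} (hf : ∀ i, |f i| ≤ 1) (c : EuclideanSpace ℝ A) :
    ‖diagMul f c‖ ≤ ‖c‖ :=
  norm_le_of_abs_le fun i => by
    rw [diagMul_apply, abs_mul]
    exact mul_le_of_le_one_left (abs_nonneg _) (hf i)

lemma norm_coef_le {ψ : A → H} (hψ : Orthonormal ℝ ψ) (v : H) : ‖coef ψ v‖ ≤ ‖v‖ := by
  rw [← sq_le_sq₀ (norm_nonneg _) (norm_nonneg _), EuclideanSpace.norm_sq_eq]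
  simpa using hψ.sum_inner_products_le v (s := Finset.univ)

/-- The orthonormal family `ψ` diagonalises the compression of `K` to its span, with
eigenvalues `κ`. -/
structure IsRitz (K : H →L[ℝ] H) (ψ : A → H) (κ : A → ℝ) : Prop where
  orthonormal : Orthonormal ℝ ψ
  inner_self : ∀ i, ⟪ψ i, K (ψ i)⟫ = κ i
  inner_ne : ∀ i j, i ≠ j → ⟪ψ i, K (ψ j)⟫ = 0

/-- The vector `v` is at distance at most `η` of the span of `ψ`. -/
def IsApprox (ψ : A → H) (η : ℝ) (v : H) : Prop :=
  ∃ v' ∈ Submodule.span ℝ (Set.range ψ), ‖v - v'‖ ≤ η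

lemma inner_coef_of_mem_span {ψ : A → H} (hψ : Orthonormal ℝ ψ) {v : H}
    (hv : v ∈ Submodule.span ℝ (Set.range ψ)) (g : H) : ⟪coef ψ v, coef ψ g⟫ = ⟪v, g⟫ := by
  classical
  induction hv using Submodule.span_induction with
  | mem x hx =>
    obtain ⟨i, rfl⟩ := hx
    simp [PiLp.inner_apply, orthonormal_iff_ite.1 hψ]
  | zero => simp
  | add x y _ _ hx hy => simp [inner_add_left, hx, hy]
  | smul c x _ hx => simp [inner_smul_left, hx]

lemma abs_inner_coef_sub_le {ψ : A → H} (hψ : Orthonormal ℝ ψ) {v : H} {η : ℝ}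
    (hv : IsApprox ψ η v) (g : H) : |⟪coef ψ v, coef ψ g⟫ - ⟪v, g⟫| ≤ 2 * η * ‖g‖ := by
  obtain ⟨v', hv', h⟩ := hv
  have h1 : ⟪coef ψ v, coef ψ g⟫ - ⟪v, g⟫ = ⟪coef ψ (v - v'), coef ψ g⟫ - ⟪v - v', g⟫ := by
    rw [map_sub, inner_sub_left, inner_sub_left, inner_coef_of_mem_span hψ hv']
    ring
  rw [h1]
  refine (abs_sub _ _).trans ?_
  have h2 := (abs_real_inner_le_norm (coef ψ (v - v')) (coef ψ g)).trans
    (mul_le_mul (norm_coef_le hψ _) (norm_coef_le hψ _) (norm_nonneg _) (norm_nonneg _))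
  have h3 := abs_real_inner_le_norm (v - v') g
  have h4 : ‖v - v'‖ * ‖g‖ ≤ η * ‖g‖ := by gcongr
  linarith

namespace IsRitz

variable {K : H →L[ℝ] H} {ψ : A → H} {κ : A → ℝ}

omit [Fintype A] in
lemma inner_of_mem_span (h : IsRitz K ψ κ) {v : H}
    (hv : v ∈ Submodule.span ℝ (Set.range ψ)) (i : A) : ⟪ψ i, K v⟫ = κ i * ⟪ψ i, v⟫ := by
  classical
  induction hv using Submodule.span_induction with
  | mem x hx =>
    obtain ⟨j, rfl⟩ := hx
    rw [orthonormal_iff_ite.1 h.orthonormal]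
    split_ifs with hij
    · rw [← hij, h.inner_self, mul_one]
    · rw [h.inner_ne i j hij, mul_zero]
  | zero => simp
  | add x y _ _ hx hy => simp [inner_add_right, hx, hy, mul_add]
  | smul c x _ hx => simp only [map_smul, inner_smul_right, hx]; ring

/-- Near the span of `ψ`, the operator `K` acts on the coefficients as multiplication by the
eigenvalues `κ`. -/
lemma norm_diagMul_sub_le (h : IsRitz K ψ κ) (hK : ∀ v, ‖K v‖ ≤ ‖v‖) (hκ : ∀ i, |κ i| ≤ 1)
    {v : H} {η : ℝ} (hv : IsApprox ψ η v) : ‖diagMul κ (coef ψ v) - coef ψ (K v)‖ ≤ 2 * η := by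
  obtain ⟨v', hv', hη⟩ := hv
  have h1 : diagMul κ (coef ψ v) - coef ψ (K v)
      = diagMul κ (coef ψ (v - v')) - coef ψ (K (v - v')) := by
    ext i
    have := h.inner_of_mem_span hv' i
    simp only [PiLp.sub_apply, diagMul_apply, coef_apply, map_sub] at *
    rw [this]
    ring
  rw [h1]
  refine (norm_sub_le _ _).trans ?_
  have h2 := (norm_diagMul_le hκ _).trans (norm_coef_le h.orthonormal (v - v'))
  have h3 := (norm_coef_le h.orthonormal (K (v - v'))).trans (hK _)
  linarith

end IsRitz

lemma exists_exp_sub_one_eq (x : ℝ) (hx : x ≤ 0) :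
    ∃ φ : ℝ, Real.exp x - 1 = x * φ ∧ |φ| ≤ 1 ∧ |φ - 1| ≤ |x| := by
  rcases hx.eq_or_lt with rfl | hx
  · exact ⟨1, by simp⟩
  refine ⟨(Real.exp x - 1) / x, (mul_div_cancel₀ _ hx.ne).symm, ?_, ?_⟩
  · rw [abs_div, div_le_one (abs_pos.2 hx.ne), abs_of_nonpos, abs_of_neg hx]
    · linarith [Real.add_one_le_exp x]
    · linarith [Real.exp_le_one_iff.2 hx.le]
  · rw [div_sub_one hx.ne, abs_div, div_le_iff₀ (abs_pos.2 hx.ne), abs_of_nonneg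
      (by linarith [Real.add_one_le_exp x])]
    -- `exp x ≤ 1 / (1 - x)`, hence `exp x - 1 - x ≤ x ^ 2 / (1 - x)`
    have h1 : Real.exp x * (1 - x) ≤ 1 := by
      have h2 := Real.add_one_le_exp (-x)
      have h3 : Real.exp x * Real.exp (-x) = 1 := by rw [← Real.exp_add]; simp
      nlinarith [Real.exp_pos x]
    rw [abs_mul_abs_self]
    have h4 : Real.exp x ≤ 1 := by linarith [Real.exp_le_one_iff.2 hx.le]
    have h5 := Real.add_one_le_exp x
    nlinarith

/-- The difference quotient `(K - 1) / ε`. -/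
def diffQuot (K : H →L[ℝ] H) (ε : ℝ) : H →L[ℝ] H := ε⁻¹ • (K - 1)

lemma diffQuot_apply (K : H →L[ℝ] H) (ε : ℝ) (v : H) : diffQuot K ε v = ε⁻¹ • (K v - v) := rfl

lemma diffQuot_pow_apply (K : H →L[ℝ] H) (ε : ℝ) (m : ℕ) (v : H) :
    diffQuot K ε ((K ^ m) v) = (K ^ m) (diffQuot K ε v) := by
  rw [diffQuot_apply, diffQuot_apply, map_smul, map_sub]
  congr 2
  rw [← mul_apply_eq_comp, ← mul_apply_eq_comp, ← pow_succ, ← pow_succ']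

lemma norm_pow_apply_le {K : H →L[ℝ] H} (hK : ∀ v, ‖K v‖ ≤ ‖v‖) (n : ℕ) (v : H) :
    ‖(K ^ n) v‖ ≤ ‖v‖ := by
  induction n generalizing v with
  | zero => simp
  | succ n ih =>
    rw [pow_succ, mul_apply_eq_comp]
    exact (ih _).trans (hK v)

lemma apply_eq_add_diffQuot (K : H →L[ℝ] H) {ε : ℝ} (hε : ε ≠ 0) (v : H) :
    K v = v + ε • diffQuot K ε v := by
  rw [diffQuot_apply, smul_inv_smul₀ hε]
  abel

lemma norm_pow_sub_le {K : H →L[ℝ] H} (hK : ∀ v, ‖K v‖ ≤ ‖v‖) {ε : ℝ} (hε : 0 < ε) (n : ℕ)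
    (v : H) : ‖(K ^ n) v - v‖ ≤ n * ε * ‖diffQuot K ε v‖ := by
  induction n with
  | zero => simp
  | succ n ih =>
    have h1 : (K ^ (n + 1)) v - v = ((K ^ n) v - v) + ε • (K ^ n) (diffQuot K ε v) := by
      rw [pow_succ, mul_apply_eq_comp]
      nth_rewrite 1 [apply_eq_add_diffQuot K hε.ne' v]
      rw [map_add, map_smul]
      abel
    rw [h1]
    refine (norm_add_le _ _).trans ?_
    rw [norm_smul, Real.norm_of_nonneg hε.le]
    have h2 := norm_pow_apply_le hK n (diffQuot K ε v)
    have h3 : ε * ‖(K ^ n) (diffQuot K ε v)‖ ≤ ε * ‖diffQuot K ε v‖ := by gcongr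
    rw [Nat.cast_succ]
    linarith

/-- Taylor's formula of second order for `K ^ n`, in terms of difference quotients. -/
lemma norm_pow_sub_sub_le {K : H →L[ℝ] H} (hK : ∀ v, ‖K v‖ ≤ ‖v‖) {ε : ℝ} (hε : 0 < ε) (n : ℕ)
    (v : H) : ‖(K ^ n) v - v - (n * ε) • diffQuot K ε v‖
      ≤ (n * ε) ^ 2 * ‖diffQuot K ε (diffQuot K ε v)‖ := by
  set w := diffQuot K ε v with hw
  have key : ∀ m ≤ n, ‖(K ^ m) v - v - (m * ε) • w‖ ≤ m * ε * (n * ε * ‖diffQuot K ε w‖) := by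
    intro m hm
    induction m with
    | zero => simp
    | succ m ih =>
      have h1 : (K ^ (m + 1)) v - v - ((m + 1 : ℕ) * ε) • w
          = ((K ^ m) v - v - (m * ε) • w) + ε • ((K ^ m) w - w) := by
        rw [pow_succ, mul_apply_eq_comp]
        nth_rewrite 1 [apply_eq_add_diffQuot K hε.ne' v]
        rw [map_add, map_smul, ← hw]
        push_cast
        module
      rw [h1]
      refine (norm_add_le _ _).trans ?_
      rw [norm_smul, Real.norm_of_nonneg hε.le]
      have h2 := norm_pow_sub_le hK hε m w
      have h3 : (m : ℝ) * ε * ‖diffQuot K ε w‖ ≤ n * ε * ‖diffQuot K ε w‖ := by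
        have : (m : ℝ) ≤ n := by exact_mod_cast (Nat.le_succ m).trans hm
        gcongr
      have h4 : ε * ‖(K ^ m) w - w‖ ≤ ε * (n * ε * ‖diffQuot K ε w‖) := by
        have := h2.trans h3
        gcongr
      have h5 := ih ((Nat.le_succ m).trans hm)
      rw [Nat.cast_succ]
      linarith
  refine (key n le_rfl).trans (le_of_eq ?_)
  ring

namespace IsRitz

variable {K : H →L[ℝ] H} {ψ : A → H} {κ : A → ℝ}

/-- The rate `(κ i - 1) / ε` of the eigenvalue `κ i`. -/
def _root_.MarkovLimit.ritzRate (κ : A → ℝ) (ε : ℝ) (i : A) : ℝ := (κ i - 1) / ε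

/-- Near the span of `ψ`, the difference quotient of `K` acts on the coefficients as multiplication
by the rates. The division by `ε` is the reason why a precision `δ * ε` is needed. -/
lemma norm_rate_sub_le (h : IsRitz K ψ κ) (hK : ∀ v, ‖K v‖ ≤ ‖v‖) (hκ : ∀ i, |κ i| ≤ 1)
    {ε : ℝ} (hε : 0 < ε) {v : H} {δ : ℝ} (hv : IsApprox ψ (δ * ε) v) :
    ‖diagMul (ritzRate κ ε) (coef ψ v) - coef ψ (diffQuot K ε v)‖ ≤ 2 * δ := by
  have h1 : diagMul (ritzRate κ ε) (coef ψ v) - coef ψ (diffQuot K ε v)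
      = ε⁻¹ • (diagMul κ (coef ψ v) - coef ψ (K v)) := by
    ext i
    simp only [PiLp.sub_apply, diagMul_apply, coef_apply, diffQuot_apply, ritzRate,
      inner_smul_right, inner_sub_right, PiLp.smul_apply, smul_eq_mul]
    field_simp
    ring
  rw [h1, norm_smul, norm_inv, Real.norm_of_nonneg hε.le, inv_mul_le_iff₀ hε]
  have := h.norm_diagMul_sub_le hK hκ hv
  linarith

/-- One time step: comparison of `exp (τ q)` on the coefficients with `K ^ n`, for `τ = n ε`. The
vector `v` and its difference quotient have to be close to the span of `ψ`, but the vectors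
`K ^ j v` for `j ≤ n` do not: the error is of second order in `τ`. -/
lemma norm_exp_step_le (h : IsRitz K ψ κ) (hK : ∀ v, ‖K v‖ ≤ ‖v‖) (hκ : ∀ i, |κ i| ≤ 1)
    {ε : ℝ} (hε : 0 < ε) {v : H} {δ C : ℝ} (hv : IsApprox ψ (δ * ε) v)
    (hw : IsApprox ψ (δ * ε) (diffQuot K ε v)) (hC : ‖diffQuot K ε (diffQuot K ε v)‖ ≤ C)
    (n : ℕ) :
    ‖diagMul (fun i => Real.exp (n * ε * ritzRate κ ε i)) (coef ψ v) - coef ψ ((K ^ n) v)‖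
      ≤ (n * ε) * (2 * δ) + (n * ε) ^ 2 * (2 * δ + 2 * C) := by
  set τ : ℝ := n * ε with hτ
  have hτ0 : 0 ≤ τ := by positivity
  set w := diffQuot K ε v with hw'
  set q := ritzRate κ ε with hq
  have hq0 : ∀ i, q i ≤ 0 := fun i =>
    div_nonpos_of_nonpos_of_nonneg (by linarith [(abs_le.1 (hκ i)).2]) hε.le
  choose φ hφ1 hφ2 hφ3 using fun i =>
    exists_exp_sub_one_eq (τ * q i) (mul_nonpos_of_nonneg_of_nonpos hτ0 (hq0 i))
  have h1 : diagMul (fun i => Real.exp (τ * q i)) (coef ψ v) - coef ψ ((K ^ n) v)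
      = τ • diagMul φ (diagMul q (coef ψ v) - coef ψ w)
        + diagMul (fun i => φ i - 1) (τ • coef ψ w)
        - coef ψ ((K ^ n) v - v - τ • w) := by
    ext i
    have : Real.exp (τ * q i) = 1 + τ * q i * φ i := by linarith [hφ1 i]
    simp only [PiLp.sub_apply, PiLp.add_apply, diagMul_apply, coef_apply, PiLp.smul_apply,
      smul_eq_mul, map_sub, map_smul, this]
    ring
  rw [h1]
  have h2 : ‖τ • diagMul φ (diagMul q (coef ψ v) - coef ψ w)‖ ≤ τ * (2 * δ) := by
    rw [norm_smul, Real.norm_of_nonneg hτ0]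
    have := (norm_diagMul_le hφ2 _).trans (h.norm_rate_sub_le hK hκ hε hv)
    gcongr
  have h3 : ‖diagMul (fun i => φ i - 1) (τ • coef ψ w)‖ ≤ τ ^ 2 * (2 * δ + C) := by
    have h4 : ‖diagMul (fun i => φ i - 1) (τ • coef ψ w)‖ ≤ ‖τ ^ 2 • diagMul q (coef ψ w)‖ := by
      refine norm_le_of_abs_le fun i => ?_
      simp only [diagMul_apply, PiLp.smul_apply, smul_eq_mul, abs_mul]
      have := hφ3 i
      rw [abs_mul] at this
      calc |φ i - 1| * (|τ| * |coef ψ w i|) ≤ |τ| * |q i| * (|τ| * |coef ψ w i|) := by gcongr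
        _ = |τ ^ 2| * (|q i| * |coef ψ w i|) := by rw [abs_pow]; ring
    refine h4.trans ?_
    rw [norm_smul, Real.norm_of_nonneg (sq_nonneg _)]
    have h5 := h.norm_rate_sub_le hK hκ hε hw
    have h6 := (norm_coef_le h.orthonormal (diffQuot K ε w)).trans hC
    have h7 : ‖diagMul q (coef ψ w)‖ ≤ 2 * δ + C := by
      have := norm_sub_norm_le (diagMul q (coef ψ w)) (coef ψ (diffQuot K ε w))
      linarith
    gcongr
  have h4 : ‖coef ψ ((K ^ n) v - v - τ • w)‖ ≤ τ ^ 2 * C := by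
    refine ((norm_coef_le h.orthonormal _).trans (norm_pow_sub_sub_le hK hε n v)).trans ?_
    gcongr
  refine (norm_sub_le _ _).trans ?_
  have h5 := norm_add_le (τ • diagMul φ (diagMul q (coef ψ v) - coef ψ w))
    (diagMul (fun i => φ i - 1) (τ • coef ψ w))
  linarith

/-- Comparison of `exp (J τ q)` on the coefficients with `K ^ (n J)`, by `J` steps of length
`τ = n ε`; the multipliers are contractions, so that the errors of the steps add up. -/
lemma norm_exp_sub_le (h : IsRitz K ψ κ) (hK : ∀ v, ‖K v‖ ≤ ‖v‖) (hκ : ∀ i, |κ i| ≤ 1)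
    {ε : ℝ} (hε : 0 < ε) {v : H} {δ C : ℝ} (n J : ℕ)
    (hv : ∀ j < J, IsApprox ψ (δ * ε) ((K ^ (n * j)) v))
    (hw : ∀ j < J, IsApprox ψ (δ * ε) (diffQuot K ε ((K ^ (n * j)) v)))
    (hC : ‖diffQuot K ε (diffQuot K ε v)‖ ≤ C) :
    ‖diagMul (fun i => Real.exp (J * (n * ε) * ritzRate κ ε i)) (coef ψ v)
        - coef ψ ((K ^ (n * J)) v)‖
      ≤ J * ((n * ε) * (2 * δ) + (n * ε) ^ 2 * (2 * δ + 2 * C)) := by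
  induction J with
  | zero =>
    have : diagMul (fun i => Real.exp ((0 : ℕ) * (n * ε) * ritzRate κ ε i)) (coef ψ v)
        - coef ψ ((K ^ (n * 0)) v) = 0 := by
      ext i
      simp
    rw [this]
    simp
  | succ J ih =>
    have ih' := ih (fun j hj => hv j (hj.trans (Nat.lt_succ_self J)))
      (fun j hj => hw j (hj.trans (Nat.lt_succ_self J)))
    have hC' : ‖diffQuot K ε (diffQuot K ε ((K ^ (n * J)) v))‖ ≤ C := by
      rw [diffQuot_pow_apply, diffQuot_pow_apply]
      exact (norm_pow_apply_le hK _ _).trans hC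
    have h1 := h.norm_exp_step_le hK hκ hε (hv J (Nat.lt_succ_self J))
      (hw J (Nat.lt_succ_self J)) hC' n
    have h2 : (K ^ n) ((K ^ (n * J)) v) = (K ^ (n * (J + 1))) v := by
      rw [← mul_apply_eq_comp, ← pow_add]
      congr 2
      ring
    rw [h2] at h1
    set q := ritzRate κ ε with hq
    have hq0 : ∀ i, q i ≤ 0 := fun i =>
      div_nonpos_of_nonpos_of_nonneg (by linarith [(abs_le.1 (hκ i)).2]) hε.le
    have h3 : diagMul (fun i => Real.exp ((J + 1 : ℕ) * (n * ε) * q i)) (coef ψ v)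
        - coef ψ ((K ^ (n * (J + 1))) v)
        = diagMul (fun i => Real.exp (n * ε * q i))
            (diagMul (fun i => Real.exp (J * (n * ε) * q i)) (coef ψ v)
              - coef ψ ((K ^ (n * J)) v))
          + (diagMul (fun i => Real.exp (n * ε * q i)) (coef ψ ((K ^ (n * J)) v))
            - coef ψ ((K ^ (n * (J + 1))) v)) := by
      ext i
      have : Real.exp ((J + 1 : ℕ) * (n * ε) * q i)
          = Real.exp (n * ε * q i) * Real.exp (J * (n * ε) * q i) := by
        rw [← Real.exp_add]
        congr 1
        push_cast
        ring
      simp only [PiLp.sub_apply, PiLp.add_apply, diagMul_apply, this]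
      ring
    rw [h3]
    refine (norm_add_le _ _).trans ?_
    have h4 := (norm_diagMul_le (f := fun i => Real.exp (n * ε * q i)) (fun i => by
      rw [abs_of_pos (Real.exp_pos _), Real.exp_le_one_iff]
      exact mul_nonpos_of_nonneg_of_nonpos (by positivity) (hq0 i)) _).trans ih'
    rw [Nat.cast_succ] at *
    linarith

end IsRitz

/-- An eigenvalue `κ` of the discrete semigroup against that of the chain with jumps at
exponential times: the factor `exp ((κ - 1) N)` is dominated by a power `κ ^ k` with `k` slightly
less than `N`, except for small `κ`, where it is exponentially small in `N`. -/
lemma exp_neg_mul_le {κ δ N : ℝ} (hκ0 : 0 ≤ κ) (hκ1 : κ ≤ 1) (hδ : δ < 1) (hN : 0 ≤ N)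
    {k : ℕ} (hk : k ≤ (1 - δ) * N) :
    Real.exp ((κ - 1) * N) ≤ Real.exp (-(δ * N)) + κ ^ k := by
  rcases le_or_gt (1 - κ) δ with h | h
  · -- here `κ ≥ 1 - δ > 0` and `κ ≥ exp (- (1 - κ) / κ) ≥ exp (- (1 - κ) / (1 - δ))`
    have hκ : 0 < κ := by linarith
    have h1 : Real.exp (-((1 - κ) / κ)) ≤ κ := by
      have h2 := Real.add_one_le_exp ((1 - κ) / κ)
      have h3 : (1 - κ) / κ + 1 = κ⁻¹ := by field_simp; ring
      rw [h3] at h2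
      rw [Real.exp_neg]
      exact inv_le_of_inv_le₀ hκ h2
    have h2 : Real.exp ((κ - 1) * N) ≤ κ ^ k := by
      calc Real.exp ((κ - 1) * N) ≤ Real.exp (-((1 - κ) / κ)) ^ k := by
            rw [← Real.exp_nat_mul]
            apply Real.exp_le_exp.2
            have h3 : (k : ℝ) ≤ κ * N := hk.trans (by gcongr; linarith)
            have h4 : (k : ℝ) * ((1 - κ) / κ) ≤ κ * N * ((1 - κ) / κ) := by
              have : 0 ≤ (1 - κ) / κ := div_nonneg (by linarith) hκ.le
              gcongr
            have h5 : κ * N * ((1 - κ) / κ) = N * (1 - κ) := by field_simp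
            linarith
        _ ≤ κ ^ k := by gcongr
    have := Real.exp_pos (-(δ * N))
    linarith
  · have h1 : Real.exp ((κ - 1) * N) ≤ Real.exp (-(δ * N)) := by
      apply Real.exp_le_exp.2
      nlinarith
    have : 0 ≤ κ ^ k := by positivity
    linarith

/-- The sum of `‖S ψ i‖ ^ 2` over a finite orthonormal family is at most the squared
Hilbert-Schmidt norm of a symmetric operator `S`. -/
lemma sum_norm_sq_le_of_hasSum {ι : Type*} (b : HilbertBasis ι ℝ H) {S : H →L[ℝ] H}
    (hS : ∀ f g, ⟪f, S g⟫ = ⟪S f, g⟫) {g : ℝ} (hg : HasSum (fun m => ‖S (b m)‖ ^ 2) g)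
    {ψ : A → H} (hψ : Orthonormal ℝ ψ) : ∑ i, ‖S (ψ i)‖ ^ 2 ≤ g := by
  have h1 : ∀ v : H, HasSum (fun m => ⟪v, b m⟫ ^ 2) (‖v‖ ^ 2) := by
    intro v
    have := b.hasSum_inner_mul_inner v v
    rw [real_inner_self_eq_norm_sq] at this
    refine this.congr_fun fun m => ?_
    rw [real_inner_comm v (b m), pow_two]
  have h2 : HasSum (fun m => ∑ i, ⟪S (ψ i), b m⟫ ^ 2) (∑ i, ‖S (ψ i)‖ ^ 2) :=
    hasSum_sum fun i _ => h1 _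
  refine hasSum_le (fun m => ?_) h2 hg
  have h3 := hψ.sum_inner_products_le (S (b m)) (s := Finset.univ)
  refine le_trans (le_of_eq (Finset.sum_congr rfl fun i _ => ?_)) h3
  rw [← hS, Real.norm_eq_abs, sq_abs]

namespace IsSymmSemigroup

variable {T : ℚ → H →L[ℝ] H}

omit [Fintype A] in
lemma ritz_mem_Icc (hT : IsSymmSemigroup T) {ε : ℚ} (hε : 0 < ε) {ψ : A → H} {κ : A → ℝ}
    (h : IsRitz (T ε) ψ κ) (i : A) : 0 ≤ κ i ∧ κ i ≤ 1 := by
  rw [← h.inner_self]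
  constructor
  · rw [hT.inner_self hε]
    exact sq_nonneg _
  · have := hT.inner_le ε hε (ψ i)
    rwa [h.orthonormal.1 i, one_pow] at this

/-- The trace of the approximating chain, bounded by the trace of the semigroup at an earlier
time; the error is exponentially small in `1 / ε`, so that it beats the cardinality of `A`. -/
lemma sum_exp_le (hT : IsSymmSemigroup T) {ε : ℚ} (hε : 0 < ε) {ψ : A → H} {κ : A → ℝ}
    (h : IsRitz (T ε) ψ κ) {ι : Type*} (b : HilbertBasis ι ℝ H) {g : ℝ} {k : ℕ} (hk : 0 < k)
    (hg : HasSum (fun m => ‖T (k * ε / 2) (b m)‖ ^ 2) g) {δ t : ℝ} (hδ : δ < 1) (ht : 0 ≤ t)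
    (hkt : k * (ε : ℝ) ≤ (1 - δ) * t) :
    ∑ i, Real.exp (t * ritzRate κ ε i)
      ≤ Fintype.card A * Real.exp (-(δ * (t / ε))) + g := by
  have hε' : (0 : ℝ) < ε := by exact_mod_cast hε
  have hk2 : 0 < (k : ℚ) * ε / 2 := by positivity
  have h1 : ∀ i, Real.exp (t * ritzRate κ ε i)
      ≤ Real.exp (-(δ * (t / ε))) + ‖T (k * ε / 2) (ψ i)‖ ^ 2 := by
    intro i
    obtain ⟨h0, h1⟩ := hT.ritz_mem_Icc hε h i
    have h2 : (k : ℝ) ≤ (1 - δ) * (t / ε) := by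
      rw [← mul_div_assoc, le_div_iff₀ hε']
      exact hkt
    have h3 := exp_neg_mul_le h0 h1 hδ (div_nonneg ht hε'.le) h2
    have h4 : t * ritzRate κ ε i = (κ i - 1) * (t / ε) := by
      rw [ritzRate]
      ring
    have h5 : κ i ^ k ≤ ‖T (k * ε / 2) (ψ i)‖ ^ 2 := by
      have := hT.inner_pow_le hε (h.orthonormal.1 i) k
      rw [h.inner_self] at this
      refine this.trans (le_of_eq ?_)
      obtain ⟨m, rfl⟩ : ∃ m, k = m + 1 := ⟨k - 1, by omega⟩
      rw [hT.pow_apply hε, hT.inner_self (by positivity)]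
    rw [h4]
    linarith
  refine (Finset.sum_le_sum fun i _ => h1 i).trans ?_
  rw [Finset.sum_add_distrib, Finset.sum_const, nsmul_eq_mul, Finset.card_univ]
  have := sum_norm_sq_le_of_hasSum b (hT.symm _ hk2) hg h.orthonormal
  linarith

/-- Two difference quotients of `T s u` are bounded by `(2 / s) ^ 2 * ‖u‖`, for `s = 2 k ε`. -/
lemma norm_diffQuot_diffQuot_le (hT : IsSymmSemigroup T) {ε : ℚ} (hε : 0 < ε) {k : ℕ} (hk : 0 < k)
    (u : H) :
    ‖diffQuot (T ε) ε (diffQuot (T ε) ε ((T ε ^ (k + k)) u))‖ ≤ ‖u‖ / (k * ε) ^ 2 := by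
  have hε' : (0 : ℝ) < ε := by exact_mod_cast hε
  have h1 : ∀ v, ‖(T ε ^ k) (diffQuot (T ε) ε v)‖ ≤ ‖v‖ / (k * ε) := by
    intro v
    have h2 := hT.norm_sub_pow_le hε k v
    rw [diffQuot_apply, map_smul, norm_smul, norm_inv, Real.norm_of_nonneg hε'.le,
      le_div_iff₀ (by positivity)]
    calc (ε : ℝ)⁻¹ * ‖(T ε ^ k) (T ε v - v)‖ * (k * ε)
        = k * ‖(T ε ^ k) (T ε v - v)‖ := by field_simp
      _ ≤ _ := h2
  rw [pow_add, mul_apply_eq_comp, diffQuot_pow_apply, diffQuot_pow_apply]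
  refine (h1 _).trans ?_
  rw [diffQuot_pow_apply, pow_two, ← div_div ‖u‖]
  exact div_le_div_of_nonneg_right (h1 u) (by positivity)

end IsSymmSemigroup

end ritz

/-! ### The operator semigroup at rational times -/

section ratSemigroup

local notation "⟪" x ", " y "⟫" => inner ℝ x y

/-- A positive rational number as a time; other rational numbers are sent to `1`. -/
def ratTime (q : ℚ) : PosReal := if h : 0 < q then ⟨q, by exact_mod_cast h⟩ else 1

lemma ratTime_coe {q : ℚ} (hq : 0 < q) : (ratTime q : ℝ) = q := by
  simp [ratTime, hq]

lemma ratTime_add {q r : ℚ} (hq : 0 < q) (hr : 0 < r) :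
    ratTime (q + r) = ratTime q + ratTime r := by
  apply Subtype.ext
  change (ratTime (q + r) : ℝ) = ratTime q + ratTime r
  rw [ratTime_coe hq, ratTime_coe hr, ratTime_coe (add_pos hq hr)]
  push_cast
  rfl

/-- The set of positive rational times. -/
def ratTimes : Set PosReal := ratTime '' Set.Ioi 0

lemma ratTime_mem {q : ℚ} (hq : 0 < q) : ratTime q ∈ ratTimes := ⟨q, hq, rfl⟩

lemma countable_ratTimes : ratTimes.Countable := (Set.to_countable _).image _

lemma add_mem_ratTimes : ∀ s ∈ ratTimes, ∀ t ∈ ratTimes, s + t ∈ ratTimes := by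
  rintro _ ⟨q, hq, rfl⟩ _ ⟨r, hr, rfl⟩
  rw [← ratTime_add hq hr]
  exact ratTime_mem (add_pos hq hr)

lemma half_mem_ratTimes : ∀ t ∈ ratTimes, half t ∈ ratTimes := by
  rintro _ ⟨q, hq, rfl⟩
  have hq : 0 < q := hq
  have : half (ratTime q) = ratTime (q / 2) := by
    apply Subtype.ext
    rw [ratTime_coe (half_pos hq)]
    change (ratTime q : ℝ) / 2 = _
    rw [ratTime_coe hq]
    push_cast
    rfl
  rw [this]
  exact ratTime_mem (half_pos hq)

variable {S : Type*} [MeasurableSpace S] {ν : Measure S} [IsProbabilityMeasure ν]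
  {p : PosReal → S → S → ℝ} {d : PosReal → S → ℝ} {D : Set PosReal}

/-- The constant function `1` as an element of `L²`. -/
def oneLp (ν : Measure S) [IsProbabilityMeasure ν] : Lp ℝ 2 ν := (memLp_const (1 : ℝ)).toLp _

lemma oneLp_coeFn : oneLp ν =ᵐ[ν] fun _ => (1 : ℝ) := MemLp.coeFn_toLp _

/-- The trace of the semigroup at a rational time, for the kernel with diagonal values `d`. -/
def trace (ν : Measure S) (d : PosReal → S → ℝ) (t : ℚ) : ℝ := ∫ x, d (ratTime t) x ∂ν

namespace IsKernelSemigroup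

lemma diag_symm (hK : IsKernelSemigroup ν p d D) {s t : PosReal} (hs : s ∈ D) (ht : t ∈ D) :
    ∀ᵐ x ∂ν, Integrable (fun w => p s x w * p t x w) ν ∧
      d (s + t) x = ∫ w, p s x w * p t x w ∂ν := by
  filter_upwards [hK.diag s hs t ht, Measure.ae_ae_of_ae_prod (hK.symm t ht)] with x hx hsx
  have h : (fun w => p s x w * p t x w) =ᵐ[ν] fun w => p s x w * p t w x := by
    filter_upwards [hsx] with w hw
    rw [hw]
  exact ⟨(integrable_congr h).2 hx.1, hx.2.trans (integral_congr_ae h).symm⟩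

lemma memLp (hK : IsKernelSemigroup ν p d D) {t : PosReal} (ht : t ∈ D) (ht2 : t + t ∈ D) :
    MemLp (Function.uncurry (p t)) 2 (ν.prod ν) := by
  rw [memLp_two_iff_integrable_sq (hK.measurable t).aestronglyMeasurable,
    integrable_prod_iff ((hK.measurable t).pow_const 2).aestronglyMeasurable]
  have h := hK.diag_symm ht ht
  constructor
  · filter_upwards [h] with x hx
    simpa only [Function.uncurry_apply_pair, sq] using hx.1
  · refine (integrable_congr ?_).2 (hK.integrable_diag _ ht2)
    filter_upwards [h] with x hx
    rw [hx.2]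
    refine integral_congr_ae (Eventually.of_forall fun y => ?_)
    simp [sq]

lemma integral_mul (hK : IsKernelSemigroup ν p d D) {s t : PosReal} (hs : s ∈ D) (ht : t ∈ D)
    (hs2 : s + s ∈ D) (ht2 : t + t ∈ D) :
    ∫ z, p s z.1 z.2 * p t z.1 z.2 ∂(ν.prod ν) = ∫ x, d (s + t) x ∂ν := by
  have hi : Integrable (fun z : S × S => p s z.1 z.2 * p t z.1 z.2) (ν.prod ν) :=
    (hK.memLp hs hs2).integrable_mul (hK.memLp ht ht2)
  rw [integral_prod _ hi]
  refine integral_congr_ae ?_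
  filter_upwards [hK.diag_symm hs ht] with x hx
  exact hx.2.symm

variable (hK : IsKernelSemigroup ν p d ratTimes)

include hK

/-- The operator on `L²` with kernel `p t`, for a positive rational time `t`, and `0` for other
rational numbers. -/
def op (t : ℚ) : Lp ℝ 2 ν →L[ℝ] Lp ℝ 2 ν :=
  if h : 0 < t then kernelOp ν (p (ratTime t)) (hK.measurable _)
    (hK.memLp (ratTime_mem h) (add_mem_ratTimes _ (ratTime_mem h) _ (ratTime_mem h))) else 0

lemma memLp_rat {t : ℚ} (h : 0 < t) : MemLp (Function.uncurry (p (ratTime t))) 2 (ν.prod ν) :=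
  hK.memLp (ratTime_mem h) (add_mem_ratTimes _ (ratTime_mem h) _ (ratTime_mem h))

lemma op_eq {t : ℚ} (h : 0 < t) :
    hK.op t = kernelOp ν (p (ratTime t)) (hK.measurable _) (hK.memLp_rat h) := by
  rw [op, dif_pos h]

lemma op_coeFn {t : ℚ} (h : 0 < t) (f : Lp ℝ 2 ν) :
    hK.op t f =ᵐ[ν] fun x => ∫ y, p (ratTime t) x y * f y ∂ν := by
  rw [hK.op_eq h]
  exact kernelOp_coeFn _ _ f

lemma inner_op {t : ℚ} (h : 0 < t) (f g : Lp ℝ 2 ν) :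
    ⟪f, hK.op t g⟫ = ∫ z, p (ratTime t) z.1 z.2 * (f z.1 * g z.2) ∂(ν.prod ν) := by
  rw [hK.op_eq h]
  exact inner_kernelOp _ _ f g

lemma symm_op {t : ℚ} (h : 0 < t) (f g : Lp ℝ 2 ν) : ⟪f, hK.op t g⟫ = ⟪hK.op t f, g⟫ := by
  rw [hK.op_eq h]
  exact inner_kernelOp_comm _ _ (hK.symm _ (ratTime_mem h)) f g

lemma op_add {s t : ℚ} (hs : 0 < s) (ht : 0 < t) (f : Lp ℝ 2 ν) :
    hK.op (s + t) f = hK.op s (hK.op t f) := by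
  rw [hK.op_eq hs, hK.op_eq ht, hK.op_eq (add_pos hs ht)]
  refine kernelOp_comp _ _ _ _ _ _ ?_ f
  filter_upwards [hK.comp _ (ratTime_mem hs) _ (ratTime_mem ht)] with z hz
  rw [ratTime_add hs ht]
  exact hz.2

/-- The Dirichlet form `⟪f, f - T t f⟫` of the semigroup, as an integral of squared differences. -/
lemma integral_sub_sq {t : ℚ} (ht : 0 < t) (f : Lp ℝ 2 ν) :
    Integrable (fun z : S × S => p (ratTime t) z.1 z.2 * (f z.1 - f z.2) ^ 2) (ν.prod ν) ∧
    ∫ z, p (ratTime t) z.1 z.2 * (f z.1 - f z.2) ^ 2 ∂(ν.prod ν)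
      = 2 * (‖f‖ ^ 2 - ⟪f, hK.op t f⟫) := by
  set k := p (ratTime t) with hk
  have hf2 : Integrable (fun x => f x ^ 2) ν := (Lp.memLp f).integrable_sq
  have hrow := hK.row _ (ratTime_mem ht)
  have hpos := hK.pos _ (ratTime_mem ht)
  have hsymm := hK.symm _ (ratTime_mem ht)
  have hfm : AEStronglyMeasurable f ν := (Lp.memLp f).aestronglyMeasurable
  have i1 : Integrable (fun z : S × S => k z.1 z.2 * f z.1 ^ 2) (ν.prod ν) := by
    have hm : AEStronglyMeasurable (fun z : S × S => k z.1 z.2 * f z.1 ^ 2) (ν.prod ν) :=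
      (hK.measurable _).aestronglyMeasurable.mul (hfm.comp_fst.pow 2)
    rw [integrable_prod_iff hm]
    constructor
    · filter_upwards [hrow] with x hx
      exact hx.1.mul_const _
    · refine (integrable_congr ?_).2 hf2
      filter_upwards [hrow, Measure.ae_ae_of_ae_prod hpos] with x hx hxp
      have h1 : f x ^ 2 = ∫ y, k x y * f x ^ 2 ∂ν := by
        rw [integral_mul_const, hx.2, one_mul]
      refine Eq.trans (integral_congr_ae ?_) h1.symm
      filter_upwards [hxp] with y hy
      rw [Real.norm_of_nonneg (mul_nonneg hy.le (sq_nonneg _))]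
  have e1 : ∫ z, k z.1 z.2 * f z.1 ^ 2 ∂(ν.prod ν) = ‖f‖ ^ 2 := by
    rw [integral_prod _ i1, norm_sq_eq_integral]
    refine integral_congr_ae ?_
    filter_upwards [hrow] with x hx
    rw [integral_mul_const, hx.2, one_mul]
  have hswap : (fun z : S × S => k z.1 z.2 * f z.2 ^ 2)
      =ᵐ[ν.prod ν] fun z => (fun z : S × S => k z.1 z.2 * f z.1 ^ 2) z.swap := by
    filter_upwards [hsymm] with z hz
    simp only [Prod.fst_swap, Prod.snd_swap, hk]
    rw [hz]
  have i2 : Integrable (fun z : S × S => k z.1 z.2 * f z.2 ^ 2) (ν.prod ν) :=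
    (integrable_congr hswap).2 i1.swap
  have e2 : ∫ z, k z.1 z.2 * f z.2 ^ 2 ∂(ν.prod ν) = ‖f‖ ^ 2 := by
    rw [integral_congr_ae hswap, integral_prod_swap (fun z : S × S => k z.1 z.2 * f z.1 ^ 2), e1]
  have i3 : Integrable (fun z : S × S => 2 * (k z.1 z.2 * (f z.1 * f z.2))) (ν.prod ν) :=
    (integrable_kernel_mul (hK.memLp_rat ht) (Lp.memLp f) (Lp.memLp f)).const_mul 2
  have i12 : Integrable (fun z : S × S => k z.1 z.2 * f z.1 ^ 2 + k z.1 z.2 * f z.2 ^ 2)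
      (ν.prod ν) := i1.add i2
  have heq : (fun z : S × S => k z.1 z.2 * (f z.1 - f z.2) ^ 2) = fun z =>
      (k z.1 z.2 * f z.1 ^ 2 + k z.1 z.2 * f z.2 ^ 2) - 2 * (k z.1 z.2 * (f z.1 * f z.2)) := by
    ext z
    ring
  rw [heq]
  refine ⟨i12.sub i3, ?_⟩
  rw [integral_sub i12 i3, integral_add i1 i2, e1, e2, integral_const_mul, hK.inner_op ht]
  ring

lemma isSymmSemigroup : IsSymmSemigroup hK.op where
  symm t ht f g := hK.symm_op ht f g
  add s t hs ht f := hK.op_add hs ht f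
  inner_le t ht f := by
    have h := (hK.integral_sub_sq ht f).2
    have h0 : 0 ≤ ∫ z, p (ratTime t) z.1 z.2 * (f z.1 - f z.2) ^ 2 ∂(ν.prod ν) := by
      refine integral_nonneg_of_ae ?_
      filter_upwards [hK.pos _ (ratTime_mem ht)] with z hz
      exact mul_nonneg hz.le (sq_nonneg _)
    linarith

/-- A vector on which the semigroup is isometric is constant. -/
lemma ae_const_of_inner_eq {t : ℚ} (ht : 0 < t) {f : Lp ℝ 2 ν} (h : ⟪f, hK.op t f⟫ = ‖f‖ ^ 2) :
    ∃ c : ℝ, ∀ᵐ x ∂ν, f x = c := by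
  obtain ⟨hi, he⟩ := hK.integral_sub_sq ht f
  rw [h, sub_self, mul_zero] at he
  have hpos := hK.pos _ (ratTime_mem ht)
  rw [integral_eq_zero_iff_of_nonneg_ae (by
    filter_upwards [hpos] with z hz
    exact mul_nonneg hz.le (sq_nonneg _)) hi] at he
  have h1 : ∀ᵐ z ∂(ν.prod ν), f z.1 = f z.2 := by
    filter_upwards [he, hpos] with z hz hp
    rcases mul_eq_zero.1 hz with h0 | h0
    · exact absurd h0 hp.ne'
    · exact sub_eq_zero.1 (pow_eq_zero_iff two_ne_zero |>.1 h0)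
  obtain ⟨x, hx⟩ := (Measure.ae_ae_of_ae_prod h1).exists
  exact ⟨f x, hx.mono fun y hy => hy.symm⟩

/-- The semigroup contracts the supremum norm. -/
lemma op_abs_le {t : ℚ} (ht : 0 < t) {f : Lp ℝ 2 ν} {R : ℝ} (h : ∀ᵐ x ∂ν, |f x| ≤ R) :
    ∀ᵐ x ∂ν, |hK.op t f x| ≤ R := by
  filter_upwards [hK.op_coeFn ht f, hK.row _ (ratTime_mem ht),
    Measure.ae_ae_of_ae_prod (hK.pos _ (ratTime_mem ht))] with x hx hr hp
  rw [hx, ← Real.norm_eq_abs]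
  calc ‖∫ y, p (ratTime t) x y * f y ∂ν‖ ≤ ∫ y, p (ratTime t) x y * R ∂ν := by
        refine norm_integral_le_of_norm_le (hr.1.mul_const R) ?_
        filter_upwards [h, hp] with y hy hpy
        rw [norm_mul, Real.norm_of_nonneg hpy.le]
        exact mul_le_mul_of_nonneg_left hy hpy.le
    _ = R := by rw [integral_mul_const, hr.2, one_mul]

lemma op_one {t : ℚ} (ht : 0 < t) : hK.op t (oneLp ν) = oneLp ν := by
  refine Lp.ext ?_
  filter_upwards [hK.op_coeFn ht (oneLp ν), hK.row _ (ratTime_mem ht), oneLp_coeFn (ν := ν)]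
    with x hx hr h1
  rw [hx, h1, ← hr.2]
  refine integral_congr_ae ?_
  filter_upwards [oneLp_coeFn (ν := ν)] with y hy
  rw [hy, mul_one]

/-- The trace is the squared Hilbert-Schmidt norm of the operator at half of the time. -/
lemma hasSum_op {ι : Type*} [Countable ι] (b : HilbertBasis ι ℝ (Lp ℝ 2 ν)) {t : ℚ}
    (ht : 0 < t) : HasSum (fun i => ‖hK.op t (b i)‖ ^ 2) (trace ν d (t + t)) := by
  have h := hasSum_norm_sq_kernelOp (hK.measurable (ratTime t)) (hK.memLp_rat ht) b
  have h2 := add_mem_ratTimes _ (ratTime_mem ht) _ (ratTime_mem ht)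
  have h3 := hK.integral_mul (ratTime_mem ht) (ratTime_mem ht) h2 h2
  rw [hK.op_eq ht, trace, ratTime_add ht ht, ← h3]
  simpa only [sq] using h

lemma trace_le {ι : Type*} [Countable ι] (b : HilbertBasis ι ℝ (Lp ℝ 2 ν)) {s t : ℚ}
    (hs : 0 < s) (hst : s ≤ t) : trace ν d t ≤ trace ν d s := by
  rcases hst.eq_or_lt with rfl | hst
  · exact le_rfl
  have h1 := hK.hasSum_op b (half_pos hs)
  have h2 := hK.hasSum_op b (half_pos (hs.trans hst))
  rw [add_halves] at h1 h2
  refine hasSum_le (fun i => ?_) h2 h1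
  have : t / 2 = (t - s) / 2 + s / 2 := by ring
  rw [this, hK.op_add (half_pos (sub_pos.2 hst)) (half_pos hs)]
  have := hK.isSymmSemigroup.norm_le (half_pos (sub_pos.2 hst)) (hK.op (s / 2) (b i))
  gcongr

/-- If the trace takes the same value at two times, then this value is `1`: the semigroup is then
isometric on its range, which therefore consists of constants. -/
lemma trace_eq_one_of_eq {ι : Type*} [Countable ι] (b : HilbertBasis ι ℝ (Lp ℝ 2 ν)) {s t : ℚ}
    (hs : 0 < s) (hst : s < t) (h : trace ν d t = trace ν d s) : trace ν d s = 1 := by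
  have h1 := hK.hasSum_op b (half_pos hs)
  have h2 := hK.hasSum_op b (half_pos (hs.trans hst))
  rw [add_halves] at h1 h2
  set r := (t - s) / 2 with hr
  have hr0 : 0 < r := half_pos (sub_pos.2 hst)
  have ht : t / 2 = r + s / 2 := by rw [hr]; ring
  have hle : ∀ i, ‖hK.op (t / 2) (b i)‖ ^ 2 ≤ ‖hK.op (s / 2) (b i)‖ ^ 2 := by
    intro i
    rw [ht, hK.op_add hr0 (half_pos hs)]
    have := hK.isSymmSemigroup.norm_le hr0 (hK.op (s / 2) (b i))
    gcongr
  have heq : ∀ i, ‖hK.op (t / 2) (b i)‖ ^ 2 = ‖hK.op (s / 2) (b i)‖ ^ 2 := by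
    intro i
    by_contra hne
    have := hasSum_lt hle (lt_of_le_of_ne (hle i) hne) h2 h1
    exact this.ne h
  have hconst : ∀ i, ‖hK.op (s / 2) (b i)‖ ^ 2 = ⟪oneLp ν, b i⟫ * ⟪b i, oneLp ν⟫ := by
    intro i
    set v := hK.op (s / 2) (b i) with hv
    have h3 : ⟪v, hK.op (r + r) v⟫ = ‖v‖ ^ 2 := by
      rw [hK.op_add hr0 hr0, hK.symm_op hr0, real_inner_self_eq_norm_sq, ← heq i, ht,
        hK.op_add hr0 (half_pos hs)]
    obtain ⟨c, hc⟩ := hK.ae_const_of_inner_eq (by positivity) h3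
    have h4 : ‖v‖ ^ 2 = c ^ 2 := by
      rw [norm_sq_eq_integral, integral_congr_ae (g := fun _ => c ^ 2)]
      · simp
      · filter_upwards [hc] with x hx
        rw [hx]
    have h5 : ⟪oneLp ν, v⟫ = c := by
      rw [inner_eq_integral_mul, integral_congr_ae (g := fun _ => c)]
      · simp
      · filter_upwards [hc, oneLp_coeFn (ν := ν)] with x hx h1
        rw [hx, h1, one_mul]
    rw [hv, hK.symm_op (half_pos hs), hK.op_one (half_pos hs)] at h5
    rw [h4, real_inner_comm (oneLp ν) (b i), h5, sq]
  have h3 := b.hasSum_inner_mul_inner (oneLp ν) (oneLp ν)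
  have h4 : ⟪oneLp ν, oneLp ν⟫ = 1 := by
    rw [inner_eq_integral_mul, integral_congr_ae (g := fun _ => (1 : ℝ))]
    · simp
    · filter_upwards [oneLp_coeFn (ν := ν)] with x h1
      rw [h1, one_mul]
  rw [h4] at h3
  simp only [hconst] at h1
  exact h1.unique h3

lemma trace_lt {ι : Type*} [Countable ι] (b : HilbertBasis ι ℝ (Lp ℝ 2 ν)) {s t : ℚ}
    (hs : 0 < s) (hst : s < t) (h : trace ν d s ≠ 1) : trace ν d t < trace ν d s :=
  lt_of_le_of_ne (hK.trace_le b hs hst.le) fun heq => h (hK.trace_eq_one_of_eq b hs hst heq)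

end IsKernelSemigroup

lemma _root_.HilbertBasis.countable {H : Type*} [NormedAddCommGroup H] [InnerProductSpace ℝ H]
    [TopologicalSpace.SeparableSpace H] {ι : Type*} (b : HilbertBasis ι ℝ H) : Countable ι := by
  refine Pairwise.countable_of_isOpen_disjoint (s := fun i => Metric.ball (b i) (1 / 2)) ?_
    (fun i => Metric.isOpen_ball) (fun i => Metric.nonempty_ball.2 (by norm_num))
  intro i j hij
  refine Metric.ball_disjoint_ball ?_
  have h1 : ‖b i - b j‖ ^ 2 = 2 := by
    rw [norm_sub_sq_real, b.orthonormal.1 i, b.orthonormal.1 j, b.orthonormal.2 hij]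
    norm_num
  rw [dist_eq_norm]
  nlinarith [norm_nonneg (b i - b j)]

omit [IsProbabilityMeasure ν] in
/-- Bounded functions are dense in `L²`. -/
lemma exists_bounded_approx (f : Lp ℝ 2 ν) {η : ℝ} (hη : 0 < η) :
    ∃ (g : Lp ℝ 2 ν) (R : ℝ), (∀ᵐ x ∂ν, |g x| ≤ R) ∧ ‖f - g‖ ≤ η := by
  obtain ⟨g, hg1, hg2⟩ := (Lp.memLp f).exists_simpleFunc_eLpNorm_sub_lt (by simp)
    (ENNReal.ofReal_pos.2 hη).ne'
  obtain ⟨R, hR⟩ := g.exists_forall_norm_le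
  refine ⟨hg2.toLp g, R, ?_, ?_⟩
  · filter_upwards [hg2.coeFn_toLp] with x hx
    rw [hx]
    exact hR x
  · rw [Lp.norm_def]
    refine ENNReal.toReal_le_of_le_ofReal hη.le (le_trans (le_of_eq ?_) hg1.le)
    refine eLpNorm_congr_ae ?_
    filter_upwards [Lp.coeFn_sub f (hg2.toLp g), hg2.coeFn_toLp] with x h1 h2
    rw [h1, Pi.sub_apply, Pi.sub_apply, h2]

end ratSemigroup

/-! ### Finite chains from symmetric matrices -/

section chain

variable {A : Type} [Fintype A] [DecidableEq A] {w : A → ℝ} {M : Matrix A A ℝ}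

lemma exists_spectral_decomposition (hM : M.IsSymm) :
    ∃ (U : Matrix A A ℝ) (κ : A → ℝ), U * U.transpose = 1 ∧ U.transpose * U = 1 ∧
      M = U * Matrix.diagonal κ * U.transpose := by
  have hH : M.IsHermitian := by
    rw [Matrix.IsHermitian, Matrix.conjTranspose_eq_transpose_of_trivial]
    exact hM
  refine ⟨hH.eigenvectorUnitary, hH.eigenvalues, ?_, ?_, ?_⟩
  · have := Unitary.coe_mul_star_self hH.eigenvectorUnitary
    rwa [Unitary.coe_star, Matrix.star_eq_conjTranspose,
      Matrix.conjTranspose_eq_transpose_of_trivial] at this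
  · have := Unitary.coe_star_mul_self hH.eigenvectorUnitary
    rwa [Matrix.star_eq_conjTranspose, Matrix.conjTranspose_eq_transpose_of_trivial] at this
  · have := hH.spectral_theorem
    rw [Unitary.conjStarAlgAut_apply, Matrix.star_eq_conjTranspose,
      Matrix.conjTranspose_eq_transpose_of_trivial] at this
    exact this

/-- A symmetric matrix with positive entries, such that conjugation by the square roots of the
weights `w` turns it into a stochastic matrix. -/
structure IsSymmStochastic (w : A → ℝ) (M : Matrix A A ℝ) : Prop where
  w_pos : ∀ a, 0 < w a
  w_sum : ∑ a, w a = 1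
  symm : M.IsSymm
  pos : ∀ a b, 0 < M a b
  row : ∀ a, ∑ b, M a b * √(w b) = √(w a)

/-- The rates of the continuous time chain which jumps at rate `r` according to the stochastic
matrix `(w a) ^ (-1/2) * M a b * (w b) ^ (1/2)`. -/
def rateMatrix (w : A → ℝ) (M : Matrix A A ℝ) (r : ℝ) : Matrix A A ℝ :=
  Matrix.of fun a b => r * ((√(w a))⁻¹ * M a b * √(w b) - (1 : Matrix A A ℝ) a b)

namespace IsSymmStochastic

/-- The finite chain with rates `rateMatrix w M r`. -/
def chain (h : IsSymmStochastic w M) (r : ℝ) (hr : 0 < r) : FiniteMarkovChain where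
  State := A
  Q := rateMatrix w M r
  Q_nonneg a b hab := by
    have := h.pos a b
    rw [rateMatrix, Matrix.of_apply, Matrix.one_apply_ne hab, sub_zero]
    positivity
  Q_row_sum a := by
    have h1 : ∀ b, (√(w a))⁻¹ * M a b * √(w b) = (√(w a))⁻¹ * (M a b * √(w b)) :=
      fun b => mul_assoc _ _ _
    simp only [rateMatrix, Matrix.of_apply]
    rw [← Finset.mul_sum, Finset.sum_sub_distrib]
    simp only [h1]
    rw [← Finset.mul_sum, h.row, inv_mul_cancel₀ (Real.sqrt_pos.2 (h.w_pos a)).ne']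
    simp [Matrix.one_apply]

/-- The weights as a probability distribution. -/
def law (h : IsSymmStochastic w M) : PMF A :=
  PMF.ofFintype (fun a => ENNReal.ofReal (w a)) (by
    rw [← ENNReal.ofReal_sum_of_nonneg fun a _ => (h.w_pos a).le, h.w_sum, ENNReal.ofReal_one])

omit [DecidableEq A] in
lemma law_apply (h : IsSymmStochastic w M) (a : A) : (h.law a).toReal = w a := by
  rw [law, PMF.ofFintype_apply, ENNReal.toReal_ofReal (h.w_pos a).le]

lemma detailedBalance (h : IsSymmStochastic w M) {r : ℝ} (hr : 0 < r) :
    (h.chain r hr).DetailedBalance h.law := by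
  intro (a : A) (b : A)
  change (h.law a).toReal * (r * ((√(w a))⁻¹ * M a b * √(w b) - (1 : Matrix A A ℝ) a b))
    = (h.law b).toReal * (r * ((√(w b))⁻¹ * M b a * √(w a) - (1 : Matrix A A ℝ) b a))
  rw [h.law_apply, h.law_apply]
  rcases eq_or_ne a b with rfl | hab
  · rfl
  rw [Matrix.one_apply_ne hab, Matrix.one_apply_ne hab.symm, ← h.symm.apply a b]
  have ha := Real.sqrt_pos.2 (h.w_pos a)
  have hb := Real.sqrt_pos.2 (h.w_pos b)
  nth_rewrite 1 [← Real.mul_self_sqrt (h.w_pos a).le]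
  nth_rewrite 2 [← Real.mul_self_sqrt (h.w_pos b).le]
  field_simp
  ring

lemma isStationary (h : IsSymmStochastic w M) {r : ℝ} (hr : 0 < r) :
    (h.chain r hr).IsStationary h.law := by
  intro b
  have h1 := h.detailedBalance hr
  simp only [h1 _ b]
  rw [← Finset.mul_sum, (h.chain r hr).Q_row_sum, mul_zero]

lemma isReversible (h : IsSymmStochastic w M) {r : ℝ} (hr : 0 < r) :
    (h.chain r hr).IsReversible := ⟨h.law, h.isStationary hr, h.detailedBalance hr⟩

variable {U : Matrix A A ℝ} {κ : A → ℝ}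

/-- The transition probabilities in terms of a spectral decomposition of `M`. -/
lemma exp_rateMatrix_apply (h : IsSymmStochastic w M) (r : ℝ) (hU : U * U.transpose = 1)
    (hU' : U.transpose * U = 1) (hM : M = U * Matrix.diagonal κ * U.transpose) (t : ℝ) (a b : A) :
    NormedSpace.exp (t • rateMatrix w M r) a b
      = (√(w a))⁻¹ * (∑ i, Real.exp (t * (r * (κ i - 1))) * (U a i * U b i)) * √(w b) := by
  set s : A → ℝ := fun a => √(w a) with hs
  have hs0 : ∀ a, s a ≠ 0 := fun a => (Real.sqrt_pos.2 (h.w_pos a)).ne'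
  set V : Matrix A A ℝ := Matrix.diagonal (fun a => (s a)⁻¹) * U with hV
  set W : Matrix A A ℝ := U.transpose * Matrix.diagonal s with hW
  have hd1 : Matrix.diagonal s * Matrix.diagonal (fun a => (s a)⁻¹) = (1 : Matrix A A ℝ) := by
    rw [Matrix.diagonal_mul_diagonal]
    simp [hs0]
  have hd2 : Matrix.diagonal (fun a => (s a)⁻¹) * Matrix.diagonal s = (1 : Matrix A A ℝ) := by
    rw [Matrix.diagonal_mul_diagonal]
    simp [hs0]
  have hVW : V * W = 1 := by
    rw [hV, hW, Matrix.mul_assoc, ← Matrix.mul_assoc U, hU, Matrix.one_mul, hd2]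
  have hWV : W * V = 1 := by
    rw [hV, hW, Matrix.mul_assoc, ← Matrix.mul_assoc (Matrix.diagonal s), hd1, Matrix.one_mul, hU']
  have hVinv : V⁻¹ = W := Matrix.inv_eq_right_inv hVW
  have hVunit : IsUnit V := ⟨⟨V, W, hVW, hWV⟩, rfl⟩
  have hQ : t • rateMatrix w M r
      = V * Matrix.diagonal (fun i => t * (r * (κ i - 1))) * V⁻¹ := by
    have h1 : Matrix.diagonal (fun i => t * (r * (κ i - 1)))
        = (t * r) • (Matrix.diagonal κ - (1 : Matrix A A ℝ)) := by
      ext i j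
      rcases eq_or_ne i j with rfl | hij
      · simp [mul_assoc]
      · simp [hij]
    have h2 : rateMatrix w M r = r • (Matrix.diagonal (fun a => (s a)⁻¹) * M * Matrix.diagonal s
        - (1 : Matrix A A ℝ)) := by
      ext a b
      rw [Matrix.smul_apply, Matrix.sub_apply, Matrix.mul_diagonal, Matrix.diagonal_mul]
      rfl
    rw [hVinv, h1, h2, smul_smul, Matrix.mul_smul, Matrix.smul_mul]
    congr 1
    rw [Matrix.mul_sub, Matrix.sub_mul, Matrix.mul_one, hVW, hM, hV, hW]
    simp only [Matrix.mul_assoc]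
  have hexp : NormedSpace.exp (t • rateMatrix w M r)
      = V * Matrix.diagonal (fun i => Real.exp (t * (r * (κ i - 1)))) * W := by
    have h3 : NormedSpace.exp (fun i => t * (r * (κ i - 1)))
        = fun i => Real.exp (t * (r * (κ i - 1))) := by
      rw [Pi.exp_def]
      simp only [Real.exp_eq_exp_ℝ]
    rw [hQ]
    refine (Matrix.exp_conj V _ hVunit).trans ?_
    rw [Matrix.exp_diagonal, hVinv, h3]
  rw [hexp]
  change (V * Matrix.diagonal (fun i => Real.exp (t * (r * (κ i - 1)))) * W) a b = _
  rw [Matrix.mul_apply, Finset.mul_sum, Finset.sum_mul]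
  refine Finset.sum_congr rfl fun i _ => ?_
  rw [Matrix.mul_diagonal, hV, hW, Matrix.diagonal_mul, Matrix.mul_diagonal,
    Matrix.transpose_apply]
  ring

lemma P_apply (h : IsSymmStochastic w M) {r : ℝ} (hr : 0 < r) (hU : U * U.transpose = 1)
    (hU' : U.transpose * U = 1) (hM : M = U * Matrix.diagonal κ * U.transpose) (t : ℝ) (a b : A) :
    (h.chain r hr).P t a b
      = (√(w a))⁻¹ * (∑ i, Real.exp (t * (r * (κ i - 1))) * (U a i * U b i)) * √(w b) :=
  h.exp_rateMatrix_apply r hU hU' hM t a b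

lemma G_eq (h : IsSymmStochastic w M) {r : ℝ} (hr : 0 < r) (hU : U * U.transpose = 1)
    (hU' : U.transpose * U = 1) (hM : M = U * Matrix.diagonal κ * U.transpose) (t : ℝ) :
    (h.chain r hr).G t = ∑ i, Real.exp (t * (r * (κ i - 1))) := by
  have h1 : ∀ a : A, (h.chain r hr).P t a a
      = ∑ i, Real.exp (t * (r * (κ i - 1))) * (U a i * U a i) := by
    intro a
    have h0 := (Real.sqrt_pos.2 (h.w_pos a)).ne'
    refine (h.P_apply hr hU hU' hM t a a).trans ?_
    field_simp
  have h2 : ∀ i, ∑ a, U a i * U a i = 1 := by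
    intro i
    have := congrFun (congrFun hU' i) i
    rwa [Matrix.mul_apply, Matrix.one_apply_eq] at this
  have h3 : ∑ a : A, ∑ i : A, Real.exp (t * (r * (κ i - 1))) * (U a i * U a i)
      = ∑ i, Real.exp (t * (r * (κ i - 1))) := by
    rw [Finset.sum_comm]
    refine Finset.sum_congr rfl fun i _ => ?_
    rw [← Finset.mul_sum, h2, mul_one]
  exact (Finset.sum_congr rfl fun a _ => h1 a).trans h3

/-- The density with respect to the stationary distribution, as a sum over the eigenfunctions
`(w a) ^ (-1/2) * U a i`. -/
lemma density_eq (h : IsSymmStochastic w M) {r : ℝ} (hr : 0 < r) (hU : U * U.transpose = 1)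
    (hU' : U.transpose * U = 1) (hM : M = U * Matrix.diagonal κ * U.transpose) (t : ℝ) (a b : A) :
    (h.chain r hr).density h.law t a b
      = ∑ i, Real.exp (t * (r * (κ i - 1))) * ((√(w a))⁻¹ * U a i * ((√(w b))⁻¹ * U b i)) := by
  have hb := (Real.sqrt_pos.2 (h.w_pos b)).ne'
  have h1 : (h.law b).toReal = √(w b) * √(w b) := by
    rw [Real.mul_self_sqrt (h.w_pos b).le, h.law_apply]
  refine (congrArg₂ (· / ·) (h.P_apply hr hU hU' hM t a b) h1).trans ?_
  rw [Finset.mul_sum, Finset.sum_mul, Finset.sum_div]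
  refine Finset.sum_congr rfl fun i _ => ?_
  field_simp

lemma isIrreducible (h : IsSymmStochastic w M) {r : ℝ} (hr : 0 < r) :
    (h.chain r hr).IsIrreducible := by
  intro t ht (a : A) (b : A)
  obtain ⟨U, κ, hU, hU', hM⟩ := exists_spectral_decomposition h.symm
  have ha := Real.sqrt_pos.2 (h.w_pos a)
  have hb := Real.sqrt_pos.2 (h.w_pos b)
  refine lt_of_lt_of_eq ?_ (h.P_apply hr hU hU' hM t a b).symm
  refine mul_pos (mul_pos (inv_pos.2 ha) ?_) hb
  have hpow : ∀ k : ℕ, M ^ k = U * Matrix.diagonal (fun i => κ i ^ k) * U.transpose := by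
    intro k
    induction k with
    | zero => simp [hU]
    | succ k ih =>
      rw [pow_succ, ih]
      nth_rewrite 1 [hM]
      simp only [Matrix.mul_assoc]
      rw [← Matrix.mul_assoc U.transpose U, hU', Matrix.one_mul,
        ← Matrix.mul_assoc (Matrix.diagonal _) (Matrix.diagonal _), Matrix.diagonal_mul_diagonal]
      simp only [pow_succ]
  have hpow_nonneg : ∀ (k : ℕ) (a b : A), 0 ≤ (M ^ k) a b := by
    intro k
    induction k with
    | zero =>
      intro a b
      rw [pow_zero, Matrix.one_apply]
      split_ifs <;> norm_num
    | succ k ih =>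
      intro a b
      rw [pow_succ, Matrix.mul_apply]
      exact Finset.sum_nonneg fun i _ => mul_nonneg (ih a i) (h.pos i b).le
  -- `exp (N (M - 1))` is a series in the nonnegative matrices `M ^ k`, with positive term `k = 1`
  set N := t * r with hN
  have hN0 : 0 < N := mul_pos ht hr
  have hsum : HasSum (fun k : ℕ => Real.exp (-N) * (N ^ k / k.factorial * (M ^ k) a b))
      (∑ i, Real.exp (t * (r * (κ i - 1))) * (U a i * U b i)) := by
    have h1 : ∀ i, HasSum (fun k : ℕ => Real.exp (-N) * ((N * κ i) ^ k / k.factorial)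
        * (U a i * U b i)) (Real.exp (t * (r * (κ i - 1))) * (U a i * U b i)) := by
      intro i
      have h2 : Real.exp (t * (r * (κ i - 1))) = Real.exp (-N) * Real.exp (N * κ i) := by
        rw [← Real.exp_add]
        congr 1
        rw [hN]
        ring
      rw [h2]
      refine HasSum.mul_right _ (HasSum.mul_left _ ?_)
      rw [Real.exp_eq_exp_ℝ]
      exact NormedSpace.expSeries_div_hasSum_exp (N * κ i)
    refine (hasSum_sum fun i _ => h1 i).congr_fun fun k => ?_
    rw [hpow, Matrix.mul_apply, Finset.mul_sum, Finset.mul_sum]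
    refine Finset.sum_congr rfl fun i _ => ?_
    rw [Matrix.mul_diagonal, Matrix.transpose_apply, mul_pow]
    ring
  have hnn : ∀ k : ℕ, 0 ≤ Real.exp (-N) * (N ^ k / k.factorial * (M ^ k) a b) := fun k =>
    mul_nonneg (Real.exp_pos _).le (mul_nonneg (by positivity) (hpow_nonneg k a b))
  refine lt_of_lt_of_le ?_ (le_hasSum hsum 1 fun k _ => hnn k)
  have := h.pos a b
  rw [pow_one, pow_one]
  positivity

end IsSymmStochastic

end chain

/-! ### Discretization of the state space -/

section cells

local notation "⟪" x ", " y "⟫" => inner ℝ x y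

variable {S : Type*} [MeasurableSpace S] {ν : Measure S} {A : Type} {c : S → A}

/-- The map `c` is measurable (for the discrete `σ`-algebra) and each of its fibres, the cells, has
positive measure. -/
structure IsCellMap (ν : Measure S) (c : S → A) : Prop where
  measurableSet : ∀ a, MeasurableSet (c ⁻¹' {a})
  pos : ∀ a, 0 < ν.real (c ⁻¹' {a})

/-- The measure of a cell. -/
def cellWeight (ν : Measure S) (c : S → A) (a : A) : ℝ := ν.real (c ⁻¹' {a})

/-- The indicator of a cell, normalized in `L²`. -/
def cellFun (ν : Measure S) (c : S → A) (a : A) : S → ℝ :=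
  (c ⁻¹' {a}).indicator fun _ => (√(cellWeight ν c a))⁻¹

/-- The class in `L²` of a square integrable function, and `0` for other functions. -/
def toL2 (ν : Measure S) (f : S → ℝ) : Lp ℝ 2 ν := by
  classical exact if h : MemLp f 2 ν then h.toLp f else 0

lemma toL2_coeFn {f : S → ℝ} (h : MemLp f 2 ν) : toL2 ν f =ᵐ[ν] f := by
  rw [toL2, dif_pos h]
  exact h.coeFn_toLp

variable [IsProbabilityMeasure ν]

lemma IsCellMap.memLp (hc : IsCellMap ν c) (a : A) : MemLp (cellFun ν c a) 2 ν :=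
  (memLp_const _).indicator (hc.measurableSet a)

/-- The normalized indicator of a cell, as an element of `L²`. -/
def cellVec (ν : Measure S) (c : S → A) (a : A) : Lp ℝ 2 ν := toL2 ν (cellFun ν c a)

omit [IsProbabilityMeasure ν] in
lemma cellFun_apply [DecidableEq A] (a : A) (x : S) :
    cellFun ν c a x = if c x = a then (√(cellWeight ν c a))⁻¹ else 0 := by
  by_cases h : c x = a <;> simp [cellFun, Set.indicator, h]

namespace IsCellMap

lemma cellVec_coeFn (hc : IsCellMap ν c) (a : A) : cellVec ν c a =ᵐ[ν] cellFun ν c a :=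
  toL2_coeFn (hc.memLp a)

omit [IsProbabilityMeasure ν] in
lemma sqrt_pos (hc : IsCellMap ν c) (a : A) : 0 < √(cellWeight ν c a) := Real.sqrt_pos.2 (hc.pos a)

lemma orthonormal (hc : IsCellMap ν c) : Orthonormal ℝ (cellVec ν c) := by
  classical
  rw [orthonormal_iff_ite]
  intro a b
  rw [inner_eq_integral_mul]
  have h : (fun x => cellVec ν c a x * cellVec ν c b x) =ᵐ[ν]
      (c ⁻¹' {a}).indicator fun _ => if a = b then (cellWeight ν c a)⁻¹ else 0 := by
    filter_upwards [hc.cellVec_coeFn a, hc.cellVec_coeFn b] with x ha hb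
    rw [ha, hb, cellFun_apply, cellFun_apply]
    by_cases hx : c x = a
    · subst hx
      simp only [if_true, Set.mem_preimage, Set.mem_singleton_iff, Set.indicator_of_mem]
      split_ifs with h
      · subst h
        rw [← mul_inv, Real.mul_self_sqrt (show 0 ≤ cellWeight ν c (c x) from (hc.pos _).le)]
      · simp
    · rw [if_neg hx, zero_mul, Set.indicator_of_notMem]
      simpa using hx
  rw [integral_congr_ae h, integral_indicator_const _ (hc.measurableSet a)]
  split_ifs with h
  · exact mul_inv_cancel₀ (hc.pos a).ne'
  · simp

variable [Fintype A]

lemma sum_smul_coeFn (hc : IsCellMap ν c) (φ : A → ℝ) :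
    ((∑ a, φ a • cellVec ν c a : Lp ℝ 2 ν) : S → ℝ)
      =ᵐ[ν] fun x => (√(cellWeight ν c (c x)))⁻¹ * φ (c x) := by
  classical
  have h1 := Lp.coeFn_finsetSum Finset.univ fun a => φ a • cellVec ν c a
  filter_upwards [h1, ae_all_iff.2 fun a => Lp.coeFn_smul (φ a) (cellVec ν c a),
    ae_all_iff.2 hc.cellVec_coeFn] with x h1 h2 h3
  rw [h1, Finset.sum_apply]
  simp only [h2, Pi.smul_apply, h3, cellFun_apply, smul_eq_mul, mul_ite, mul_zero]
  rw [Finset.sum_ite_eq Finset.univ (c x)]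
  simp [mul_comm]

lemma sum_sqrt_smul (hc : IsCellMap ν c) :
    ∑ a, √(cellWeight ν c a) • cellVec ν c a = oneLp ν := by
  refine Lp.ext ?_
  filter_upwards [hc.sum_smul_coeFn fun a => √(cellWeight ν c a), oneLp_coeFn (ν := ν)]
    with x h1 h2
  rw [h1, h2, inv_mul_cancel₀ (hc.sqrt_pos _).ne']

lemma sum_cellWeight (hc : IsCellMap ν c) : ∑ a, cellWeight ν c a = 1 := by
  simp only [cellWeight]
  have hU : ⋃ a, c ⁻¹' {a} = Set.univ := by
    ext x
    simp
  rw [← measureReal_iUnion_fintype ?_ hc.measurableSet, hU]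
  · simp
  · intro a b hab
    exact Disjoint.preimage c (by simpa using hab)

/-- A vector uniformly close to a function of the cell is close to the span of the cell
indicators. -/
lemma isApprox (hc : IsCellMap ν c) {v : Lp ℝ 2 ν} {θ : ℝ} (hθ : 0 ≤ θ) {φ : A → ℝ}
    (h : ∀ᵐ x ∂ν, |v x - φ (c x)| ≤ θ) : IsApprox (cellVec ν c) θ v := by
  refine ⟨∑ a, (√(cellWeight ν c a) * φ a) • cellVec ν c a, ?_, ?_⟩
  · exact Submodule.sum_mem _ fun a _ =>
      Submodule.smul_mem _ _ (Submodule.subset_span (Set.mem_range_self a))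
  · rw [← sq_le_sq₀ (norm_nonneg _) hθ, norm_sq_eq_integral]
    set v' : Lp ℝ 2 ν := ∑ a, (√(cellWeight ν c a) * φ a) • cellVec ν c a with hv'
    have h2 : ∀ᵐ x ∂ν, (v - v') x ^ 2 ≤ θ ^ 2 := by
      filter_upwards [h, Lp.coeFn_sub v v',
        hc.sum_smul_coeFn fun a => √(cellWeight ν c a) * φ a] with x hx hs hv
      rw [hs, Pi.sub_apply, hv, inv_mul_cancel_left₀ (hc.sqrt_pos _).ne', ← sq_abs]
      gcongr
    calc ∫ x, (v - v') x ^ 2 ∂ν ≤ ∫ _, θ ^ 2 ∂ν :=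
          integral_mono_ae (Lp.memLp (v - v')).integrable_sq (integrable_const _) h2
      _ = θ ^ 2 := by simp

end IsCellMap

/-- Finitely many bounded functions are simultaneously constant, up to an error `θ`, on the cells
of a partition, obtained by rounding their values to a grid of mesh `θ`. Cells of measure zero
are merged into another cell. -/
lemma exists_isCellMap {ι : Type} [Fintype ι] (v : ι → Lp ℝ 2 ν) {R θ : ℝ} (hθ : 0 < θ)
    (hv : ∀ i, ∀ᵐ x ∂ν, |v i x| ≤ R) :
    ∃ (A : Type) (_ : Fintype A) (c : S → A), IsCellMap ν c ∧
      Fintype.card A ≤ (⌊2 * R / θ⌋₊ + 1) ^ Fintype.card ι ∧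
      ∀ i, ∃ φ : A → ℝ, ∀ᵐ x ∂ν, |v i x - φ (c x)| ≤ θ := by
  classical
  set L := ⌊2 * R / θ⌋₊ with hL
  have hvm : ∀ i, Measurable (v i) := fun i => (Lp.stronglyMeasurable (v i)).measurable
  let c₀ : S → ι → Fin (L + 1) := fun x i =>
    ⟨min ⌊(v i x + R) / θ⌋₊ L, Nat.lt_succ_of_le (min_le_right _ _)⟩
  have hc₀ : Measurable c₀ := by
    refine measurable_pi_lambda _ fun i => ?_
    have h1 : Measurable fun x => ⌊(v i x + R) / θ⌋₊ :=
      Nat.measurable_floor.comp (((hvm i).add_const R).div_const θ)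
    have h2 : Measurable fun n : ℕ =>
        (⟨min n L, Nat.lt_succ_of_le (min_le_right _ _)⟩ : Fin (L + 1)) :=
      measurable_from_nat
    exact h2.comp h1
  let A := {a : ι → Fin (L + 1) // 0 < ν.real (c₀ ⁻¹' {a})}
  have hfib : ∀ a, MeasurableSet (c₀ ⁻¹' {a}) := fun a => hc₀ (measurableSet_singleton a)
  have hgood : ∀ᵐ x ∂ν, 0 < ν.real (c₀ ⁻¹' {c₀ x}) := by
    have h1 : ∀ a : ι → Fin (L + 1), ∀ᵐ x ∂ν, c₀ x = a → 0 < ν.real (c₀ ⁻¹' {a}) := by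
      intro a
      by_cases ha : 0 < ν.real (c₀ ⁻¹' {a})
      · exact Eventually.of_forall fun x _ => ha
      · have h0 : ν (c₀ ⁻¹' {a}) = 0 := by
          rw [measureReal_def, ENNReal.toReal_pos_iff] at ha
          push Not at ha
          by_contra hne
          exact (measure_lt_top ν _).ne (top_le_iff.1 (ha (pos_iff_ne_zero.2 hne)))
        filter_upwards [measure_eq_zero_iff_ae_notMem.1 h0] with x hx hxa
        exact absurd (by simpa using hxa) hx
    filter_upwards [ae_all_iff.2 h1] with x hx
    exact hx _ rfl
  obtain ⟨x₀, hx₀⟩ := hgood.exists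
  let a₀ : A := ⟨c₀ x₀, hx₀⟩
  let c : S → A := fun x => if h : 0 < ν.real (c₀ ⁻¹' {c₀ x}) then ⟨c₀ x, h⟩ else a₀
  have hcm : ∀ a : A, c ⁻¹' {a} = c₀ ⁻¹' {b | (if h : 0 < ν.real (c₀ ⁻¹' {b}) then
      (⟨b, h⟩ : A) else a₀) = a} := fun a => rfl
  have hc : ∀ᵐ x ∂ν, (c x : ι → Fin (L + 1)) = c₀ x := by
    filter_upwards [hgood] with x hx
    simp only [c, dif_pos hx]
  refine ⟨A, inferInstance, c, ⟨fun a => ?_, fun a => ?_⟩, ?_, fun i => ?_⟩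
  · rw [hcm]
    exact hc₀ (Set.toFinite _).measurableSet
  · refine a.2.trans_le (measureReal_mono ?_)
    intro x hx
    have hx' : c₀ x = a := hx
    have h0 : 0 < ν.real (c₀ ⁻¹' {c₀ x}) := by
      rw [hx']
      exact a.2
    change c x = a
    simp only [c, dif_pos h0]
    exact Subtype.ext hx'
  · refine (Fintype.card_subtype_le _).trans ?_
    simp
  · refine ⟨fun a => θ * (a.1 i : ℕ) - R, ?_⟩
    filter_upwards [hc, hv i] with x hx hvx
    rw [hx]
    simp only [c₀]
    obtain ⟨h1, h2⟩ := abs_le.1 hvx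
    have h3 : 0 ≤ (v i x + R) / θ := div_nonneg (by linarith) hθ.le
    have h4 : ⌊(v i x + R) / θ⌋₊ ≤ L := by
      apply Nat.floor_le_floor
      gcongr
      linarith
    rw [min_eq_left h4]
    have h5 := Nat.floor_le h3
    have h6 := Nat.lt_floor_add_one ((v i x + R) / θ)
    rw [le_div_iff₀ hθ] at h5
    rw [div_lt_iff₀ hθ] at h6
    rw [abs_le]
    constructor <;> linarith

end cells

/-! ### The approximating chains -/

section approximation

local notation "⟪" x ", " y "⟫" => inner ℝ x y

variable {S : Type*} [MeasurableSpace S] {ν : Measure S} [IsProbabilityMeasure ν]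
  {p : PosReal → S → S → ℝ} {d : PosReal → S → ℝ}
  {A : Type} [Fintype A] [DecidableEq A] {c : S → A}

/-- The matrix of the compression of an operator to the span of the cell indicators. -/
def cellMatrix (ν : Measure S) [IsProbabilityMeasure ν] (c : S → A) (K : Lp ℝ 2 ν →L[ℝ] Lp ℝ 2 ν) :
    Matrix A A ℝ :=
  Matrix.of fun a b => ⟪cellVec ν c a, K (cellVec ν c b)⟫

lemma IsKernelSemigroup.isSymmStochastic (hK : IsKernelSemigroup ν p d ratTimes)
    (hc : IsCellMap ν c) {ε : ℚ} (hε : 0 < ε) :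
    IsSymmStochastic (cellWeight ν c) (cellMatrix ν c (hK.op ε)) where
  w_pos := hc.pos
  w_sum := hc.sum_cellWeight
  symm := by
    refine Matrix.IsSymm.ext fun a b => ?_
    simp only [cellMatrix, Matrix.of_apply]
    rw [hK.symm_op hε, real_inner_comm]
  pos a b := by
    simp only [cellMatrix, Matrix.of_apply]
    rw [hK.inner_op hε]
    have hi := integrable_kernel_mul (hK.memLp_rat hε) (Lp.memLp (cellVec ν c a))
      (Lp.memLp (cellVec ν c b))
    have h1 := (Measure.quasiMeasurePreserving_fst (μ := ν) (ν := ν)).ae (hc.cellVec_coeFn a)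
    have h2 := (Measure.quasiMeasurePreserving_snd (μ := ν) (ν := ν)).ae (hc.cellVec_coeFn b)
    have hnn : 0 ≤ᵐ[ν.prod ν] fun z : S × S =>
        p (ratTime ε) z.1 z.2 * (cellVec ν c a z.1 * cellVec ν c b z.2) := by
      filter_upwards [hK.pos _ (ratTime_mem hε), h1, h2] with z hz ha hb
      rw [ha, hb, cellFun_apply, cellFun_apply]
      have := hc.sqrt_pos a
      have := hc.sqrt_pos b
      refine mul_nonneg hz.le (mul_nonneg ?_ ?_) <;> split_ifs <;> positivity
    rw [integral_pos_iff_support_of_nonneg_ae hnn hi]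
    have hab : 0 < (ν.prod ν) ((c ⁻¹' {a}) ×ˢ (c ⁻¹' {b})) := by
      rw [Measure.prod_prod]
      have ha := hc.pos a
      have hb := hc.pos b
      rw [measureReal_def, ENNReal.toReal_pos_iff] at ha hb
      exact ENNReal.mul_pos ha.1.ne' hb.1.ne'
    refine hab.trans_le (measure_mono_ae ?_)
    filter_upwards [hK.pos _ (ratTime_mem hε), h1, h2] with z hz ha hb hmem
    obtain ⟨hza, hzb⟩ := hmem
    change p (ratTime ε) z.1 z.2 * (cellVec ν c a z.1 * cellVec ν c b z.2) ≠ 0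
    rw [ha, hb, cellFun_apply, cellFun_apply, if_pos (by simpa using hza),
      if_pos (by simpa using hzb)]
    have := hc.sqrt_pos a
    have := hc.sqrt_pos b
    positivity
  row a := by
    have h1 : ∑ b, cellMatrix ν c (hK.op ε) a b * √(cellWeight ν c b)
        = ⟪cellVec ν c a, hK.op ε (oneLp ν)⟫ := by
      rw [← hc.sum_sqrt_smul, map_sum, inner_sum]
      refine Finset.sum_congr rfl fun b _ => ?_
      rw [map_smul, inner_smul_right, mul_comm]
      rfl
    rw [h1, hK.op_one hε, ← hc.sum_sqrt_smul, inner_sum]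
    simp only [inner_smul_right, orthonormal_iff_ite.1 hc.orthonormal]
    simp

/-- The vectors with coordinates the columns of `U` in the basis of cell indicators. -/
def ritzVec (ν : Measure S) [IsProbabilityMeasure ν] (c : S → A) (U : Matrix A A ℝ) (i : A) :
    Lp ℝ 2 ν := ∑ a, U a i • cellVec ν c a

variable {U : Matrix A A ℝ} {κ : A → ℝ}

omit [DecidableEq A] in
lemma IsCellMap.ritzVec_coeFn (hc : IsCellMap ν c) (i : A) :
    ritzVec ν c U i =ᵐ[ν] fun x => (√(cellWeight ν c (c x)))⁻¹ * U (c x) i :=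
  hc.sum_smul_coeFn fun a => U a i

omit [DecidableEq A] in
lemma inner_ritzVec (K : Lp ℝ 2 ν →L[ℝ] Lp ℝ 2 ν) (i j : A) :
    ⟪ritzVec ν c U i, K (ritzVec ν c U j)⟫ = (U.transpose * cellMatrix ν c K * U) i j := by
  simp only [ritzVec, map_sum, map_smul, sum_inner, inner_sum, inner_smul_left, inner_smul_right,
    Matrix.mul_apply, Matrix.transpose_apply, cellMatrix, Matrix.of_apply, Finset.sum_mul,
    Real.ringHom_apply]
  refine Finset.sum_congr rfl fun b _ => ?_
  rw [Finset.mul_sum]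
  refine Finset.sum_congr rfl fun a _ => ?_
  ring

lemma IsCellMap.orthonormal_ritzVec (hc : IsCellMap ν c) (hU' : U.transpose * U = 1) :
    Orthonormal ℝ (ritzVec ν c U) := by
  rw [orthonormal_iff_ite]
  intro i j
  have h2 := inner_ritzVec (c := c) (U := U) (ContinuousLinearMap.id ℝ (Lp ℝ 2 ν)) i j
  have h3 : cellMatrix ν c (ContinuousLinearMap.id ℝ (Lp ℝ 2 ν)) = 1 := by
    ext a b
    simp only [cellMatrix, Matrix.of_apply, ContinuousLinearMap.id_apply,
      orthonormal_iff_ite.1 hc.orthonormal, Matrix.one_apply]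
  rw [h3, Matrix.mul_one, hU'] at h2
  exact h2.trans (Matrix.one_apply)

lemma IsCellMap.isRitz (hc : IsCellMap ν c) {K : Lp ℝ 2 ν →L[ℝ] Lp ℝ 2 ν}
    (hU' : U.transpose * U = 1) (hM : cellMatrix ν c K = U * Matrix.diagonal κ * U.transpose) :
    IsRitz K (ritzVec ν c U) κ := by
  have h1 : ∀ i j, ⟪ritzVec ν c U i, K (ritzVec ν c U j)⟫ = Matrix.diagonal κ i j := by
    intro i j
    rw [inner_ritzVec, hM]
    simp only [Matrix.mul_assoc, hU', Matrix.mul_one]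
    rw [← Matrix.mul_assoc, hU', Matrix.one_mul]
  exact ⟨hc.orthonormal_ritzVec hU', fun i => by rw [h1, Matrix.diagonal_apply_eq],
    fun i j hij => by rw [h1, Matrix.diagonal_apply_ne _ hij]⟩

lemma isApprox_ritzVec (hU : U * U.transpose = 1) {θ : ℝ} {v : Lp ℝ 2 ν}
    (h : IsApprox (cellVec ν c) θ v) : IsApprox (ritzVec ν c U) θ v := by
  obtain ⟨v', hv', hθ⟩ := h
  refine ⟨v', ?_, hθ⟩
  refine Submodule.span_le.2 ?_ hv'
  rintro _ ⟨a, rfl⟩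
  have h1 : cellVec ν c a = ∑ i, U a i • ritzVec ν c U i := by
    simp only [ritzVec, Finset.smul_sum, smul_smul]
    rw [Finset.sum_comm]
    simp only [← Finset.sum_smul]
    have h2 : ∀ b, ∑ i, U a i * U b i = (1 : Matrix A A ℝ) a b := by
      intro b
      rw [← hU, Matrix.mul_apply]
      rfl
    simp only [h2]
    simp [Matrix.one_apply]
  rw [h1]
  exact Submodule.sum_mem _ fun i _ =>
    Submodule.smul_mem _ _ (Submodule.subset_span (Set.mem_range_self i))

end approximation

/-! ### Existence of good approximations -/

section approximation

local notation "⟪" x ", " y "⟫" => inner ℝ x y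

/-- A finite chain whose states are the cells of a partition of the state space `S`, together with a
spectral decomposition `M = U * diagonal κ * Uᵀ` of its symmetrized transition matrix. The chain
jumps at rate `ρ`. -/
structure Approximation {S : Type*} [MeasurableSpace S] (ν : Measure S) [IsProbabilityMeasure ν]
    where
  State : Type
  [fintype : Fintype State]
  [decidableEq : DecidableEq State]
  cell : S → State
  isCellMap : IsCellMap ν cell
  M : Matrix State State ℝ
  stoch : IsSymmStochastic (cellWeight ν cell) M
  U : Matrix State State ℝ
  κ : State → ℝ
  mul_transpose : U * U.transpose = 1
  transpose_mul : U.transpose * U = 1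
  spectral : M = U * Matrix.diagonal κ * U.transpose
  κ_le : ∀ i, κ i ≤ 1
  ρ : ℝ
  ρ_pos : 0 < ρ

section

variable {H : Type*} [NormedAddCommGroup H] [InnerProductSpace ℝ H] {A : Type*} [Fintype A]

lemma inner_diagMul_coef (ψ : A → H) (e : A → ℝ) (f : H) :
    ⟪coef ψ f, diagMul e (coef ψ f)⟫ = ∑ i, e i * ⟪ψ i, f⟫ ^ 2 := by
  rw [PiLp.inner_apply]
  refine Finset.sum_congr rfl fun i _ => ?_
  simp only [diagMul_apply, coef_apply, RCLike.inner_apply, conj_trivial]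
  ring

lemma abs_sum_mul_sq_sub_le {ψ : A → H} (hψ : Orthonormal ℝ ψ) {e : A → ℝ} (he : ∀ i, |e i| ≤ 1)
    (f g : H) : |∑ i, e i * ⟪ψ i, f⟫ ^ 2 - ∑ i, e i * ⟪ψ i, g⟫ ^ 2| ≤ ‖f - g‖ * (‖f‖ + ‖g‖) := by
  have h1 : ∑ i, e i * ⟪ψ i, f⟫ ^ 2 - ∑ i, e i * ⟪ψ i, g⟫ ^ 2
      = ⟪diagMul e (coef ψ (f - g)), coef ψ (f + g)⟫ := by
    rw [PiLp.inner_apply, ← Finset.sum_sub_distrib]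
    refine Finset.sum_congr rfl fun i _ => ?_
    simp only [diagMul_apply, coef_apply, RCLike.inner_apply, conj_trivial, inner_sub_right,
      inner_add_right]
    ring
  rw [h1]
  refine (abs_real_inner_le_norm _ _).trans ?_
  gcongr
  · exact (norm_diagMul_le he _).trans (norm_coef_le hψ _)
  · exact (norm_coef_le hψ _).trans (norm_add_le f g)

lemma IsSymmSemigroup.abs_inner_sub_le {T : ℚ → H →L[ℝ] H} (hT : IsSymmSemigroup T) {t : ℚ}
    (ht : 0 < t) (f g : H) : |⟪f, T t f⟫ - ⟪g, T t g⟫| ≤ ‖f - g‖ * (‖f‖ + ‖g‖) := by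
  have h1 : ⟪f, T t f⟫ - ⟪g, T t g⟫ = ⟪T t (f - g), f + g⟫ := by
    rw [map_sub, inner_sub_left, inner_add_right, inner_add_right, ← hT.symm t ht f f,
      ← hT.symm t ht f g, ← hT.symm t ht g f, ← hT.symm t ht g g,
      show ⟪f, T t g⟫ = ⟪g, T t f⟫ by rw [hT.symm t ht, real_inner_comm]]
    ring
  rw [h1]
  refine (abs_real_inner_le_norm _ _).trans ?_
  gcongr
  · exact hT.norm_le ht _
  · exact norm_add_le f g

/-- Comparison of the quadratic forms of the approximating chain and of the semigroup, at a vector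
regularized by the semigroup. -/
lemma IsSymmSemigroup.abs_sum_exp_sub_le {T : ℚ → H →L[ℝ] H} (hT : IsSymmSemigroup T) {ε : ℚ}
    (hε : 0 < ε) {ψ : A → H} {κ : A → ℝ} (h : IsRitz (T ε) ψ κ) (u : H) {δ : ℝ} {k n J : ℕ}
    (hk : 0 < k) (hJ : 0 < J)
    (hv : ∀ j < J, IsApprox ψ (δ * ε) ((T ε ^ (n * j)) ((T ε ^ (k + k)) u)))
    (hw : ∀ j < J, IsApprox ψ (δ * ε) (diffQuot (T ε) ε ((T ε ^ (n * j)) ((T ε ^ (k + k)) u)))) :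
    |∑ i, Real.exp (J * (n * ε) * ritzRate κ ε i) * ⟪ψ i, (T ε ^ (k + k)) u⟫ ^ 2
        - ⟪(T ε ^ (k + k)) u, (T ε ^ (n * J)) ((T ε ^ (k + k)) u)⟫|
      ≤ ‖u‖ * (J * ((n * ε) * (2 * δ) + (n * ε) ^ 2 * (2 * δ + 2 * (‖u‖ / (k * ε) ^ 2)))
        + 2 * (δ * ε)) := by
  set x := (T ε ^ (k + k)) u with hx
  set e : A → ℝ := fun i => Real.exp (J * (n * ε) * ritzRate κ ε i) with he
  have hε' : (0 : ℝ) < ε := by exact_mod_cast hε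
  have hκ : ∀ i, |κ i| ≤ 1 := fun i => by
    obtain ⟨h0, h1⟩ := hT.ritz_mem_Icc hε h i
    rwa [abs_of_nonneg h0]
  have hxu : ‖x‖ ≤ ‖u‖ := hT.norm_pow_le hε _ _
  have h1 := h.norm_exp_sub_le (hT.norm_le hε) hκ hε' n J hv hw
    (hT.norm_diffQuot_diffQuot_le hε hk u)
  have hv0 : IsApprox ψ (δ * ε) x := by simpa using hv 0 hJ
  have h2 := abs_inner_coef_sub_le h.orthonormal hv0 ((T ε ^ (n * J)) x)
  have h3 := abs_real_inner_le_norm (coef ψ x) (diagMul e (coef ψ x) - coef ψ ((T ε ^ (n * J)) x))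
  rw [inner_sub_right, inner_diagMul_coef] at h3
  have h4 := hT.norm_pow_le hε (n * J) x
  have hδ : 0 ≤ δ * ε := by
    obtain ⟨v', _, h⟩ := hv0
    exact (norm_nonneg _).trans h
  have h5 : ‖coef ψ x‖ * ‖diagMul e (coef ψ x) - coef ψ ((T ε ^ (n * J)) x)‖
      ≤ ‖u‖ * (J * ((n * ε) * (2 * δ) + (n * ε) ^ 2 * (2 * δ + 2 * (‖u‖ / (k * ε) ^ 2)))) :=
    mul_le_mul ((norm_coef_le h.orthonormal x).trans hxu) h1 (norm_nonneg _) (norm_nonneg _)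
  have h6 : 2 * (δ * ε) * ‖(T ε ^ (n * J)) x‖ ≤ 2 * (δ * ε) * ‖u‖ := by
    have := h4.trans hxu
    gcongr
  have h7 := abs_sub_le (∑ i, e i * ⟪ψ i, x⟫ ^ 2) ⟪coef ψ x, coef ψ ((T ε ^ (n * J)) x)⟫
    ⟪x, (T ε ^ (n * J)) x⟫
  linarith

end

/-- Polynomial growth is beaten by exponential decay. -/
lemma tendsto_floor_pow_mul_exp (a : ℝ) (m : ℕ) {β : ℝ} (hβ : 0 < β) :
    Tendsto (fun n : ℕ => (((⌊a * n ^ 2⌋₊ + 1) ^ m : ℕ) : ℝ) * Real.exp (-(β * n))) atTop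
      (𝓝 0) := by
  have h1 : Tendsto (fun n : ℕ => (|a| + 1) ^ m * (β⁻¹ ^ (2 * m) *
      ((β * n) ^ (2 * m) * Real.exp (-(β * n))))) atTop (𝓝 0) := by
    have h2 := (Real.tendsto_pow_mul_exp_neg_atTop_nhds_zero (2 * m)).comp
      (tendsto_natCast_atTop_atTop.const_mul_atTop hβ)
    have h3 := (h2.const_mul (β⁻¹ ^ (2 * m))).const_mul ((|a| + 1) ^ m)
    simpa using h3
  refine squeeze_zero' (Eventually.of_forall fun n => by positivity) ?_ h1
  filter_upwards [eventually_ge_atTop 1] with n hn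
  have hn' : (1 : ℝ) ≤ n := by exact_mod_cast hn
  have h2 : ((⌊a * n ^ 2⌋₊ + 1 : ℕ) : ℝ) ≤ (|a| + 1) * n ^ 2 := by
    have h3 : (⌊a * n ^ 2⌋₊ : ℝ) ≤ |a| * n ^ 2 := by
      refine (Nat.cast_le.2 (Nat.floor_le_floor (?_ : a * n ^ 2 ≤ |a| * n ^ 2))).trans
        (Nat.floor_le (by positivity))
      gcongr
      exact le_abs_self a
    push_cast
    nlinarith
  calc (((⌊a * n ^ 2⌋₊ + 1) ^ m : ℕ) : ℝ) * Real.exp (-(β * n))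
      = ((⌊a * n ^ 2⌋₊ + 1 : ℕ) : ℝ) ^ m * Real.exp (-(β * n)) := by push_cast; rfl
    _ ≤ ((|a| + 1) * n ^ 2) ^ m * Real.exp (-(β * n)) := by gcongr
    _ = _ := by
      rw [mul_pow, mul_pow, ← pow_mul, inv_pow]
      field_simp

namespace Approximation

variable {S : Type*} [MeasurableSpace S] {ν : Measure S} [IsProbabilityMeasure ν]

instance (𝒜 : Approximation ν) : Fintype 𝒜.State := 𝒜.fintype

instance (𝒜 : Approximation ν) : DecidableEq 𝒜.State := 𝒜.decidableEq

variable (𝒜 : Approximation ν)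

/-- The eigenvalues of the generator. -/
def rate (i : 𝒜.State) : ℝ := 𝒜.ρ * (𝒜.κ i - 1)

lemma rate_nonpos (i : 𝒜.State) : 𝒜.rate i ≤ 0 :=
  mul_nonpos_of_nonneg_of_nonpos 𝒜.ρ_pos.le (by linarith [𝒜.κ_le i])

/-- The eigenvectors of the generator, as functions on `S`. -/
def vec (i : 𝒜.State) : Lp ℝ 2 ν := ritzVec ν 𝒜.cell 𝒜.U i

lemma orthonormal : Orthonormal ℝ 𝒜.vec := 𝒜.isCellMap.orthonormal_ritzVec 𝒜.transpose_mul

/-- The trace of the semigroup of the chain. -/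
def tr (t : ℝ) : ℝ := ∑ i, Real.exp (t * 𝒜.rate i)

/-- The quadratic form of the semigroup of the chain. -/
def form (t : ℝ) (f : Lp ℝ 2 ν) : ℝ := ∑ i, Real.exp (t * 𝒜.rate i) * ⟪𝒜.vec i, f⟫ ^ 2

lemma exp_le_one {t : ℝ} (ht : 0 ≤ t) (i : 𝒜.State) : |Real.exp (t * 𝒜.rate i)| ≤ 1 := by
  rw [abs_of_pos (Real.exp_pos _), Real.exp_le_one_iff]
  exact mul_nonpos_of_nonneg_of_nonpos ht (𝒜.rate_nonpos i)

lemma abs_form_sub_le {t : ℝ} (ht : 0 ≤ t) (f g : Lp ℝ 2 ν) :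
    |𝒜.form t f - 𝒜.form t g| ≤ ‖f - g‖ * (‖f‖ + ‖g‖) :=
  abs_sum_mul_sq_sub_le 𝒜.orthonormal (𝒜.exp_le_one ht) f g

end Approximation

end approximation

section existence

local notation "⟪" x ", " y "⟫" => inner ℝ x y

variable {S : Type*} [MeasurableSpace S] {ν : Measure S} [IsProbabilityMeasure ν]
  {p : PosReal → S → S → ℝ} {d : PosReal → S → ℝ}

namespace IsKernelSemigroup

variable (hK : IsKernelSemigroup ν p d ratTimes)

include hK

lemma op_pow_abs_le {t : ℚ} (ht : 0 < t) {f : Lp ℝ 2 ν} {R : ℝ} (h : ∀ᵐ x ∂ν, |f x| ≤ R) (n : ℕ) :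
    ∀ᵐ x ∂ν, |(hK.op t ^ n) f x| ≤ R := by
  induction n with
  | zero => simpa using h
  | succ n ih =>
    rw [pow_succ', mul_apply_eq_comp]
    exact hK.op_abs_le ht ih

omit hK [IsProbabilityMeasure ν] in
lemma _root_.MarkovLimit.diffQuot_abs_le {K : Lp ℝ 2 ν →L[ℝ] Lp ℝ 2 ν} {ε R : ℝ} (hε : 0 < ε)
    {f : Lp ℝ 2 ν} (h : ∀ᵐ x ∂ν, |f x| ≤ R) (h' : ∀ᵐ x ∂ν, |K f x| ≤ R) :
    ∀ᵐ x ∂ν, |diffQuot K ε f x| ≤ 2 * R / ε := by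
  rw [diffQuot_apply]
  filter_upwards [h, h', Lp.coeFn_smul ε⁻¹ (K f - f), Lp.coeFn_sub (K f) f] with x h1 h2 h3 h4
  rw [h3, Pi.smul_apply, h4, Pi.sub_apply, smul_eq_mul, abs_mul, abs_inv, abs_of_pos hε,
    inv_mul_eq_div]
  gcongr
  exact (abs_sub _ _).trans (by linarith)

/-- The approximation associated with a discretization of the state space and of the time. -/
def approximation {A : Type} [Fintype A] [DecidableEq A] {c : S → A} (hc : IsCellMap ν c) {ε : ℚ}
    (hε : 0 < ε) {U : Matrix A A ℝ} {κ : A → ℝ} (hU : U * U.transpose = 1)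
    (hU' : U.transpose * U = 1)
    (hM : cellMatrix ν c (hK.op ε) = U * Matrix.diagonal κ * U.transpose) : Approximation ν where
  State := A
  cell := c
  isCellMap := hc
  M := cellMatrix ν c (hK.op ε)
  stoch := hK.isSymmStochastic hc hε
  U := U
  κ := κ
  mul_transpose := hU
  transpose_mul := hU'
  spectral := hM
  κ_le i := (hK.isSymmSemigroup.ritz_mem_Icc hε (hc.isRitz hU' hM) i).2
  ρ := (ε : ℝ)⁻¹
  ρ_pos := inv_pos.2 (by exact_mod_cast hε)

/-- Discretization at time scale `ε` and with cells adapted to finitely many vectors. -/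
lemma exists_approximation_of_bounded {ι : Type} [Fintype ι] (v : ι → Lp ℝ 2 ν) {R δ : ℝ} {ε : ℚ}
    (hε : 0 < ε) (hε1 : ε ≤ 1) (hδ : 0 < δ) (hR : 0 ≤ R) (hv : ∀ i, ∀ᵐ x ∂ν, |v i x| ≤ R) :
    ∃ (𝒜 : Approximation ν), IsRitz (hK.op ε) 𝒜.vec 𝒜.κ ∧ (∀ i, 𝒜.rate i = ritzRate 𝒜.κ ε i) ∧
      Fintype.card 𝒜.State ≤ (⌊4 * R / (δ * ε ^ 2)⌋₊ + 1) ^ (Fintype.card ι + Fintype.card ι) ∧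
      ∀ i, IsApprox 𝒜.vec (δ * ε) (v i) ∧ IsApprox 𝒜.vec (δ * ε) (diffQuot (hK.op ε) ε (v i)) := by
  classical
  have hε' : (0 : ℝ) < ε := by exact_mod_cast hε
  have hε1' : (ε : ℝ) ≤ 1 := by exact_mod_cast hε1
  have hw : ∀ i, ∀ᵐ x ∂ν, |diffQuot (hK.op ε) ε (v i) x| ≤ 2 * R / ε := fun i =>
    diffQuot_abs_le hε' (hv i) (hK.op_abs_le hε (hv i))
  have hv' : ∀ i, ∀ᵐ x ∂ν, |v i x| ≤ 2 * R / ε := fun i => by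
    have : R ≤ 2 * R / ε := by
      rw [le_div_iff₀ hε']
      nlinarith
    exact (hv i).mono fun x hx => hx.trans this
  obtain ⟨A, hA, c, hc, hcard, happ⟩ := exists_isCellMap
    (Sum.elim v fun i => diffQuot (hK.op ε) ε (v i)) (R := 2 * R / ε) (θ := δ * ε) (by positivity)
    (by rintro (i | i); exacts [hv' i, hw i])
  obtain ⟨U, κ, hU, hU', hM⟩ := exists_spectral_decomposition (hK.isSymmStochastic hc hε).symm
  refine ⟨hK.approximation hc hε hU hU' hM, hc.isRitz hU' hM, fun i => ?_, ?_, fun i => ?_⟩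
  · change (ε : ℝ)⁻¹ * (κ i - 1) = (κ i - 1) / ε
    ring
  · have h1 : 2 * (2 * R / ε) / (δ * ε) = 4 * R / (δ * (ε : ℝ) ^ 2) := by
      field_simp
      ring
    rw [h1, Fintype.card_sum] at hcard
    exact hcard
  · have h2 : ∀ j, IsApprox (ritzVec ν c U) (δ * ε)
        (Sum.elim v (fun i => diffQuot (hK.op ε) ε (v i)) j) := by
      intro j
      obtain ⟨φ, hφ⟩ := happ j
      exact isApprox_ritzVec hU (hc.isApprox (by positivity) hφ)
    exact ⟨h2 (Sum.inl i), h2 (Sum.inr i)⟩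

/-- Approximation of the semigroup at finitely many bounded vectors. The constants are chosen in
the order: time step `τ` of the comparison, mesh `δ ε` of the cells, and last the time scale
`ε = τ / (2 n)` of the chain. The number of vectors to be discretized does not depend on `n`, so
that the number of cells is bounded by a polynomial in `n`. -/
lemma exists_approximation_bounded {ι : Type*} [Countable ι] (b : HilbertBasis ι ℝ (Lp ℝ 2 ν))
    {F : Type} [Fintype F] (f : F → Lp ℝ 2 ν) {R₀ B : ℝ} (hf : ∀ i, ∀ᵐ x ∂ν, |f i x| ≤ R₀)
    (hB : ∀ i, ‖f i‖ ≤ B) (R : Finset ℚ) (hR : ∀ t ∈ R, 0 < t) {η : ℝ} (hη : 0 < η) :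
    ∃ 𝒜 : Approximation ν, (∀ i, ∀ s ∈ R, ∀ t ∈ R,
      |𝒜.form t (hK.op s (f i)) - ⟪hK.op s (f i), hK.op t (hK.op s (f i))⟫| ≤ η) ∧
      ∀ t ∈ R, ∀ t' ∈ R, t' < t → 𝒜.tr t ≤ trace ν d t' + η := by
  have hT := hK.isSymmSemigroup
  -- a common denominator of the times
  set N : ℕ := ∏ r ∈ R, r.den with hN
  have hN0 : 0 < N := Finset.prod_pos fun r _ => r.den_pos
  have hm : ∀ t ∈ R, ∃ m : ℕ, 0 < m ∧ t * N = m := by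
    intro t ht
    obtain ⟨k, hk⟩ := Finset.dvd_prod_of_mem (fun r : ℚ => r.den) ht
    have hk0 : 0 < k := Nat.pos_of_ne_zero fun h => by
      rw [h, mul_zero] at hk
      exact hN0.ne' hk
    have hnum : 0 < t.num := Rat.num_pos.2 (hR t ht)
    refine ⟨t.num.toNat * k, Nat.mul_pos (by omega) hk0, ?_⟩
    have h1 : (N : ℚ) = t.den * k := by
      rw [hN]
      exact_mod_cast hk
    have h2 : ((t.num.toNat : ℕ) : ℚ) = t.num := by
      have : ((t.num.toNat : ℕ) : ℤ) = t.num := Int.toNat_of_nonneg hnum.le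
      exact_mod_cast this
    rw [h1, ← mul_assoc, Rat.mul_den_eq_num, Nat.cast_mul, h2]
  choose! m hm0 hm using hm
  set B' : ℝ := |B| + 1 with hB'
  have hB'0 : 0 < B' := by positivity
  have hfB : ∀ i, ‖f i‖ ≤ B' := fun i => (hB i).trans (by linarith [le_abs_self B])
  set Tm : ℝ := ∑ t ∈ R, (t : ℝ) with hTm
  have hR' : ∀ t ∈ R, (0 : ℝ) < t := fun t ht => by exact_mod_cast hR t ht
  have hTm0 : 0 ≤ Tm := Finset.sum_nonneg fun t ht => (hR' t ht).le
  have hTle : ∀ t ∈ R, (t : ℝ) ≤ Tm := fun t ht =>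
    Finset.single_le_sum (f := fun t : ℚ => (t : ℝ)) (fun t ht => (hR' t ht).le) ht
  set Cm : ℝ := ∑ s ∈ R, B' / ((s : ℝ) / 2) ^ 2 with hCm
  have hCm0 : 0 ≤ Cm := Finset.sum_nonneg fun t ht => by positivity
  have hCle : ∀ s ∈ R, B' / ((s : ℝ) / 2) ^ 2 ≤ Cm := fun s hs =>
    Finset.single_le_sum (f := fun s : ℚ => B' / ((s : ℝ) / 2) ^ 2) (fun t ht => by positivity) hs
  obtain ⟨J₀, hJ₀⟩ := exists_nat_gt (4 * B' * Tm * Cm / η)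
  have hJ₀0 : 0 < J₀ := by
    have : (0 : ℝ) < J₀ := lt_of_le_of_lt (by positivity) hJ₀
    exact_mod_cast this
  set τ : ℚ := 1 / (N * J₀) with hτ
  have hτ0 : 0 < τ := by positivity
  have hτ1 : (τ : ℝ) ≤ 1 / J₀ := by
    rw [hτ]
    push_cast
    have : (1 : ℝ) ≤ N := by exact_mod_cast hN0
    have : (0 : ℝ) < J₀ := by exact_mod_cast hJ₀0
    gcongr
    nlinarith
  have hτ2 : (τ : ℝ) ≤ 1 := hτ1.trans (by
    have : (1 : ℝ) ≤ J₀ := by exact_mod_cast hJ₀0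
    rw [div_le_one (by positivity)]
    exact this)
  have hτ0' : (0 : ℝ) < τ := by exact_mod_cast hτ0
  have hτt : ∀ t ∈ R, t = (m t * J₀ : ℕ) * τ := by
    intro t ht
    have h1 : (N : ℚ) ≠ 0 := by exact_mod_cast hN0.ne'
    have h2 : (J₀ : ℚ) ≠ 0 := by exact_mod_cast hJ₀0.ne'
    rw [hτ]
    push_cast
    rw [← hm t ht]
    field_simp
  set δ : ℝ := η / (4 * B' * (2 * Tm + 1)) / 2 with hδ
  have hδ0 : 0 < δ := by positivity
  -- the bound for the number of cells, and the time scale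
  let Jm : ℕ := ∑ t ∈ R, m t * J₀
  have hJle : ∀ t ∈ R, m t * J₀ ≤ Jm := fun t ht =>
    Finset.single_le_sum (f := fun t => m t * J₀) (fun _ _ => Nat.zero_le _) ht
  let I := F × R × Fin Jm
  set D : ℕ := Fintype.card I + Fintype.card I with hD
  set a : ℝ := 16 * |R₀| / (δ * τ ^ 2) with ha
  obtain ⟨n, hn1, hn⟩ : ∃ n : ℕ, 1 ≤ n ∧ ∀ t ∈ R, ∀ t' ∈ R, t' < t →
      (((⌊a * n ^ 2⌋₊ + 1) ^ D : ℕ) : ℝ) * Real.exp (-((t - t') * 2 / τ * n)) ≤ η := by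
    have h1 : ∀ᶠ n : ℕ in atTop, ∀ t ∈ R, ∀ t' ∈ R, t' < t →
        (((⌊a * n ^ 2⌋₊ + 1) ^ D : ℕ) : ℝ) * Real.exp (-((t - t') * 2 / τ * n)) ≤ η := by
      refine (Finset.eventually_all R).2 fun t _ => (Finset.eventually_all R).2 fun t' _ => ?_
      by_cases htt : t' < t
      · have h2 : (0 : ℝ) < (t - t') * 2 / τ := by
          have : (t' : ℝ) < t := by exact_mod_cast htt
          have : (0 : ℝ) < t - t' := sub_pos.2 this
          positivity
        filter_upwards [(tendsto_floor_pow_mul_exp a D h2).eventually_le_const hη] with n hn _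
        exact hn
      · exact Eventually.of_forall fun n h => absurd h htt
    obtain ⟨n, h2, h3⟩ := (h1.and (eventually_ge_atTop 1)).exists
    exact ⟨n, h3, h2⟩
  set ε : ℚ := τ / (2 * n) with hε
  have hn0 : (0 : ℚ) < n := by exact_mod_cast hn1
  have hε0 : 0 < ε := by positivity
  have hnε : ((2 * n : ℕ) : ℚ) * ε = τ := by
    rw [hε]
    push_cast
    field_simp
  have hε0' : (0 : ℝ) < ε := by exact_mod_cast hε0
  have hnε' : ((2 * n : ℕ) : ℝ) * ε = τ := by exact_mod_cast hnε
  have hετ : (ε : ℝ) ≤ τ := by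
    rw [← hnε']
    have : (1 : ℝ) ≤ ((2 * n : ℕ) : ℝ) := by exact_mod_cast (by omega : 1 ≤ 2 * n)
    nlinarith
  have hε1 : ε ≤ 1 := by exact_mod_cast hετ.trans hτ2
  have hks : ∀ s ∈ R, ((m s * J₀ * n + m s * J₀ * n : ℕ) : ℚ) * ε = s := by
    intro s hs
    conv_rhs => rw [hτt s hs, ← hnε]
    push_cast
    ring
  have hks0 : ∀ s ∈ R, 0 < m s * J₀ * n := fun s hs =>
    Nat.mul_pos (Nat.mul_pos (hm0 s hs) hJ₀0) hn1
  have hks' : ∀ s ∈ R, ((m s * J₀ * n : ℕ) : ℝ) * ε = (s : ℝ) / 2 := by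
    intro s hs
    have h1 : ((m s * J₀ * n : ℕ) : ℚ) * ε = s / 2 := by
      conv_rhs => rw [← hks s hs]
      push_cast
      ring
    have h2 : (((m s * J₀ * n : ℕ) : ℚ) * ε : ℚ) = ((s / 2 : ℚ) : ℝ) := by rw [h1]
    push_cast at h2
    push_cast
    exact h2
  -- `T k` as a power of `T ε`
  have hpow : ∀ (k : ℕ) (q : ℚ) (u : Lp ℝ 2 ν), 0 < k → k * ε = q →
      (hK.op ε ^ k) u = hK.op q u := by
    intro k q u hk hkq
    obtain ⟨l, rfl⟩ : ∃ l, k = l + 1 := ⟨k - 1, by omega⟩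
    rw [hT.pow_apply hε0, hkq]
  -- the vectors at the times `s + j τ`, to which the cells are adapted
  let v : I → Lp ℝ 2 ν := fun x =>
    (hK.op ε ^ (2 * n * x.2.2)) ((hK.op ε ^ (m x.2.1 * J₀ * n + m x.2.1 * J₀ * n)) (f x.1))
  have hv : ∀ x, ∀ᵐ y ∂ν, |v x y| ≤ |R₀| := fun x =>
    hK.op_pow_abs_le hε0 (hK.op_pow_abs_le hε0
      ((hf x.1).mono fun y hy => hy.trans (le_abs_self _)) _) _
  obtain ⟨𝒜, hRitz, hrate, hcard, happ⟩ :=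
    hK.exists_approximation_of_bounded v hε0 hε1 hδ0 (abs_nonneg _) hv
  refine ⟨𝒜, fun i s hs t ht => ?_, fun t ht t' ht' htt => ?_⟩
  · have hJ : 0 < m t * J₀ := Nat.mul_pos (hm0 t ht) hJ₀0
    have key := hT.abs_sum_exp_sub_le hε0 hRitz (f i) (δ := δ) (n := 2 * n) (hks0 s hs) hJ
      (fun j hj => (happ (i, ⟨s, hs⟩, ⟨j, hj.trans_le (hJle t ht)⟩)).1)
      (fun j hj => (happ (i, ⟨s, hs⟩, ⟨j, hj.trans_le (hJle t ht)⟩)).2)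
    have hts : ((m t * J₀ : ℕ) : ℝ) * ((2 * n : ℕ) * ε) = t := by
      rw [hnε']
      have := hτt t ht
      exact_mod_cast this.symm
    have hpt : (hK.op ε ^ (2 * n * (m t * J₀))) (hK.op s (f i)) = hK.op t (hK.op s (f i)) := by
      refine hpow _ _ _ (Nat.mul_pos (by omega) hJ) ?_
      conv_rhs => rw [hτt t ht, ← hnε]
      push_cast
      ring
    rw [hpow _ _ _ (by have := hks0 s hs; omega) (hks s hs), hpt, hts, hks' s hs] at key
    have hform : 𝒜.form t (hK.op s (f i))
        = ∑ j, Real.exp (t * ritzRate 𝒜.κ ε j) * ⟪𝒜.vec j, hK.op s (f i)⟫ ^ 2 := by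
      simp only [Approximation.form, hrate]
    rw [hform]
    refine key.trans ?_
    have h1 : ((m t * J₀ : ℕ) : ℝ) * τ = t := by rw [← hnε', hts]
    have h2 : ‖f i‖ / ((s : ℝ) / 2) ^ 2 ≤ Cm := by
      refine le_trans ?_ (hCle s hs)
      have := hfB i
      gcongr
    rw [hnε']
    have h3 : ((m t * J₀ : ℕ) : ℝ)
          * (τ * (2 * δ) + τ ^ 2 * (2 * δ + 2 * (‖f i‖ / ((s : ℝ) / 2) ^ 2)))
        = t * (2 * δ + τ * (2 * δ + 2 * (‖f i‖ / ((s : ℝ) / 2) ^ 2))) := by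
      rw [← h1]
      ring
    rw [h3]
    have h4 : t * (2 * δ + τ * (2 * δ + 2 * (‖f i‖ / ((s : ℝ) / 2) ^ 2)))
        ≤ Tm * (2 * δ + (2 * δ + 1 / J₀ * (2 * Cm))) := by
      have h5 : τ * (2 * δ + 2 * (‖f i‖ / ((s : ℝ) / 2) ^ 2)) ≤ 2 * δ + 1 / J₀ * (2 * Cm) := by
        rw [mul_add]
        refine add_le_add (mul_le_of_le_one_left (by positivity) hτ2) ?_
        gcongr
      have := hTle t ht
      have := hR' t ht
      gcongr
    calc ‖f i‖ * (t * (2 * δ + τ * (2 * δ + 2 * (‖f i‖ / ((s : ℝ) / 2) ^ 2))) + 2 * (δ * ε))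
        ≤ B' * (Tm * (2 * δ + (2 * δ + 1 / J₀ * (2 * Cm))) + 2 * (δ * 1)) := by
          have := hfB i
          have : (ε : ℝ) ≤ 1 := by exact_mod_cast hε1
          have := hR' t ht
          gcongr
      _ = 2 * B' * (2 * Tm + 1) * δ + 2 * B' * Tm * Cm / J₀ := by ring
      _ ≤ η / 4 + η / 2 := by
          have hJ' : (0 : ℝ) < J₀ := by exact_mod_cast hJ₀0
          have h6 : 2 * B' * (2 * Tm + 1) * δ = η / 4 := by
            rw [hδ]
            field_simp
          have h7 : 2 * B' * Tm * Cm / J₀ ≤ η / 2 := by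
            rw [div_lt_iff₀ hη] at hJ₀
            rw [div_le_iff₀ hJ']
            linarith
          linarith
      _ ≤ η := by linarith
  · set k := 2 * n * (m t' * J₀) with hk
    have hk0 : 0 < k := Nat.mul_pos (by omega) (Nat.mul_pos (hm0 t' ht') hJ₀0)
    have hkε : (k : ℚ) * ε = t' := by
      conv_rhs => rw [hτt t' ht', ← hnε]
      rw [hk]
      push_cast
      ring
    have ht0 := hR' t ht
    have hg := hK.hasSum_op b (half_pos (hR t' ht'))
    rw [add_halves] at hg
    have hδ' : (1 : ℝ) - t' / t < 1 := by
      have := div_pos (hR' t' ht') ht0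
      linarith
    have key := hT.sum_exp_le hε0 hRitz b hk0 (by rw [hkε]; exact hg) hδ' ht0.le (by
      have h1 : (k : ℝ) * ε = t' := by exact_mod_cast hkε
      rw [h1]
      field_simp
      linarith)
    have h2 : 𝒜.tr t = ∑ j, Real.exp (t * ritzRate 𝒜.κ ε j) := by
      simp only [Approximation.tr, hrate]
    rw [h2]
    have h3 : (1 - (t' : ℝ) / t) * (t / ε) = (t - t') * 2 / τ * n := by
      rw [← hnε']
      push_cast
      field_simp
    have h4 : 4 * |R₀| / (δ * (ε : ℝ) ^ 2) = a * n ^ 2 := by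
      rw [ha, ← hnε']
      push_cast
      have : (n : ℝ) ≠ 0 := by exact_mod_cast hn0.ne'
      field_simp
      ring
    rw [h4] at hcard
    rw [h3] at key
    have h5 := hn t ht t' ht' htt
    have h6 : (Fintype.card 𝒜.State : ℝ) * Real.exp (-((t - t') * 2 / τ * n))
        ≤ (((⌊a * n ^ 2⌋₊ + 1) ^ D : ℕ) : ℝ) * Real.exp (-((t - t') * 2 / τ * n)) := by
      gcongr
    linarith

end IsKernelSemigroup

end existence

/-! ### The densities of the approximating chains as kernels -/

section kernels

local notation "⟪" x ", " y "⟫" => inner ℝ x y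

variable {S : Type*} [MeasurableSpace S] {ν : Measure S} [IsProbabilityMeasure ν]
  {p : PosReal → S → S → ℝ} {d : PosReal → S → ℝ}

lemma sq_integral_abs_le {f : S → ℝ} (hf : MemLp f 2 ν) :
    (∫ x, |f x| ∂ν) ^ 2 ≤ ∫ x, f x ^ 2 ∂ν := by
  have h := sq_integral_mul_le (memLp_const (1 : ℝ)) hf.abs (ν := ν)
  simpa using h

/-- Continuity of `k ↦ ∫ k(x, y) ^ 2 dy` as a map from `L²` to `L¹`. -/
lemma sq_integral_abs_integral_sq_sub_le {k k' : S → S → ℝ}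
    (hk : MemLp (Function.uncurry k) 2 (ν.prod ν))
    (hk' : MemLp (Function.uncurry k') 2 (ν.prod ν)) :
    Integrable (fun x => ∫ y, k x y ^ 2 ∂ν - ∫ y, k' x y ^ 2 ∂ν) ν ∧
    (∫ x, |∫ y, k x y ^ 2 ∂ν - ∫ y, k' x y ^ 2 ∂ν| ∂ν) ^ 2
      ≤ (∫ z, (k z.1 z.2 - k' z.1 z.2) ^ 2 ∂(ν.prod ν))
        * (2 * ∫ z, k z.1 z.2 ^ 2 ∂(ν.prod ν) + 2 * ∫ z, k' z.1 z.2 ^ 2 ∂(ν.prod ν)) := by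
  have i1 := integrable_sq_kernel hk
  have i2 := integrable_sq_kernel hk'
  have hi : Integrable (fun x => ∫ y, k x y ^ 2 ∂ν - ∫ y, k' x y ^ 2 ∂ν) ν :=
    i1.integral_prod_left.sub i2.integral_prod_left
  refine ⟨hi, ?_⟩
  have hsub : MemLp (fun z : S × S => k z.1 z.2 - k' z.1 z.2) 2 (ν.prod ν) := hk.sub hk'
  have hadd : MemLp (fun z : S × S => k z.1 z.2 + k' z.1 z.2) 2 (ν.prod ν) := hk.add hk'
  have i3 : Integrable (fun z : S × S => |k z.1 z.2 - k' z.1 z.2| * |k z.1 z.2 + k' z.1 z.2|)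
      (ν.prod ν) := hsub.abs.integrable_mul hadd.abs
  have h1 : ∫ x, |∫ y, k x y ^ 2 ∂ν - ∫ y, k' x y ^ 2 ∂ν| ∂ν
      ≤ ∫ z, |k z.1 z.2 - k' z.1 z.2| * |k z.1 z.2 + k' z.1 z.2| ∂(ν.prod ν) := by
    rw [integral_prod _ i3]
    refine integral_mono_ae hi.abs i3.integral_prod_left ?_
    filter_upwards [i1.prod_right_ae, i2.prod_right_ae, i3.prod_right_ae] with x h1 h2 h3
    rw [← integral_sub h1 h2]
    refine (abs_integral_le_integral_abs).trans (le_of_eq (integral_congr_ae ?_))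
    refine Eventually.of_forall fun y => ?_
    simp only
    rw [← abs_mul]
    congr 1
    ring
  have h0 : 0 ≤ ∫ x, |∫ y, k x y ^ 2 ∂ν - ∫ y, k' x y ^ 2 ∂ν| ∂ν :=
    integral_nonneg fun x => abs_nonneg _
  have h2 : (∫ z, |k z.1 z.2 - k' z.1 z.2| * |k z.1 z.2 + k' z.1 z.2| ∂(ν.prod ν)) ^ 2
      ≤ (∫ z, (k z.1 z.2 - k' z.1 z.2) ^ 2 ∂(ν.prod ν))
        * ∫ z, (k z.1 z.2 + k' z.1 z.2) ^ 2 ∂(ν.prod ν) := by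
    have h := sq_integral_mul_le hsub.abs hadd.abs
    simpa only [Pi.abs_apply, sq_abs] using h
  refine (pow_le_pow_left₀ h0 h1 2).trans (h2.trans ?_)
  refine mul_le_mul_of_nonneg_left ?_ (integral_nonneg fun z => sq_nonneg _)
  have i12 : Integrable (fun z : S × S => 2 * k z.1 z.2 ^ 2 + 2 * k' z.1 z.2 ^ 2) (ν.prod ν) :=
    (i1.const_mul 2).add (i2.const_mul 2)
  rw [← integral_const_mul, ← integral_const_mul, ← integral_add (i1.const_mul 2) (i2.const_mul 2)]
  refine integral_mono hadd.integrable_sq i12 fun z => ?_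
  nlinarith [sq_nonneg (k z.1 z.2 - k' z.1 z.2)]

namespace Approximation

variable (𝒜 : Approximation ν)

lemma measurable_comp_cell (φ : 𝒜.State → ℝ) : Measurable fun x => φ (𝒜.cell x) := by
  let _ : MeasurableSpace 𝒜.State := ⊤
  have hcm : Measurable 𝒜.cell := measurable_to_countable' 𝒜.isCellMap.measurableSet
  exact (measurable_of_finite φ).comp hcm

/-- The eigenvectors of the generator, as functions which are constant on cells. -/
def vecFun (i : 𝒜.State) (x : S) : ℝ :=
  (√(cellWeight ν 𝒜.cell (𝒜.cell x)))⁻¹ * 𝒜.U (𝒜.cell x) i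

lemma vec_coeFn (i : 𝒜.State) : 𝒜.vec i =ᵐ[ν] 𝒜.vecFun i := 𝒜.isCellMap.ritzVec_coeFn i

lemma measurable_vecFun (i : 𝒜.State) : Measurable (𝒜.vecFun i) :=
  𝒜.measurable_comp_cell fun a => (√(cellWeight ν 𝒜.cell a))⁻¹ * 𝒜.U a i

lemma memLp_vecFun (i : 𝒜.State) : MemLp (𝒜.vecFun i) 2 ν :=
  (memLp_congr_ae (𝒜.vec_coeFn i)).1 (Lp.memLp _)

lemma integral_vecFun_mul (i j : 𝒜.State) :
    ∫ x, 𝒜.vecFun i x * 𝒜.vecFun j x ∂ν = if i = j then 1 else 0 := by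
  rw [← orthonormal_iff_ite.1 𝒜.orthonormal, inner_eq_integral_mul]
  refine integral_congr_ae ?_
  filter_upwards [𝒜.vec_coeFn i, 𝒜.vec_coeFn j] with x h1 h2
  rw [h1, h2]

lemma integrable_vecFun_mul (i j : 𝒜.State) :
    Integrable (fun x => 𝒜.vecFun i x * 𝒜.vecFun j x) ν :=
  (𝒜.memLp_vecFun i).integrable_mul (𝒜.memLp_vecFun j)

/-- The densities of the transition probabilities of the chain, as kernels on `S`. -/
def ker (t : ℝ) (x y : S) : ℝ := ∑ i, Real.exp (t * 𝒜.rate i) * (𝒜.vecFun i x * 𝒜.vecFun i y)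

lemma measurable_ker (t : ℝ) : Measurable (Function.uncurry (𝒜.ker t)) := by
  refine Finset.measurable_fun_sum _ fun i _ => Measurable.const_mul ?_ _
  exact ((𝒜.measurable_vecFun i).comp measurable_fst).mul
    ((𝒜.measurable_vecFun i).comp measurable_snd)

lemma memLp_ker (t : ℝ) : MemLp (Function.uncurry (𝒜.ker t)) 2 (ν.prod ν) :=
  memLp_finsetSum (f := fun i (z : S × S) =>
    Real.exp (t * 𝒜.rate i) * (𝒜.vecFun i z.1 * 𝒜.vecFun i z.2)) _ fun i _ =>
    (memLp_prod_mul (𝒜.memLp_vecFun i) (𝒜.memLp_vecFun i)).const_mul _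

lemma integral_ker_mul_ker (s t : ℝ) (x y : S) :
    ∫ w, 𝒜.ker s x w * 𝒜.ker t y w ∂ν = 𝒜.ker (s + t) x y := by
  have h1 : ∀ w, 𝒜.ker s x w * 𝒜.ker t y w = ∑ i, ∑ j, (Real.exp (s * 𝒜.rate i) * 𝒜.vecFun i x *
      (Real.exp (t * 𝒜.rate j) * 𝒜.vecFun j y)) * (𝒜.vecFun i w * 𝒜.vecFun j w) := by
    intro w
    rw [ker, ker, Finset.sum_mul_sum]
    refine Finset.sum_congr rfl fun i _ => Finset.sum_congr rfl fun j _ => ?_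
    ring
  simp only [h1]
  rw [integral_finsetSum _ fun i _ => integrable_finsetSum _ fun j _ =>
    (𝒜.integrable_vecFun_mul i j).const_mul _]
  rw [ker]
  refine Finset.sum_congr rfl fun i _ => ?_
  rw [integral_finsetSum _ fun j _ => (𝒜.integrable_vecFun_mul i j).const_mul _]
  simp only [integral_const_mul, integral_vecFun_mul, mul_ite, mul_one, mul_zero]
  rw [Finset.sum_ite_eq Finset.univ i, if_pos (Finset.mem_univ _), add_mul, Real.exp_add]
  ring

lemma integral_ker_sq (t : ℝ) (x : S) : ∫ y, 𝒜.ker t x y ^ 2 ∂ν = 𝒜.ker (t + t) x x := by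
  simp only [sq]
  exact 𝒜.integral_ker_mul_ker t t x x

lemma integrable_ker_diag (t : ℝ) : Integrable (fun x => 𝒜.ker t x x) ν :=
  integrable_finsetSum _ fun i _ => (𝒜.integrable_vecFun_mul i i).const_mul _

lemma integral_ker_diag (t : ℝ) : ∫ x, 𝒜.ker t x x ∂ν = 𝒜.tr t := by
  simp only [ker]
  rw [integral_finsetSum _ fun i _ => (𝒜.integrable_vecFun_mul i i).const_mul _, tr]
  refine Finset.sum_congr rfl fun i _ => ?_
  rw [integral_const_mul, integral_vecFun_mul, if_pos rfl, mul_one]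

lemma integral_prod_ker_mul_ker (s t : ℝ) :
    ∫ z, 𝒜.ker s z.1 z.2 * 𝒜.ker t z.1 z.2 ∂(ν.prod ν) = 𝒜.tr (s + t) := by
  have hi : Integrable (fun z : S × S => 𝒜.ker s z.1 z.2 * 𝒜.ker t z.1 z.2) (ν.prod ν) :=
    (𝒜.memLp_ker s).integrable_mul (𝒜.memLp_ker t)
  rw [integral_prod _ hi]
  simp only [integral_ker_mul_ker]
  exact 𝒜.integral_ker_diag _

lemma tr_anti {s t : ℝ} (hst : s ≤ t) : 𝒜.tr t ≤ 𝒜.tr s := by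
  refine Finset.sum_le_sum fun i _ => Real.exp_le_exp.2 ?_
  exact mul_le_mul_of_nonpos_right hst (𝒜.rate_nonpos i)

lemma continuous_tr : Continuous 𝒜.tr := by
  unfold tr
  fun_prop

lemma integral_ker_sub_sq_le {s t : ℝ} (hst : s ≤ t) :
    ∫ z, (𝒜.ker s z.1 z.2 - 𝒜.ker t z.1 z.2) ^ 2 ∂(ν.prod ν)
      ≤ 𝒜.tr (s + s) - 𝒜.tr (t + t) := by
  have i1 : Integrable (fun z : S × S => 𝒜.ker s z.1 z.2 * 𝒜.ker s z.1 z.2) (ν.prod ν) :=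
    (𝒜.memLp_ker s).integrable_mul (𝒜.memLp_ker s)
  have i2 : Integrable (fun z : S × S => 2 * (𝒜.ker s z.1 z.2 * 𝒜.ker t z.1 z.2)) (ν.prod ν) :=
    ((𝒜.memLp_ker s).integrable_mul (𝒜.memLp_ker t)).const_mul 2
  have i3 : Integrable (fun z : S × S => 𝒜.ker t z.1 z.2 * 𝒜.ker t z.1 z.2) (ν.prod ν) :=
    (𝒜.memLp_ker t).integrable_mul (𝒜.memLp_ker t)
  have i12 : Integrable (fun z : S × S => 𝒜.ker s z.1 z.2 * 𝒜.ker s z.1 z.2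
      - 2 * (𝒜.ker s z.1 z.2 * 𝒜.ker t z.1 z.2)) (ν.prod ν) := i1.sub i2
  have h1 : ∀ z : S × S, (𝒜.ker s z.1 z.2 - 𝒜.ker t z.1 z.2) ^ 2
      = 𝒜.ker s z.1 z.2 * 𝒜.ker s z.1 z.2 - 2 * (𝒜.ker s z.1 z.2 * 𝒜.ker t z.1 z.2)
        + 𝒜.ker t z.1 z.2 * 𝒜.ker t z.1 z.2 := fun z => by ring
  simp only [h1]
  rw [integral_add i12 i3, integral_sub i1 i2, integral_const_mul, integral_prod_ker_mul_ker,
    integral_prod_ker_mul_ker, integral_prod_ker_mul_ker]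
  have := 𝒜.tr_anti (show s + t ≤ t + t by linarith)
  linarith

lemma integral_abs_ker_diag_sub {s t : ℝ} (hst : s ≤ t) :
    ∫ x, |𝒜.ker s x x - 𝒜.ker t x x| ∂ν = 𝒜.tr s - 𝒜.tr t := by
  rw [← integral_ker_diag, ← integral_ker_diag,
    ← integral_sub (𝒜.integrable_ker_diag s) (𝒜.integrable_ker_diag t)]
  refine integral_congr_ae (Eventually.of_forall fun x => abs_of_nonneg (sub_nonneg.2 ?_))
  refine Finset.sum_le_sum fun i _ => ?_
  refine mul_le_mul_of_nonneg_right (Real.exp_le_exp.2 ?_) (mul_self_nonneg _)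
  exact mul_le_mul_of_nonpos_right hst (𝒜.rate_nonpos i)

variable {𝒜}

/-- The trace of the semigroup of the chain composed with the given one, as an inner product of
kernels. -/
lemma hasSum_form (hK : IsKernelSemigroup ν p d ratTimes) {ι : Type*}
    (b : HilbertBasis ι ℝ (Lp ℝ 2 ν)) (s : ℝ) {t : ℚ} (ht : 0 < t) :
    HasSum (fun m => 𝒜.form s (hK.op (t / 2) (b m)))
      (∫ z, 𝒜.ker s z.1 z.2 * p (ratTime t) z.1 z.2 ∂(ν.prod ν)) := by
  have hi : ∀ i, Integrable (fun z : S × S =>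
      p (ratTime t) z.1 z.2 * (𝒜.vecFun i z.1 * 𝒜.vecFun i z.2)) (ν.prod ν) := fun i =>
    integrable_kernel_mul (hK.memLp_rat ht) (𝒜.memLp_vecFun i) (𝒜.memLp_vecFun i)
  have h1 : ∀ i, ∫ z, p (ratTime t) z.1 z.2 * (𝒜.vecFun i z.1 * 𝒜.vecFun i z.2) ∂(ν.prod ν)
      = ‖hK.op (t / 2) (𝒜.vec i)‖ ^ 2 := by
    intro i
    rw [← hK.isSymmSemigroup.inner_self ht, hK.inner_op ht]
    have h1 := (Measure.quasiMeasurePreserving_fst (μ := ν) (ν := ν)).ae (𝒜.vec_coeFn i)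
    have h2 := (Measure.quasiMeasurePreserving_snd (μ := ν) (ν := ν)).ae (𝒜.vec_coeFn i)
    refine integral_congr_ae ?_
    filter_upwards [h1, h2] with z h1 h2
    rw [h1, h2]
  have h2 : ∫ z, 𝒜.ker s z.1 z.2 * p (ratTime t) z.1 z.2 ∂(ν.prod ν)
      = ∑ i, Real.exp (s * 𝒜.rate i) * ‖hK.op (t / 2) (𝒜.vec i)‖ ^ 2 := by
    have h3 : ∀ z : S × S, 𝒜.ker s z.1 z.2 * p (ratTime t) z.1 z.2
        = ∑ i, Real.exp (s * 𝒜.rate i)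
          * (p (ratTime t) z.1 z.2 * (𝒜.vecFun i z.1 * 𝒜.vecFun i z.2)) := by
      intro z
      rw [ker, Finset.sum_mul]
      refine Finset.sum_congr rfl fun i _ => ?_
      ring
    simp only [h3]
    rw [integral_finsetSum _ fun i _ => (hi i).const_mul _]
    simp only [integral_const_mul, h1]
  rw [h2]
  refine hasSum_sum fun i _ => HasSum.mul_left _ ?_
  have h4 := b.hasSum_inner_mul_inner (hK.op (t / 2) (𝒜.vec i)) (hK.op (t / 2) (𝒜.vec i))
  rw [real_inner_self_eq_norm_sq] at h4
  refine h4.congr_fun fun m => ?_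
  rw [hK.symm_op (half_pos ht), sq, real_inner_comm (hK.op (t / 2) (𝒜.vec i)) (b m)]

lemma integral_ker_sub_sq (hK : IsKernelSemigroup ν p d ratTimes) {t : ℚ} (ht : 0 < t) :
    ∫ z, (𝒜.ker t z.1 z.2 - p (ratTime t) z.1 z.2) ^ 2 ∂(ν.prod ν)
      = 𝒜.tr (t + t) - 2 * ∫ z, 𝒜.ker t z.1 z.2 * p (ratTime t) z.1 z.2 ∂(ν.prod ν)
        + trace ν d (t + t) := by
  have hp := hK.memLp_rat ht
  have i1 : Integrable (fun z : S × S => 𝒜.ker t z.1 z.2 * 𝒜.ker t z.1 z.2) (ν.prod ν) :=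
    (𝒜.memLp_ker t).integrable_mul (𝒜.memLp_ker t)
  have i2 : Integrable (fun z : S × S => 2 * (𝒜.ker t z.1 z.2 * p (ratTime t) z.1 z.2))
      (ν.prod ν) := ((𝒜.memLp_ker t).integrable_mul hp).const_mul 2
  have i3 : Integrable (fun z : S × S => p (ratTime t) z.1 z.2 * p (ratTime t) z.1 z.2)
      (ν.prod ν) := hp.integrable_mul hp
  have i12 : Integrable (fun z : S × S => 𝒜.ker t z.1 z.2 * 𝒜.ker t z.1 z.2
      - 2 * (𝒜.ker t z.1 z.2 * p (ratTime t) z.1 z.2)) (ν.prod ν) := i1.sub i2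
  have h1 : ∀ z : S × S, (𝒜.ker t z.1 z.2 - p (ratTime t) z.1 z.2) ^ 2
      = 𝒜.ker t z.1 z.2 * 𝒜.ker t z.1 z.2 - 2 * (𝒜.ker t z.1 z.2 * p (ratTime t) z.1 z.2)
        + p (ratTime t) z.1 z.2 * p (ratTime t) z.1 z.2 := fun z => by ring
  have h2 := add_mem_ratTimes _ (ratTime_mem ht) _ (ratTime_mem ht)
  simp only [h1]
  rw [integral_add i12 i3, integral_sub i1 i2, integral_const_mul, integral_prod_ker_mul_ker,
    hK.integral_mul (ratTime_mem ht) (ratTime_mem ht) h2 h2, trace, ratTime_add ht ht]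

end Approximation

end kernels

/-! ### Convergence of a sequence of approximations at rational times -/

section sequence

local notation "⟪" x ", " y "⟫" => inner ℝ x y

variable {S : Type*} [MeasurableSpace S] {ν : Measure S} [IsProbabilityMeasure ν]
  {p : PosReal → S → S → ℝ} {d : PosReal → S → ℝ}

namespace IsKernelSemigroup

variable (hK : IsKernelSemigroup ν p d ratTimes)

include hK

/-- Approximation of the semigroup at finitely many vectors, which by density may be assumed
bounded. -/
lemma exists_approximation {ι : Type*} [Countable ι] (b : HilbertBasis ι ℝ (Lp ℝ 2 ν))
    {F : Type} [Fintype F] (f : F → Lp ℝ 2 ν) (R : Finset ℚ) (hR : ∀ t ∈ R, 0 < t) {η : ℝ}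
    (hη : 0 < η) :
    ∃ 𝒜 : Approximation ν, (∀ i, ∀ s ∈ R, ∀ t ∈ R,
      |𝒜.form t (hK.op s (f i)) - ⟪hK.op s (f i), hK.op t (hK.op s (f i))⟫| ≤ η) ∧
      ∀ t ∈ R, ∀ t' ∈ R, t' < t → 𝒜.tr t ≤ trace ν d t' + η := by
  have hT := hK.isSymmSemigroup
  set B : ℝ := ∑ i, ‖f i‖ + 1 with hB
  have hB0 : 0 < B := by positivity
  have hfB : ∀ i, ‖f i‖ + 1 ≤ B := fun i => by
    have := Finset.single_le_sum (f := fun i => ‖f i‖) (fun _ _ => norm_nonneg _)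
      (Finset.mem_univ i)
    linarith
  set η₀ : ℝ := min 1 (η / (8 * B)) with hη₀
  have hη₀0 : 0 < η₀ := lt_min one_pos (by positivity)
  choose g R₀ hg hfg using fun i => exists_bounded_approx (f i) hη₀0
  have hR₀ : ∀ i, R₀ i ≤ ∑ i, |R₀ i| := fun i => (le_abs_self _).trans
    (Finset.single_le_sum (f := fun i => |R₀ i|) (fun _ _ => abs_nonneg _) (Finset.mem_univ i))
  have hgB : ∀ i, ‖g i‖ ≤ B := by
    intro i
    have h1 := norm_sub_norm_le (g i) (f i)
    rw [norm_sub_rev] at h1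
    have h2 := (hfg i).trans (min_le_left _ _)
    linarith [hfB i]
  obtain ⟨𝒜, h1, h2⟩ := hK.exists_approximation_bounded b g (R₀ := ∑ i, |R₀ i|)
    (fun i => (hg i).mono fun x hx => hx.trans (hR₀ i)) hgB R hR (half_pos hη)
  refine ⟨𝒜, fun i s hs t ht => ?_, fun t ht t' ht' htt => (h2 t ht t' ht' htt).trans (by linarith)⟩
  set u := hK.op s (f i) with hu
  set v := hK.op s (g i) with hv
  have huv : ‖u - v‖ * (‖u‖ + ‖v‖) ≤ η / 4 := by
    have e1 : ‖u - v‖ ≤ η / (8 * B) := by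
      rw [hu, hv, ← map_sub]
      exact (hT.norm_le (hR s hs) _).trans ((hfg i).trans (min_le_right _ _))
    have e2 : ‖u‖ ≤ B := (hT.norm_le (hR s hs) _).trans (by linarith [hfB i])
    have e3 : ‖v‖ ≤ B := (hT.norm_le (hR s hs) _).trans (hgB i)
    calc ‖u - v‖ * (‖u‖ + ‖v‖) ≤ η / (8 * B) * (B + B) := by gcongr
      _ = η / 4 := by field_simp; ring
  have ht0 : (0 : ℝ) ≤ t := by exact_mod_cast (hR t ht).le
  have e1 := (𝒜.abs_form_sub_le ht0 u v).trans huv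
  have e2 := (hT.abs_inner_sub_le (hR t ht) u v).trans huv
  have e3 := h1 i s hs t ht
  rw [abs_le] at *
  constructor <;> linarith [e1.1, e1.2, e2.1, e2.2, e3.1, e3.2]

/-- A sequence of approximations, such that the semigroups of the chains converge to the given
semigroup, and such that the traces do not exceed the given trace in the limit. -/
lemma exists_seq_approximation {ι : Type*} [Countable ι] (b : HilbertBasis ι ℝ (Lp ℝ 2 ν)) :
    ∃ 𝒜 : ℕ → Approximation ν,
      (∀ m, ∀ s t : ℚ, 0 < s → 0 < t → Tendsto (fun n => (𝒜 n).form t (hK.op s (b m))) atTop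
        (𝓝 ⟪hK.op s (b m), hK.op t (hK.op s (b m))⟫)) ∧
      ∀ t' t : ℚ, 0 < t' → t' < t → ∀ η > 0, ∀ᶠ n in atTop, (𝒜 n).tr t ≤ trace ν d t' + η := by
  classical
  obtain ⟨w, hw⟩ := ((Set.countable_range b).insert 0).exists_eq_range (Set.insert_nonempty _ _)
  obtain ⟨e, he⟩ := exists_surjective_nat {q : ℚ // 0 < q}
  let R : ℕ → Finset ℚ := fun n => (Finset.range n).image fun j => (e j : ℚ)
  have hR : ∀ n, ∀ t ∈ R n, 0 < t := by
    intro n t ht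
    obtain ⟨j, -, rfl⟩ := Finset.mem_image.1 ht
    exact (e j).2
  have hRt : ∀ t : ℚ, 0 < t → ∀ᶠ n in atTop, t ∈ R n := by
    intro t ht
    obtain ⟨j, hj⟩ := he ⟨t, ht⟩
    filter_upwards [eventually_gt_atTop j] with n hn
    exact Finset.mem_image.2 ⟨j, Finset.mem_range.2 hn, by rw [hj]⟩
  choose 𝒜 h1 h2 using fun n : ℕ => hK.exists_approximation b (fun i : Fin n => w i) (R n) (hR n)
    (η := 1 / (n + 1)) (by positivity)
  have hlim := tendsto_one_div_add_atTop_nhds_zero_nat (𝕜 := ℝ)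
  refine ⟨𝒜, fun m s t hs ht => ?_, fun t' t ht' htt η hη => ?_⟩
  · obtain ⟨j, hj⟩ : b m ∈ Set.range w := by
      rw [← hw]
      exact Set.mem_insert_of_mem _ (Set.mem_range_self m)
    rw [tendsto_iff_dist_tendsto_zero]
    refine squeeze_zero' (Eventually.of_forall fun n => dist_nonneg) ?_ hlim
    filter_upwards [hRt s hs, hRt t ht, eventually_gt_atTop j] with n hs ht hn
    rw [Real.dist_eq, ← hj]
    exact h1 n ⟨j, hn⟩ s hs t ht
  · filter_upwards [hRt t (ht'.trans htt), hRt t' ht', hlim.eventually_le_const hη] with n hn hn' hη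
    exact (h2 n t hn t' hn' htt).trans (by linarith)

/-- Convergence in Hilbert-Schmidt norm. The inner product of the two kernels converges, since it
is a series of quadratic forms dominated by the trace; the norms do not increase in the limit. -/
lemma tendsto_integral_ker_sub_sq {ι : Type*} [Countable ι] (b : HilbertBasis ι ℝ (Lp ℝ 2 ν))
    (hcont : ∀ t : ℚ, 0 < t → ∀ η > 0, ∃ t' : ℚ, 0 < t' ∧ t' < t ∧ trace ν d t' ≤ trace ν d t + η)
    {𝒜 : ℕ → Approximation ν}
    (hform : ∀ m, ∀ s t : ℚ, 0 < s → 0 < t → Tendsto (fun n => (𝒜 n).form t (hK.op s (b m))) atTop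
        (𝓝 ⟪hK.op s (b m), hK.op t (hK.op s (b m))⟫))
    (htr : ∀ t' t : ℚ, 0 < t' → t' < t → ∀ η > 0, ∀ᶠ n in atTop, (𝒜 n).tr t ≤ trace ν d t' + η)
    {t : ℚ} (ht : 0 < t) :
    Tendsto (fun n => ∫ z, ((𝒜 n).ker t z.1 z.2 - p (ratTime t) z.1 z.2) ^ 2 ∂(ν.prod ν)) atTop
      (𝓝 0) ∧ Tendsto (fun n => (𝒜 n).tr (t + t : ℚ)) atTop (𝓝 (trace ν d (t + t))) := by
  have ht0 : (0 : ℝ) ≤ t := by exact_mod_cast ht.le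
  set J : ℕ → ℝ := fun n => ∫ z, (𝒜 n).ker t z.1 z.2 * p (ratTime t) z.1 z.2 ∂(ν.prod ν) with hJ
  have hJlim : Tendsto J atTop (𝓝 (trace ν d (t + t))) := by
    have h1 : ∀ n, J n = ∑' m, (𝒜 n).form t (hK.op (t / 2) (b m)) := fun n =>
      ((𝒜 n).hasSum_form hK b t ht).tsum_eq.symm
    have h2 : trace ν d (t + t) = ∑' m, ⟪hK.op (t / 2) (b m), hK.op t (hK.op (t / 2) (b m))⟫ := by
      rw [← (hK.hasSum_op b ht).tsum_eq]
      refine tsum_congr fun m => ?_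
      rw [hK.isSymmSemigroup.inner_self ht, ← hK.op_add (half_pos ht) (half_pos ht), add_halves]
    have hsum := hK.hasSum_op b (half_pos ht)
    rw [h2]
    refine Tendsto.congr (fun n => (h1 n).symm) ?_
    refine tendsto_tsum_of_dominated_convergence hsum.summable
      (fun m => hform m _ _ (half_pos ht) ht) (Eventually.of_forall fun n m => ?_)
    have h3 := (𝒜 n).abs_form_sub_le ht0 (hK.op (t / 2) (b m)) 0
    have h4 : (𝒜 n).form t 0 = 0 := by simp [Approximation.form]
    rw [h4, sub_zero, sub_zero, norm_zero, add_zero, ← sq] at h3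
    exact h3
  have hid : ∀ n, ∫ z, ((𝒜 n).ker t z.1 z.2 - p (ratTime t) z.1 z.2) ^ 2 ∂(ν.prod ν)
      = (𝒜 n).tr (t + t : ℚ) - 2 * J n + trace ν d (t + t) := by
    intro n
    rw [(𝒜 n).integral_ker_sub_sq hK ht]
    push_cast
    rfl
  have hnn : ∀ n, 0 ≤ ∫ z, ((𝒜 n).ker t z.1 z.2 - p (ratTime t) z.1 z.2) ^ 2 ∂(ν.prod ν) :=
    fun n => integral_nonneg fun z => sq_nonneg _
  have hupper : ∀ η > 0, ∀ᶠ n in atTop, (𝒜 n).tr (t + t : ℚ) ≤ trace ν d (t + t) + η := by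
    intro η hη
    obtain ⟨t', ht', htt, h⟩ := hcont (t + t) (by positivity) (η / 2) (half_pos hη)
    filter_upwards [htr t' (t + t) ht' htt (η / 2) (half_pos hη)] with n hn
    linarith
  have htrlim : Tendsto (fun n => (𝒜 n).tr (t + t : ℚ)) atTop (𝓝 (trace ν d (t + t))) := by
    rw [Metric.tendsto_atTop']
    intro η hη
    have h1 := (hJlim.const_mul 2).eventually_const_lt (show 2 * trace ν d (t + t) - η / 2
      < 2 * trace ν d (t + t) by linarith)
    obtain ⟨N, hN⟩ := ((hupper (η / 2) (half_pos hη)).and h1).exists_forall_of_atTop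
    refine ⟨N, fun n hn => ?_⟩
    obtain ⟨h2, h3⟩ := hN n hn.le
    have h4 := hnn n
    rw [hid] at h4
    rw [Real.dist_eq, abs_lt]
    constructor <;> linarith
  refine ⟨?_, htrlim⟩
  simp only [hid]
  have := (htrlim.sub (hJlim.const_mul 2)).add_const (trace ν d (t + t))
  convert this using 2
  ring

/-- Convergence of the diagonal in `L¹`, at twice the time: the diagonal is the square function of
the kernel. -/
lemma tendsto_integral_abs_ker_diag_sub {𝒜 : ℕ → Approximation ν} {t : ℚ} (ht : 0 < t)
    (h1 : Tendsto (fun n => ∫ z, ((𝒜 n).ker t z.1 z.2 - p (ratTime t) z.1 z.2) ^ 2 ∂(ν.prod ν))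
      atTop (𝓝 0))
    (h2 : Tendsto (fun n => (𝒜 n).tr (t + t : ℚ)) atTop (𝓝 (trace ν d (t + t)))) :
    Tendsto (fun n => ∫ x, |(𝒜 n).ker (t + t : ℚ) x x - d (ratTime (t + t)) x| ∂ν) atTop
      (𝓝 0) := by
  have h3 : ∀ n, (∫ x, |(𝒜 n).ker (t + t : ℚ) x x - d (ratTime (t + t)) x| ∂ν) ^ 2
      ≤ (∫ z, ((𝒜 n).ker t z.1 z.2 - p (ratTime t) z.1 z.2) ^ 2 ∂(ν.prod ν))
        * (2 * (𝒜 n).tr (t + t : ℚ) + 2 * trace ν d (t + t)) := by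
    intro n
    have h := (sq_integral_abs_integral_sq_sub_le ((𝒜 n).memLp_ker t) (hK.memLp_rat ht)).2
    have hm := ratTime_mem ht
    have h2 := add_mem_ratTimes _ (ratTime_mem ht) _ (ratTime_mem ht)
    have e1 : ∫ z, (𝒜 n).ker t z.1 z.2 ^ 2 ∂(ν.prod ν) = (𝒜 n).tr (t + t : ℚ) := by
      simp only [sq]
      rw [(𝒜 n).integral_prod_ker_mul_ker]
      push_cast
      rfl
    have e2 : ∫ z, p (ratTime t) z.1 z.2 ^ 2 ∂(ν.prod ν) = trace ν d (t + t) := by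
      simp only [sq]
      rw [hK.integral_mul hm hm h2 h2, trace, ratTime_add ht ht]
    rw [e1, e2] at h
    refine le_trans (le_of_eq ?_) h
    congr 1
    refine integral_congr_ae ?_
    filter_upwards [hK.diag_symm hm hm] with x hx
    rw [(𝒜 n).integral_ker_sq, ratTime_add ht ht, hx.2]
    push_cast
    simp only [sq]
  have h4 : Tendsto (fun n => (∫ x, |(𝒜 n).ker (t + t : ℚ) x x - d (ratTime (t + t)) x| ∂ν) ^ 2)
      atTop (𝓝 0) := by
    refine squeeze_zero (fun n => sq_nonneg _) h3 ?_
    have := h1.mul ((h2.const_mul 2).add_const (2 * trace ν d (t + t)))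
    simpa using this
  have h5 := h4.sqrt
  rw [Real.sqrt_zero] at h5
  refine h5.congr fun n => Real.sqrt_sq (integral_nonneg fun x => abs_nonneg _)

end IsKernelSemigroup

end sequence

/-! ### Continuity in time of a density array -/

section arrayContinuity

variable {Ω : Type*} [MeasurableSpace Ω] {μ : Measure Ω}
  {X : ℕ → ℕ → Ω → PosReal → ℝ} {D : Set PosReal}
  {S : Type*} [MeasurableSpace S] {ν : Measure S} [IsProbabilityMeasure ν]
  {p : PosReal → S → S → ℝ} {d : PosReal → S → ℝ}

lemma Represents.map_offDiag (h : Represents ν p d D μ X)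
    (hX : ∀ i j t, Measurable fun ω => X i j ω t)
    (hp : ∀ t, Measurable (Function.uncurry (p t))) (hd : ∀ t, Measurable (d t)) :
    (ν.prod ν).map (fun z (t : D) => p t z.1 z.2) = μ.map (fun ω (t : D) => X 0 1 ω t) := by
  have hXm : Measurable fun ω (i j : Fin 2) (t : D) => X i j ω t :=
    measurable_pi_lambda _ fun _ => measurable_pi_lambda _ fun _ =>
      measurable_pi_lambda _ fun _ => hX _ _ _
  have hM := measurable_kernelMatrix (D := D) hp hd 2
  have hev : Measurable fun x : Fin 2 → Fin 2 → D → ℝ => x 0 1 :=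
    (measurable_pi_apply _).comp (measurable_pi_apply _)
  have hm : Measurable fun q : S × S => (![q.1, q.2] : Fin 2 → S) := by
    refine measurable_pi_lambda _ fun i => ?_
    fin_cases i <;> simp <;> fun_prop
  have e1 := congrArg (Measure.map fun x : Fin 2 → Fin 2 → D → ℝ => x 0 1) (h 2)
  rw [Measure.map_map hev hM, Measure.map_map hev hXm, ← pi_two_eq_map_prod,
    Measure.map_map (hev.comp hM) hm] at e1
  refine Eq.trans ?_ e1
  congr 1

/-- The times which are rational combinations of two given times. -/
def spanTimes (s t : PosReal) : Set PosReal := {u | ∃ a b : ℚ, (u : ℝ) = a * s + b * t}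

lemma countable_spanTimes (s t : PosReal) : (spanTimes s t).Countable := by
  refine ((Set.countable_range fun q : ℚ × ℚ => (q.1 * s + q.2 * t : ℝ)).preimage
    Subtype.val_injective).mono ?_
  rintro u ⟨a, b, h⟩
  exact ⟨(a, b), h.symm⟩

lemma add_mem_spanTimes (s t : PosReal) :
    ∀ u ∈ spanTimes s t, ∀ v ∈ spanTimes s t, u + v ∈ spanTimes s t := by
  rintro u ⟨a, b, h⟩ v ⟨a', b', h'⟩
  refine ⟨a + a', b + b', ?_⟩
  change (u : ℝ) + v = _
  rw [h, h']
  push_cast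
  ring

lemma half_mem_spanTimes (s t : PosReal) : ∀ u ∈ spanTimes s t, half u ∈ spanTimes s t := by
  rintro u ⟨a, b, h⟩
  refine ⟨a / 2, b / 2, ?_⟩
  change (u : ℝ) / 2 = _
  rw [h]
  push_cast
  ring

lemma left_mem_spanTimes (s t : PosReal) : s ∈ spanTimes s t := ⟨1, 0, by simp⟩

lemma right_mem_spanTimes (s t : PosReal) : t ∈ spanTimes s t := ⟨0, 1, by simp⟩

namespace IsDensityArray

variable [IsProbabilityMeasure μ]

/-- The variation in time of the diagonal is controlled by that of the entries off the diagonal, at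
half of the times. This is read off from kernels which represent the array at a countable set of
times containing the two given ones. -/
lemma memLp_and_sq_integral_abs_diag_sub_le (hX : IsDensityArray μ X) (s t : PosReal) :
    MemLp (fun ω => X 0 1 ω t) 2 μ ∧
    (∫ ω, |X 0 0 ω t - X 0 0 ω s| ∂μ) ^ 2
      ≤ (∫ ω, (X 0 1 ω (half t) - X 0 1 ω (half s)) ^ 2 ∂μ)
        * (2 * ∫ ω, X 0 0 ω t ∂μ + 2 * ∫ ω, X 0 0 ω s ∂μ) := by
  set D := spanTimes s t with hD
  have hDc : Countable D := (countable_spanTimes s t).to_subtype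
  obtain ⟨S, _, _, ν, p, d, _, hp, hd, h⟩ :=
    exists_kernel_representation (D := D) hX (half_mem_spanTimes s t)
  have hrep : Represents ν p d D μ X := h
  have hadd := add_mem_spanTimes s t
  have hK := hrep.isKernelSemigroup hX hp hd hadd
  have hs := left_mem_spanTimes s t
  have ht := right_mem_spanTimes s t
  have hs2 := half_mem_spanTimes s t s hs
  have ht2 := half_mem_spanTimes s t t ht
  have hoff := hrep.map_offDiag hX.measurable_apply hp hd
  have hdiag := hrep.map_diag hX.measurable_apply hp hd
  have hmp : Measurable fun (z : S × S) (t : D) => p t z.1 z.2 :=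
    measurable_pi_lambda _ fun t => hp t
  have hmX : Measurable fun ω (t : D) => X 0 1 ω t :=
    measurable_pi_lambda _ fun t => hX.measurable_apply _ _ _
  have hmd : Measurable fun x (t : D) => d t x := measurable_pi_lambda _ fun t => hd t
  have hmY : Measurable fun ω (t : D) => X 0 0 ω t :=
    measurable_pi_lambda _ fun t => hX.measurable_apply _ _ _
  have toff : ∀ f : (D → ℝ) → ℝ, Measurable f →
      ∫ z, f (fun t : D => p t z.1 z.2) ∂(ν.prod ν) = ∫ ω, f (fun t : D => X 0 1 ω t) ∂μ := by
    intro f hf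
    rw [← integral_map hmp.aemeasurable hf.aestronglyMeasurable, hoff,
      integral_map hmX.aemeasurable hf.aestronglyMeasurable]
  have tdiag : ∀ f : (D → ℝ) → ℝ, Measurable f →
      ∫ x, f (fun t : D => d t x) ∂ν = ∫ ω, f (fun t : D => X 0 0 ω t) ∂μ := by
    intro f hf
    rw [← integral_map hmd.aemeasurable hf.aestronglyMeasurable, hdiag,
      integral_map hmY.aemeasurable hf.aestronglyMeasurable]
  constructor
  · have hm : Measurable fun x : D → ℝ => x ⟨t, ht⟩ := measurable_pi_apply _
    have h1 : MemLp (fun x : D → ℝ => x ⟨t, ht⟩) 2 ((ν.prod ν).map fun z (t : D) => p t z.1 z.2) :=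
      (memLp_map_measure_iff hm.aestronglyMeasurable hmp.aemeasurable).2
        (hK.memLp ht (hadd t ht t ht))
    rw [hoff] at h1
    exact (memLp_map_measure_iff hm.aestronglyMeasurable hmX.aemeasurable).1 h1
  · have key := (sq_integral_abs_integral_sq_sub_le (hK.memLp ht2 (hadd _ ht2 _ ht2))
      (hK.memLp hs2 (hadd _ hs2 _ hs2))).2
    have e1 : ∀ u, (hu : u ∈ D) → (hu2 : half u ∈ D) →
        ∫ z, p (half u) z.1 z.2 ^ 2 ∂(ν.prod ν) = ∫ ω, X 0 0 ω u ∂μ := by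
      intro u hu hu2
      have h1 := hK.integral_mul hu2 hu2 (hadd _ hu2 _ hu2) (hadd _ hu2 _ hu2)
      rw [half_add_half] at h1
      simp only [sq]
      exact h1.trans (tdiag (fun x => x ⟨u, hu⟩) (measurable_pi_apply _))
    have e2 : ∀ u, u ∈ D → half u ∈ D → ∀ᵐ x ∂ν, ∫ y, p (half u) x y ^ 2 ∂ν = d u x := by
      intro u hu hu2
      filter_upwards [hK.diag_symm hu2 hu2] with x hx
      rw [half_add_half] at hx
      rw [hx.2]
      simp only [sq]
    have e3 : ∫ x, |∫ y, p (half t) x y ^ 2 ∂ν - ∫ y, p (half s) x y ^ 2 ∂ν| ∂ν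
        = ∫ ω, |X 0 0 ω t - X 0 0 ω s| ∂μ := by
      rw [← tdiag (fun x => |x ⟨t, ht⟩ - x ⟨s, hs⟩|) (by fun_prop)]
      refine integral_congr_ae ?_
      filter_upwards [e2 t ht ht2, e2 s hs hs2] with x h1 h2
      rw [h1, h2]
    have e4 := toff (fun x => (x ⟨half t, ht2⟩ - x ⟨half s, hs2⟩) ^ 2) (by fun_prop)
    rw [e1 t ht ht2, e1 s hs hs2, e3] at key
    exact key.trans (le_of_eq (congrArg (· * _) e4))

omit [IsProbabilityMeasure μ] in
lemma tendsto_integral_offDiag_sub_sq (hX : IsDensityArray μ X) (t : PosReal) :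
    Tendsto (fun s => ∫ ω, (X 0 1 ω t - X 0 1 ω s) ^ 2 ∂μ) (𝓝 t) (𝓝 0) := by
  have h1 : ∀ s, ∫ ω, (X 0 1 ω t - X 0 1 ω s) ^ 2 ∂μ
      = (∫⁻ ω, ENNReal.ofReal ((X 0 1 ω t - X 0 1 ω s) ^ 2) ∂μ).toReal := fun s =>
    integral_eq_lintegral_of_nonneg_ae (Eventually.of_forall fun ω => sq_nonneg _)
      (((hX.measurable_apply 0 1 t).sub (hX.measurable_apply 0 1 s)).pow_const
        2).aestronglyMeasurable
  simp only [h1]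
  have := (ENNReal.tendsto_toReal ENNReal.zero_ne_top).comp (hX.continuous t)
  rwa [ENNReal.toReal_zero] at this

lemma tendsto_integral_abs_offDiag_sub (hX : IsDensityArray μ X) (t : PosReal) :
    Tendsto (fun s => ∫ ω, |X 0 1 ω t - X 0 1 ω s| ∂μ) (𝓝 t) (𝓝 0) := by
  have h1 := (hX.tendsto_integral_offDiag_sub_sq t).sqrt
  rw [Real.sqrt_zero] at h1
  refine squeeze_zero (fun s => integral_nonneg fun ω => abs_nonneg _) (fun s => ?_) h1
  refine Real.le_sqrt_of_sq_le ?_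
  exact sq_integral_abs_le ((hX.memLp_and_sq_integral_abs_diag_sub_le t t).1.sub
    (hX.memLp_and_sq_integral_abs_diag_sub_le s s).1)

lemma continuous_half : Continuous half := by
  unfold half
  exact Continuous.subtype_mk (by fun_prop) _

lemma tendsto_integral_abs_diag_sub (hX : IsDensityArray μ X) (t : PosReal) :
    Tendsto (fun s => ∫ ω, |X 0 0 ω t - X 0 0 ω s| ∂μ) (𝓝 t) (𝓝 0) := by
  set g : PosReal → ℝ := fun s => ∫ ω, |X 0 0 ω t - X 0 0 ω s| ∂μ with hg
  set e : PosReal → ℝ := fun s => ∫ ω, (X 0 1 ω (half t) - X 0 1 ω (half s)) ^ 2 ∂μ with he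
  set a := ∫ ω, X 0 0 ω t ∂μ with ha
  have hg0 : ∀ s, 0 ≤ g s := fun s => integral_nonneg fun ω => abs_nonneg _
  have he0 : ∀ s, 0 ≤ e s := fun s => integral_nonneg fun ω => sq_nonneg _
  have hlim : Tendsto e (𝓝 t) (𝓝 0) :=
    (hX.tendsto_integral_offDiag_sub_sq (half t)).comp (continuous_half.tendsto t)
  have h1 : ∀ s, g s ^ 2 ≤ e s * (4 * a + 2 * g s) := by
    intro s
    have h2 := (hX.memLp_and_sq_integral_abs_diag_sub_le s t).2
    have h3 : ∫ ω, X 0 0 ω s ∂μ ≤ a + g s := by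
      have hi : Integrable (fun ω => |X 0 0 ω t - X 0 0 ω s|) μ :=
        ((hX.bounded t).sub (hX.bounded s)).abs
      have h4 : g s = ∫ ω, |X 0 0 ω t - X 0 0 ω s| ∂μ := rfl
      rw [ha, h4, ← integral_add (hX.bounded t) hi]
      refine integral_mono (hX.bounded s) ((hX.bounded t).add hi) fun ω => ?_
      have := le_abs_self (-(X 0 0 ω t - X 0 0 ω s))
      rw [abs_neg] at this
      simp only
      linarith
    exact h2.trans (mul_le_mul_of_nonneg_left (by linarith) (he0 s))
  -- solve the quadratic inequality for `g s`
  have h2 : ∀ s, g s ≤ e s + √(e s ^ 2 + 4 * a * e s) := by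
    intro s
    have h3 : g s - e s ≤ √(e s ^ 2 + 4 * a * e s) := by
      refine Real.le_sqrt_of_sq_le ?_
      nlinarith [h1 s]
    linarith
  refine squeeze_zero hg0 h2 ?_
  have h4 := hlim.add (((hlim.pow 2).add (hlim.const_mul (4 * a))).sqrt)
  simpa using h4

/-- The trace is a continuous function of time. -/
lemma continuous_integral_diag (hX : IsDensityArray μ X) :
    Continuous fun t => ∫ ω, X 0 0 ω t ∂μ := by
  rw [continuous_iff_continuousAt]
  intro t
  rw [ContinuousAt, tendsto_iff_dist_tendsto_zero]
  refine squeeze_zero (fun _ => dist_nonneg) (fun s => ?_) (hX.tendsto_integral_abs_diag_sub t)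
  rw [dist_comm, Real.dist_eq, ← integral_sub (hX.bounded t) (hX.bounded s)]
  exact abs_integral_le_integral_abs

end IsDensityArray

end arrayContinuity

/-! ### Normalization of the approximating chains -/

section normalization

variable {S : Type*} [MeasurableSpace S] {ν : Measure S} [IsProbabilityMeasure ν]
  {p : PosReal → S → S → ℝ} {d : PosReal → S → ℝ}

namespace Approximation

variable (𝒜 : Approximation ν)

/-- The approximating chain, run at speed `r`. -/
def chain (r : ℝ) (hr : 0 < r) : FiniteMarkovChain :=
  𝒜.stoch.chain (r * 𝒜.ρ) (mul_pos hr 𝒜.ρ_pos)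

/-- The stationary distribution of the chain. -/
def law (r : ℝ) (hr : 0 < r) : PMF (𝒜.chain r hr).State := 𝒜.stoch.law

/-- The state of the chain which corresponds to a point of `S`. -/
def state (r : ℝ) (hr : 0 < r) (x : S) : (𝒜.chain r hr).State := 𝒜.cell x

lemma chain_G (r : ℝ) (hr : 0 < r) (t : ℝ) : (𝒜.chain r hr).G t = 𝒜.tr (r * t) := by
  refine (𝒜.stoch.G_eq _ 𝒜.mul_transpose 𝒜.transpose_mul 𝒜.spectral t).trans ?_
  refine Finset.sum_congr rfl fun i _ => ?_
  rw [rate]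
  congr 1
  ring

lemma chain_density (r : ℝ) (hr : 0 < r) (t : ℝ) (x y : S) :
    (𝒜.chain r hr).density (𝒜.law r hr) t (𝒜.state r hr x) (𝒜.state r hr y)
      = 𝒜.ker (r * t) x y := by
  refine (𝒜.stoch.density_eq _ 𝒜.mul_transpose 𝒜.transpose_mul 𝒜.spectral t _ _).trans ?_
  refine Finset.sum_congr rfl fun i _ => ?_
  rw [rate]
  congr 2
  ring

lemma measurable_state (r : ℝ) (hr : 0 < r) : Measurable (𝒜.state r hr) := by
  have : Countable (𝒜.chain r hr).State := Finite.to_countable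
  exact measurable_to_countable' 𝒜.isCellMap.measurableSet

lemma map_state (r : ℝ) (hr : 0 < r) : ν.map (𝒜.state r hr) = (𝒜.law r hr).toMeasure := by
  have : Countable (𝒜.chain r hr).State := Finite.to_countable
  refine Measure.ext_of_singleton fun a => ?_
  rw [Measure.map_apply (𝒜.measurable_state r hr) (measurableSet_singleton a),
    PMF.toMeasure_apply_singleton _ _ (measurableSet_singleton a)]
  have h1 : ENNReal.ofReal (cellWeight ν 𝒜.cell a) = ν (𝒜.cell ⁻¹' {a}) :=
    ofReal_measureReal (measure_ne_top _ _)
  exact h1.symm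

end Approximation

/-- The speed of the chains can be chosen so that they are normalized; it tends to `1`, since the
trace is strictly decreasing at time `1`. -/
lemma exists_speed (hK : IsKernelSemigroup ν p d ratTimes) {ι : Type*} [Countable ι]
    (b : HilbertBasis ι ℝ (Lp ℝ 2 ν)) {𝒜 : ℕ → Approximation ν}
    (htr : ∀ q : ℚ, 0 < q → Tendsto (fun n => (𝒜 n).tr q) atTop (𝓝 (trace ν d q)))
    (h1 : trace ν d 1 = 2) :
    ∃ (N : ℕ) (r : ℕ → ℝ), (∀ n, 1 / 2 ≤ r n ∧ (𝒜 (n + N)).tr (r n) = 2) ∧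
      Tendsto r atTop (𝓝 1) := by
  have hlow : ∀ q : ℚ, 0 < q → q < 1 → ∀ᶠ n in atTop, 2 < (𝒜 n).tr q := by
    intro q hq hq1
    have h2 : 2 < trace ν d q := by
      rw [← h1]
      refine hK.trace_lt b hq hq1 fun h => ?_
      have := hK.trace_le b hq hq1.le
      rw [h, h1] at this
      norm_num at this
    exact (htr q hq).eventually_const_lt h2
  have hup : ∀ q : ℚ, 1 < q → ∀ᶠ n in atTop, (𝒜 n).tr q < 2 := by
    intro q hq1
    have h2 : trace ν d q < 2 := by
      rw [← h1]
      exact hK.trace_lt b one_pos hq1 (by rw [h1]; norm_num)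
    exact (htr q (one_pos.trans hq1)).eventually_lt_const h2
  obtain ⟨N, hN⟩ := ((hlow (1 / 2) (by norm_num) (by norm_num)).and
    (hup 2 (by norm_num))).exists_forall_of_atTop
  have hr : ∀ n : ℕ, ∃ r : ℝ, r ∈ Set.Icc (1 / 2 : ℝ) 2 ∧ (𝒜 (n + (N + 1))).tr r = 2 := by
    intro n
    obtain ⟨h2, h3⟩ := hN (n + (N + 1)) (by omega)
    push_cast at h2 h3
    obtain ⟨r, hr, hr2⟩ := intermediate_value_Icc' (by norm_num : (1 / 2 : ℝ) ≤ 2)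
      (𝒜 (n + (N + 1))).continuous_tr.continuousOn ⟨h3.le, h2.le⟩
    exact ⟨r, hr, hr2⟩
  choose r hr hr2 using hr
  refine ⟨N + 1, r, fun n => ⟨(hr n).1, hr2 n⟩, tendsto_order.2 ⟨fun a ha => ?_, fun a ha => ?_⟩⟩
  · obtain ⟨q, hq1, hq2⟩ := exists_rat_btwn (max_lt ha (by norm_num : (1 / 2 : ℝ) < 1))
    have hq0 : (0 : ℝ) < q := lt_trans (by norm_num) ((le_max_right _ _).trans_lt hq1)
    have := (tendsto_add_atTop_nat (N + 1)).eventually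
      (hlow q (by exact_mod_cast hq0) (by exact_mod_cast hq2))
    filter_upwards [this] with n hn
    by_contra hle
    push Not at hle
    have h3 := (𝒜 (n + (N + 1))).tr_anti (hle.trans ((le_max_left _ _).trans hq1.le))
    rw [hr2] at h3
    linarith
  · obtain ⟨q, hq1, hq2⟩ := exists_rat_btwn ha
    have := (tendsto_add_atTop_nat (N + 1)).eventually (hup q (by exact_mod_cast hq1))
    filter_upwards [this] with n hn
    by_contra hle
    push Not at hle
    have h3 := (𝒜 (n + (N + 1))).tr_anti (hq2.le.trans hle)
    rw [hr2] at h3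
    linarith

end normalization

/-! ### Convergence of the laws -/

section lawConvergence

variable {S : Type*} [MeasurableSpace S] {ν : Measure S} [IsProbabilityMeasure ν]
  {p : PosReal → S → S → ℝ} {d : PosReal → S → ℝ}
  {Ω : Type*} [MeasurableSpace Ω] {μ : Measure Ω} [IsProbabilityMeasure μ]
  {X : ℕ → ℕ → Ω → PosReal → ℝ}

/-- The random variable `Y` is integrable, and its `L¹` norm is at most `η`. -/
def L1Le (μ : Measure Ω) (Y : Ω → ℝ) (η : ℝ) : Prop := Integrable Y μ ∧ ∫ ω, |Y ω| ∂μ ≤ η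

omit [IsProbabilityMeasure μ] in
lemma L1Le.comp {E : Type*} [MeasurableSpace E] {g : Ω → E} (hg : Measurable g) {Y : E → ℝ}
    {η : ℝ} (h : L1Le (μ.map g) Y η) : L1Le μ (fun ω => Y (g ω)) η := by
  refine ⟨h.1.comp_measurable hg, ?_⟩
  rw [← integral_map hg.aemeasurable h.1.abs.aestronglyMeasurable]
  exact h.2

/-- Random matrices of functions of time which are close in `L¹` have close laws. -/
lemma abs_integral_sub_le {k : ℕ} {T : Finset PosReal} {Y Z : Ω → Fin k → Fin k → T → ℝ}
    (hY : Measurable Y) (hZ : Measurable Z) {η : ℝ}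
    (h : ∀ i j t, L1Le μ (fun ω => Y ω i j t - Z ω i j t) η)
    {f : (Fin k → Fin k → T → ℝ) → ℝ} {C : ℝ} (hC : ∀ x y, dist (f x) (f y) ≤ C) {K : NNReal}
    (hf : LipschitzWith K f) :
    |∫ ω, f (Y ω) ∂μ - ∫ ω, f (Z ω) ∂μ| ≤ K * (k * (k * (T.card * η))) := by
  have hint : ∀ W : Ω → Fin k → Fin k → T → ℝ, Measurable W → Integrable (fun ω => f (W ω)) μ := by
    intro W hW
    refine Integrable.of_bound (hf.continuous.measurable.comp hW).aestronglyMeasurable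
      (C + |f 0|) (Eventually.of_forall fun ω => ?_)
    have h1 := hC (W ω) 0
    rw [Real.dist_eq] at h1
    rw [Real.norm_eq_abs]
    have := abs_sub_abs_le_abs_sub (f (W ω)) (f 0)
    linarith
  rw [← integral_sub (hint Y hY) (hint Z hZ)]
  refine abs_integral_le_integral_abs.trans ?_
  have hsum : Integrable (fun ω => K * ∑ i, ∑ j, ∑ t, |Y ω i j t - Z ω i j t|) μ :=
    (integrable_finsetSum _ fun i _ => integrable_finsetSum _ fun j _ =>
      integrable_finsetSum _ fun t _ => (h i j t).1.abs).const_mul _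
  have h1 : ∫ ω, |f (Y ω) - f (Z ω)| ∂μ
      ≤ ∫ ω, K * ∑ i, ∑ j, ∑ t, |Y ω i j t - Z ω i j t| ∂μ := by
    refine integral_mono ((hint Y hY).sub (hint Z hZ)).abs hsum fun ω => ?_
    refine (hf.dist_le_mul _ _).trans (mul_le_mul_of_nonneg_left ?_ K.2)
    have h0 : ∀ i j t, |Y ω i j t - Z ω i j t| ≤ ∑ i, ∑ j, ∑ t, |Y ω i j t - Z ω i j t| := by
      intro i j t
      refine le_trans ?_ (Finset.single_le_sum (f := fun i => ∑ j, ∑ t, |Y ω i j t - Z ω i j t|)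
        (fun i _ => Finset.sum_nonneg fun j _ => Finset.sum_nonneg fun t _ => abs_nonneg _)
        (Finset.mem_univ i))
      refine le_trans ?_ (Finset.single_le_sum (f := fun j => ∑ t, |Y ω i j t - Z ω i j t|)
        (fun j _ => Finset.sum_nonneg fun t _ => abs_nonneg _) (Finset.mem_univ j))
      exact Finset.single_le_sum (f := fun t => |Y ω i j t - Z ω i j t|)
        (fun t _ => abs_nonneg _) (Finset.mem_univ t)
    have hnn : 0 ≤ ∑ i, ∑ j, ∑ t, |Y ω i j t - Z ω i j t| :=
      Finset.sum_nonneg fun i _ => Finset.sum_nonneg fun j _ => Finset.sum_nonneg fun t _ =>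
        abs_nonneg _
    exact (dist_pi_le_iff hnn).2 fun i => (dist_pi_le_iff hnn).2 fun j =>
      (dist_pi_le_iff hnn).2 fun t => h0 i j t
  refine h1.trans ?_
  rw [integral_const_mul]
  refine mul_le_mul_of_nonneg_left ?_ K.2
  rw [integral_finsetSum _ fun i _ => integrable_finsetSum _ fun j _ =>
    integrable_finsetSum _ fun t _ => (h i j t).1.abs]
  have h2 : ∀ i : Fin k, ∫ ω, ∑ j, ∑ t, |Y ω i j t - Z ω i j t| ∂μ ≤ k * (T.card * η) := by
    intro i
    rw [integral_finsetSum _ fun j _ => integrable_finsetSum _ fun t _ => (h i j t).1.abs]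
    have h3 : ∀ j : Fin k, ∫ ω, ∑ t, |Y ω i j t - Z ω i j t| ∂μ ≤ T.card * η := by
      intro j
      rw [integral_finsetSum _ fun t _ => (h i j t).1.abs]
      refine (Finset.sum_le_sum fun t _ => (h i j t).2).trans (le_of_eq ?_)
      simp
    refine (Finset.sum_le_sum fun j _ => h3 j).trans (le_of_eq ?_)
    simp
  refine (Finset.sum_le_sum fun i _ => h2 i).trans (le_of_eq ?_)
  simp

lemma map_eval_pair {k : ℕ} {i j : Fin k} (hij : i ≠ j) :
    (Measure.pi fun _ : Fin k => ν).map (fun u => (u i, u j)) = ν.prod ν := by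
  have h := (iIndepFun_pi (μ := fun _ : Fin k => ν) (X := fun _ => (id : S → S))
    fun _ => aemeasurable_id).indepFun hij
  simp only [id] at h
  rw [indepFun_iff_map_prod_eq_prod_map_map (measurable_pi_apply i).aemeasurable
    (measurable_pi_apply j).aemeasurable] at h
  rw [h]
  have h1 : ∀ i : Fin k, (Measure.pi fun _ : Fin k => ν).map (fun u => u i) = ν := fun i =>
    (measurePreserving_eval (fun _ : Fin k => ν) i).map_eq
  rw [h1, h1]

lemma L1Le_pi_of_ne {k : ℕ} {i j : Fin k} (hij : i ≠ j) {f : S → S → ℝ} {η : ℝ}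
    (h : L1Le (ν.prod ν) (fun z => f z.1 z.2) η) :
    L1Le (Measure.pi fun _ : Fin k => ν) (fun u => f (u i) (u j)) η := by
  rw [← map_eval_pair hij] at h
  exact h.comp (by fun_prop)

lemma L1Le_pi {k : ℕ} (i : Fin k) {f : S → ℝ} {η : ℝ} (h : L1Le ν f η) :
    L1Le (Measure.pi fun _ : Fin k => ν) (fun u => f (u i)) η := by
  rw [← (measurePreserving_eval (fun _ : Fin k => ν) i).map_eq] at h
  exact h.comp (by fun_prop)

namespace IsDensityArray

omit [IsProbabilityMeasure μ] in
lemma L1Le_of_map_eq {W : Type*} [MeasurableSpace W] {P : Measure W} {Y : Ω → ℝ} {Z : W → ℝ}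
    (hY : Measurable Y) (hZ : Measurable Z) (h : μ.map Y = P.map Z) {η : ℝ} (hL : L1Le P Z η) :
    L1Le μ Y η := by
  have h1 : L1Le (P.map Z) id η := by
    refine ⟨(integrable_map_measure aestronglyMeasurable_id hZ.aemeasurable).2 hL.1, ?_⟩
    rw [integral_map hZ.aemeasurable (by fun_prop)]
    exact hL.2
  rw [← h] at h1
  exact h1.comp hY

lemma L1Le_entry (hX : IsDensityArray μ X) {s t : PosReal} {η : ℝ}
    (hoff : L1Le μ (fun ω => X 0 1 ω s - X 0 1 ω t) η)
    (hdiag : L1Le μ (fun ω => X 0 0 ω s - X 0 0 ω t) η) (i j : ℕ) :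
    L1Le μ (fun ω => X i j ω s - X i j ω t) η := by
  have hm : ∀ i j, Measurable fun x : ℕ → ℕ → PosReal → ℝ => x i j s - x i j t := fun i j =>
    (measurable_eval3 _ _ _).sub (measurable_eval3 _ _ _)
  have hmX : ∀ i j, Measurable fun ω => X i j ω s - X i j ω t := fun i j =>
    (hX.measurable_apply _ _ _).sub (hX.measurable_apply _ _ _)
  have h2 : Function.Injective fun r : ℕ => 2 * r := fun a b h => by
    have : 2 * a = 2 * b := h
    omega
  -- pass to even indices, which are those enumerated by `pairEmb`
  have h1 := hX.map_comp_eq Function.injective_id h2 (hm i j)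
  by_cases hij : i = j
  · subst hij
    have h3 := hX.map_comp_eq (pairEmb_injective (Nat.succ_ne_self i).symm)
      Function.injective_id (hm 0 0)
    exact L1Le_of_map_eq (hmX i i) (hmX 0 0) (h1.trans h3) hdiag
  · have h3 := hX.map_comp_eq (pairEmb_injective hij) Function.injective_id (hm 0 1)
    exact L1Le_of_map_eq (hmX i j) (hmX 0 1) (h1.trans h3) hoff

end IsDensityArray

namespace Approximation

variable (𝒜 : Approximation ν) (r : ℝ) (hr : 0 < r)

/-- Points of `S` drawn from `ν` are in states drawn from the stationary distribution. -/
lemma map_sampleMeasure (k : ℕ) :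
    ((𝒜.chain r hr).sampleMeasure (𝒜.law r hr)).map (fun ω (i : Fin k) => ω i)
      = (Measure.pi fun _ : Fin k => ν).map (fun u i => 𝒜.state r hr (u i)) := by
  have hm := 𝒜.measurable_state r hr
  have hp : ∀ _ : Fin k, SigmaFinite (ν.map (𝒜.state r hr)) := fun _ => by
    rw [𝒜.map_state]
    infer_instance
  rw [Measure.pi_map_pi fun _ => hm.aemeasurable]
  simp only [𝒜.map_state]
  symm
  refine Measure.pi_eq fun A hA => ?_
  rw [Measure.map_apply (by fun_prop) (MeasurableSet.univ_pi hA)]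
  have h1 : (fun (ω : ℕ → (𝒜.chain r hr).State) (i : Fin k) => ω i) ⁻¹' Set.univ.pi A
      = Set.pi (Finset.range k) fun n => if h : n < k then A ⟨n, h⟩ else Set.univ := by
    ext ω
    simp only [Set.mem_preimage, Set.mem_pi, Set.mem_univ, true_implies, Finset.coe_range,
      Set.mem_Iio]
    constructor
    · intro h n hn
      rw [dif_pos hn]
      exact h ⟨n, hn⟩
    · intro h i
      have := h i i.2
      rwa [dif_pos i.2] at this
  rw [h1, FiniteMarkovChain.sampleMeasure, Measure.infinitePi_pi]
  · rw [Finset.prod_range]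
    refine Finset.prod_congr rfl fun i _ => ?_
    rw [dif_pos i.2]
  · intro n hn
    rw [dif_pos (Finset.mem_range.1 hn)]
    exact hA _

lemma measurable_densityArray (k : ℕ) (T : Finset PosReal) :
    Measurable fun (ω : ℕ → (𝒜.chain r hr).State) (i j : Fin k) (t : T) =>
      (𝒜.chain r hr).densityArray (𝒜.law r hr) i j ω t := by
  refine measurable_pi_lambda _ fun i => measurable_pi_lambda _ fun j =>
    measurable_pi_lambda _ fun t => ?_
  have : Countable (𝒜.chain r hr).State := Finite.to_countable
  have h1 : Measurable fun z : (𝒜.chain r hr).State × (𝒜.chain r hr).State =>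
      (𝒜.chain r hr).density (𝒜.law r hr) t.1 z.1 z.2 := measurable_from_prod_countable_right
        fun _ => measurable_from_top
  exact h1.comp (f := fun ω : ℕ → (𝒜.chain r hr).State => (ω i, ω j)) (by fun_prop)

/-- The law of the density array of the approximating chain, in terms of the kernels. -/
lemma integral_densityArray {k : ℕ} {T : Finset PosReal} {f : (Fin k → Fin k → T → ℝ) → ℝ}
    (hf : Measurable f) :
    ∫ ω, f (fun i j t => (𝒜.chain r hr).densityArray (𝒜.law r hr) i j ω t)
        ∂((𝒜.chain r hr).sampleMeasure (𝒜.law r hr))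
      = ∫ u, f (fun i j (t : T) => 𝒜.ker (r * t.1) (u i) (u j))
        ∂(Measure.pi fun _ : Fin k => ν) := by
  have : Countable (𝒜.chain r hr).State := Finite.to_countable
  let F : (Fin k → (𝒜.chain r hr).State) → ℝ := fun v =>
    f fun i j t => (𝒜.chain r hr).density (𝒜.law r hr) t.1 (v i) (v j)
  have hF : Measurable F := by
    refine hf.comp (measurable_pi_lambda _ fun i => measurable_pi_lambda _ fun j =>
      measurable_pi_lambda _ fun t => ?_)
    have h1 : Measurable fun z : (𝒜.chain r hr).State × (𝒜.chain r hr).State =>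
        (𝒜.chain r hr).density (𝒜.law r hr) t.1 z.1 z.2 := measurable_from_prod_countable_right
          fun _ => measurable_from_top
    exact h1.comp (f := fun v : Fin k → (𝒜.chain r hr).State => (v i, v j)) (by fun_prop)
  have hm := 𝒜.measurable_state r hr
  have h1 := congrArg (fun m => ∫ v, F v ∂m) (𝒜.map_sampleMeasure r hr k)
  beta_reduce at h1
  have hm1 : Measurable fun (ω : ℕ → (𝒜.chain r hr).State) (i : Fin k) => ω i := by fun_prop
  have hm2 : Measurable fun (u : Fin k → S) i => 𝒜.state r hr (u i) := by fun_prop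
  rw [integral_map hm1.aemeasurable hF.aestronglyMeasurable,
    integral_map hm2.aemeasurable hF.aestronglyMeasurable] at h1
  refine h1.trans ?_
  exact integral_congr_ae (Eventually.of_forall fun u => congrArg f
    (funext fun i => funext fun j => funext fun t => 𝒜.chain_density r hr t.1 (u i) (u j)))

end Approximation

end lawConvergence

/-! ### The approximating chains converge -/

section conclusion

variable {S : Type*} [MeasurableSpace S] {ν : Measure S} [IsProbabilityMeasure ν]
  {p : PosReal → S → S → ℝ} {d : PosReal → S → ℝ}
  {Ω : Type*} [MeasurableSpace Ω] {μ : Measure Ω} [IsProbabilityMeasure μ]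
  {X : ℕ → ℕ → Ω → PosReal → ℝ}

omit [IsProbabilityMeasure μ] in
lemma L1Le.add {Y Z : Ω → ℝ} {η θ : ℝ} (hY : L1Le μ Y η) (hZ : L1Le μ Z θ) :
    L1Le μ (fun ω => Y ω + Z ω) (η + θ) := by
  refine ⟨hY.1.add hZ.1, ?_⟩
  refine (integral_mono (hY.1.add hZ.1).abs (hY.1.abs.add hZ.1.abs)
    fun ω => abs_add_le _ _).trans ?_
  simp only [Pi.add_apply]
  rw [integral_add hY.1.abs hZ.1.abs]
  exact add_le_add hY.2 hZ.2

lemma L1Le_of_sq {Y : Ω → ℝ} (hY : MemLp Y 2 μ) {η : ℝ} (hη : 0 ≤ η)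
    (h : ∫ ω, Y ω ^ 2 ∂μ ≤ η ^ 2) : L1Le μ Y η :=
  ⟨hY.integrable (by norm_num), le_of_sq_le_sq ((sq_integral_abs_le hY).trans h) hη⟩

/-- Comparison with the given kernels at a rational time: if `q < t < q'` are such that the trace
varies little between `q` and `q'`, then the kernels of the chains, run at a speed tending to `1`,
are at time `t` close to the given kernels at time `q`. -/
lemma IsKernelSemigroup.eventually_L1Le_ker (hK : IsKernelSemigroup ν p d ratTimes)
    {𝒜 : ℕ → Approximation ν}
    (hoff : ∀ q : ℚ, 0 < q → Tendsto
      (fun n => ∫ z, ((𝒜 n).ker q z.1 z.2 - p (ratTime q) z.1 z.2) ^ 2 ∂(ν.prod ν)) atTop (𝓝 0))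
    (hdiag : ∀ q : ℚ, 0 < q → Tendsto
      (fun n => ∫ x, |(𝒜 n).ker q x x - d (ratTime q) x| ∂ν) atTop (𝓝 0))
    (htr : ∀ q : ℚ, 0 < q → Tendsto (fun n => (𝒜 n).tr q) atTop (𝓝 (trace ν d q)))
    {r : ℕ → ℝ} (hr : Tendsto r atTop (𝓝 1)) {t : ℝ} {q q' : ℚ} (hq : 0 < q) (hqt : q < t)
    (htq : t < q') {η : ℝ} (hη : 0 < η) (h1 : trace ν d (q + q) - trace ν d (q' + q') < η ^ 2)
    (h2 : trace ν d q - trace ν d q' < η) :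
    ∀ᶠ n in atTop,
      L1Le (ν.prod ν) (fun z => (𝒜 n).ker (r n * t) z.1 z.2 - p (ratTime q) z.1 z.2) (η + η) ∧
      L1Le ν (fun x => (𝒜 n).ker (r n * t) x x - d (ratTime q) x) (η + η) := by
  have hq' : 0 < q' := by
    have : (q : ℝ) < q' := hqt.trans htq
    exact hq.trans (by exact_mod_cast this)
  have hrt : Tendsto (fun n => r n * t) atTop (𝓝 t) := by simpa using hr.mul_const t
  filter_upwards [hrt.eventually_const_lt hqt, hrt.eventually_lt_const htq,
    (hoff q hq).eventually_lt_const (show 0 < η ^ 2 by positivity),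
    (hdiag q hq).eventually_lt_const hη,
    ((htr _ (add_pos hq hq)).sub (htr _ (add_pos hq' hq'))).eventually_lt_const h1,
    ((htr _ hq).sub (htr _ hq')).eventually_lt_const h2] with n e1 e2 e3 e4 e5 e6
  have hd := hK.integrable_diag _ (ratTime_mem hq)
  push_cast at e5
  constructor
  · have m1 : MemLp (fun z : S × S => (𝒜 n).ker q z.1 z.2 - (𝒜 n).ker (r n * t) z.1 z.2) 2
        (ν.prod ν) := ((𝒜 n).memLp_ker q).sub ((𝒜 n).memLp_ker _)
    have m2 : MemLp (fun z : S × S => (𝒜 n).ker q z.1 z.2 - p (ratTime q) z.1 z.2) 2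
        (ν.prod ν) := ((𝒜 n).memLp_ker q).sub (hK.memLp_rat hq)
    have m3 : MemLp (fun z : S × S => (𝒜 n).ker (r n * t) z.1 z.2 - (𝒜 n).ker q z.1 z.2) 2
        (ν.prod ν) := ((𝒜 n).memLp_ker _).sub ((𝒜 n).memLp_ker q)
    have l1 := L1Le_of_sq m3 hη.le (by
      have h3 := (𝒜 n).integral_ker_sub_sq_le e1.le
      have h4 := (𝒜 n).tr_anti (add_le_add e2.le e2.le)
      simp only [sub_sq_comm ((𝒜 n).ker (r n * t) _ _)]
      linarith)
    have l2 := L1Le_of_sq m2 hη.le e3.le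
    simpa using l1.add l2
  · have l1 : L1Le ν (fun x => (𝒜 n).ker (r n * t) x x - (𝒜 n).ker q x x) η := by
      refine ⟨((𝒜 n).integrable_ker_diag _).sub ((𝒜 n).integrable_ker_diag _), ?_⟩
      have h3 := (𝒜 n).integral_abs_ker_diag_sub e1.le
      have h4 := (𝒜 n).tr_anti e2.le
      simp only [abs_sub_comm ((𝒜 n).ker (r n * t) _ _)]
      linarith
    have l2 : L1Le ν (fun x => (𝒜 n).ker q x x - d (ratTime q) x) η :=
      ⟨((𝒜 n).integrable_ker_diag _).sub hd, e4.le⟩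
    simpa using l1.add l2

/-- Every time has rational times `q < t < q'` on both sides between which the trace, at `q` and
`q'` and at the doubled times, varies little, and such that the array varies little between `q` and
`t`. -/
lemma IsDensityArray.exists_ratTime (hX : IsDensityArray μ X) (t : PosReal) {η : ℝ} (hη : 0 < η) :
    ∃ q q' : ℚ, 0 < q ∧ (q : ℝ) < t ∧ (t : ℝ) < q' ∧
      ∫ ω, X 0 0 ω (ratTime (q + q)) ∂μ - ∫ ω, X 0 0 ω (ratTime (q' + q')) ∂μ < η ^ 2 ∧
      ∫ ω, X 0 0 ω (ratTime q) ∂μ - ∫ ω, X 0 0 ω (ratTime q') ∂μ < η ∧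
      L1Le μ (fun ω => X 0 1 ω t - X 0 1 ω (ratTime q)) η ∧
      L1Le μ (fun ω => X 0 0 ω t - X 0 0 ω (ratTime q)) η := by
  have hφ := hX.continuous_integral_diag
  have hadd : Continuous fun s : PosReal => s + s :=
    continuous_induced_rng.2 (by
      change Continuous fun s : PosReal => (s : ℝ) + s
      fun_prop)
  have hη2 : 0 < η ^ 2 / 2 := by positivity
  have hev := ((((Metric.tendsto_nhds.1 (hφ.tendsto t)) (η / 2) (half_pos hη)).and
    ((Metric.tendsto_nhds.1 ((hφ.comp hadd).tendsto t)) (η ^ 2 / 2) hη2)).and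
    ((hX.tendsto_integral_abs_offDiag_sub t).eventually_lt_const hη)).and
    ((hX.tendsto_integral_abs_diag_sub t).eventually_lt_const hη)
  obtain ⟨δ, hδ, h⟩ := Metric.eventually_nhds_iff.1 hev
  have ht : (0 : ℝ) < t := t.2
  obtain ⟨q, hq1, hq2⟩ := exists_rat_btwn (max_lt ht (sub_lt_self (t : ℝ) hδ))
  obtain ⟨q', hq1', hq2'⟩ := exists_rat_btwn (lt_add_of_pos_right (t : ℝ) hδ)
  have hq : 0 < q := by exact_mod_cast (le_max_left _ _).trans_lt hq1
  have hq' : 0 < q' := by exact_mod_cast ht.trans hq1'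
  have h3 := (le_max_right _ _).trans_lt hq1
  obtain ⟨⟨⟨e1, e2⟩, e3⟩, e4⟩ := h (y := ratTime q) (by
    rw [Subtype.dist_eq, ratTime_coe hq, Real.dist_eq, abs_lt]
    constructor <;> linarith)
  obtain ⟨⟨⟨e1', e2'⟩, -⟩, -⟩ := h (y := ratTime q') (by
    rw [Subtype.dist_eq, ratTime_coe hq', Real.dist_eq, abs_lt]
    constructor <;> linarith)
  rw [Real.dist_eq, abs_lt] at e1 e1' e2 e2'
  simp only [Function.comp_apply] at e2 e2'
  refine ⟨q, q', hq, hq2, hq1', ?_, by linarith, ⟨?_, e3.le⟩,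
    ⟨(hX.bounded _).sub (hX.bounded _), e4.le⟩⟩
  · rw [ratTime_add hq hq, ratTime_add hq' hq']
    linarith
  · have hm := fun s => (hX.memLp_and_sq_integral_abs_diag_sub_le s s).1.integrable (by norm_num)
    exact (hm t).sub (hm _)

/-- The expectations of bounded Lipschitz functions of the kernel matrices converge. At each time
of the finite set `T` both sides are compared with the given kernels at a nearby rational time. -/
lemma tendsto_integral_densityArray (hX : IsDensityArray μ X)
    (hrep : Represents ν p d ratTimes μ X)
    (hK : IsKernelSemigroup ν p d ratTimes)
    (htrace : ∀ q : ℚ, 0 < q → trace ν d q = ∫ ω, X 0 0 ω (ratTime q) ∂μ)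
    {𝒜 : ℕ → Approximation ν}
    (hoff : ∀ q : ℚ, 0 < q → Tendsto
      (fun n => ∫ z, ((𝒜 n).ker q z.1 z.2 - p (ratTime q) z.1 z.2) ^ 2 ∂(ν.prod ν)) atTop (𝓝 0))
    (hdiag : ∀ q : ℚ, 0 < q → Tendsto
      (fun n => ∫ x, |(𝒜 n).ker q x x - d (ratTime q) x| ∂ν) atTop (𝓝 0))
    (htr : ∀ q : ℚ, 0 < q → Tendsto (fun n => (𝒜 n).tr q) atTop (𝓝 (trace ν d q)))
    {r : ℕ → ℝ} (hr : Tendsto r atTop (𝓝 1)) {k : ℕ} {T : Finset PosReal}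
    {f : (Fin k → Fin k → T → ℝ) → ℝ} {C : ℝ} (hC : ∀ x y, dist (f x) (f y) ≤ C) {K : NNReal}
    (hf : LipschitzWith K f) :
    Tendsto (fun n => ∫ u, f (fun i j (t : T) => (𝒜 n).ker (r n * t.1) (u i) (u j))
      ∂(Measure.pi fun _ : Fin k => ν)) atTop
      (𝓝 (∫ ω, f (fun i j (t : T) => X i j ω t) ∂μ)) := by
  rw [Metric.tendsto_nhds]
  intro ε hε
  set c : ℝ := K * (k * (k * T.card)) with hc
  have hc0 : 0 ≤ c := by positivity
  set η : ℝ := ε / (4 * (c + 1)) with hη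
  have hη0 : 0 < η := by positivity
  choose q q' hq hqt htq h1 h2 h3 h4 using fun t => hX.exists_ratTime t hη0
  have hq' : ∀ t, 0 < q' t := fun t => by
    have : (q t : ℝ) < q' t := (hqt t).trans (htq t)
    exact (hq t).trans (by exact_mod_cast this)
  have hev : ∀ t : T, ∀ᶠ n in atTop,
      L1Le (ν.prod ν) (fun z => (𝒜 n).ker (r n * t.1) z.1 z.2 - p (ratTime (q t)) z.1 z.2)
        (η + η) ∧
      L1Le ν (fun x => (𝒜 n).ker (r n * t.1) x x - d (ratTime (q t)) x) (η + η) := by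
    intro t
    refine hK.eventually_L1Le_ker hoff hdiag htr hr (hq t) (hqt t) (htq t) hη0 ?_ ?_
    · rw [htrace _ (add_pos (hq t) (hq t)), htrace _ (add_pos (hq' t) (hq' t))]
      exact h1 t
    · rw [htrace _ (hq t), htrace _ (hq' t)]
      exact h2 t
  -- the common value of the two sides at the rational times `q t`
  let g : (Fin k → Fin k → ratTimes → ℝ) → ℝ := fun x =>
    f fun i j t => x i j ⟨ratTime (q t), ratTime_mem (hq t)⟩
  have hg : Measurable g := by
    refine hf.continuous.measurable.comp ?_
    exact measurable_pi_lambda _ fun i => measurable_pi_lambda _ fun j =>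
      measurable_pi_lambda _ fun t => (measurable_pi_apply _).comp
        ((measurable_pi_apply j).comp (measurable_pi_apply i))
  have hM := measurable_kernelMatrix (D := ratTimes) hK.measurable hK.measurable_diag k
  have hMapply : ∀ i j s, Measurable fun u => kernelMatrix p d ratTimes k u i j s := fun i j s =>
    (measurable_pi_apply s).comp ((measurable_pi_apply j).comp ((measurable_pi_apply i).comp hM))
  have hXm : ∀ T' : Set PosReal, Measurable fun ω (i j : Fin k) (t : T') => X i j ω t := fun T' =>
    measurable_pi_lambda _ fun _ => measurable_pi_lambda _ fun _ =>
      measurable_pi_lambda _ fun _ => hX.measurable_apply _ _ _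
  have hmid : ∫ u, g (kernelMatrix p d ratTimes k u) ∂(Measure.pi fun _ : Fin k => ν)
      = ∫ ω, f (fun i j (t : T) => X i j ω (ratTime (q t))) ∂μ := by
    rw [← integral_map hM.aemeasurable hg.aestronglyMeasurable, hrep k,
      integral_map (hXm _).aemeasurable hg.aestronglyMeasurable]
  have hlimit := abs_integral_sub_le (μ := μ) (k := k) (T := T)
    (Y := fun ω i j t => X i j ω t) (Z := fun ω i j t => X i j ω (ratTime (q t)))
    (measurable_pi_lambda _ fun _ => measurable_pi_lambda _ fun _ =>
      measurable_pi_lambda _ fun _ => hX.measurable_apply _ _ _)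
    (measurable_pi_lambda _ fun _ => measurable_pi_lambda _ fun _ =>
      measurable_pi_lambda _ fun _ => hX.measurable_apply _ _ _)
    (fun i j t => hX.L1Le_entry (h3 t) (h4 t) i j) hC hf
  filter_upwards [eventually_all.2 hev] with n hn
  have hchain := abs_integral_sub_le (μ := Measure.pi fun _ : Fin k => ν) (k := k) (T := T)
    (Y := fun u i j t => (𝒜 n).ker (r n * t.1) (u i) (u j))
    (Z := fun u i j t => kernelMatrix p d ratTimes k u i j ⟨ratTime (q t), ratTime_mem (hq t)⟩)
    (measurable_pi_lambda _ fun i => measurable_pi_lambda _ fun j =>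
      measurable_pi_lambda _ fun t => ((𝒜 n).measurable_ker _).comp
        (f := fun u : Fin k → S => (u i, u j)) (by fun_prop))
    (measurable_pi_lambda _ fun i => measurable_pi_lambda _ fun j =>
      measurable_pi_lambda _ fun t => hMapply i j _)
    (η := η + η) (fun i j t => by
      by_cases hij : i = j
      · subst hij
        simp only [kernelMatrix, if_true]
        exact L1Le_pi i (hn t).2
      · simp only [kernelMatrix, if_neg hij]
        exact L1Le_pi_of_ne hij (f := fun x y => (𝒜 n).ker (r n * t.1) x y - p (ratTime (q t)) x y)
          (hn t).1) hC hf
  change |_ - ∫ u, g (kernelMatrix p d ratTimes k u) ∂(Measure.pi fun _ : Fin k => ν)| ≤ _ at hchain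
  rw [hmid] at hchain
  have e1 : K * (k * (k * (T.card * (η + η)))) = c * (2 * η) := by rw [hc]; ring
  have e2 : K * (k * (k * (T.card * η))) = c * η := by rw [hc]; ring
  rw [e1] at hchain
  rw [e2] at hlimit
  have e3 : c * (3 * η) < ε := by
    have : 4 * (c + 1) * η = ε := by
      rw [hη]
      field_simp
    nlinarith
  rw [Real.dist_eq]
  rw [abs_le] at hchain hlimit
  rw [abs_lt]
  constructor <;> linarith [hchain.1, hchain.2, hlimit.1, hlimit.2]

end conclusion

/-! ### Density arrays are limits of finite chains -/

section main

variable {Ω : Type*} [MeasurableSpace Ω] {μ : Measure Ω} [IsProbabilityMeasure μ]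
  {X : ℕ → ℕ → Ω → PosReal → ℝ}

/-- If the kernel matrices of approximations run at speeds `r n` converge in the sense of the
expectations of Lipschitz test functions, then so do the density arrays. -/
lemma arrayTendstoInDistribution {S : Type*} [MeasurableSpace S] {ν : Measure S}
    [IsProbabilityMeasure ν] {𝒜 : ℕ → Approximation ν} {r : ℕ → ℝ} (hr : ∀ n, 0 < r n)
    (hX : ∀ i j t, Measurable fun ω => X i j ω t)
    (h : ∀ (k : ℕ) (T : Finset PosReal) (f : (Fin k → Fin k → T → ℝ) → ℝ),
      (∃ C : ℝ, ∀ x y, dist (f x) (f y) ≤ C) → (∃ K, LipschitzWith K f) →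
      Tendsto (fun n => ∫ u, f (fun i j (t : T) => (𝒜 n).ker (r n * t.1) (u i) (u j))
        ∂(Measure.pi fun _ : Fin k => ν)) atTop
        (𝓝 (∫ ω, f (fun i j (t : T) => X i j ω t) ∂μ))) :
    ArrayTendstoInDistribution
      (fun n => ((𝒜 n).chain (r n) (hr n)).sampleMeasure ((𝒜 n).law (r n) (hr n)))
      (fun n => ((𝒜 n).chain (r n) (hr n)).densityArray ((𝒜 n).law (r n) (hr n))) μ X := by
  intro k T
  have hm := fun n => (𝒜 n).measurable_densityArray (r n) (hr n) k T
  have hXm : Measurable fun ω (i j : Fin k) (t : T) => X i j ω t :=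
    measurable_pi_lambda _ fun _ => measurable_pi_lambda _ fun _ =>
      measurable_pi_lambda _ fun _ => hX _ _ _
  refine ⟨fun n => (hm n).aemeasurable, hXm.aemeasurable, ?_⟩
  refine tendsto_iff_forall_lipschitz_integral_tendsto.2 fun f hC hK => ?_
  have hf : Measurable f := hK.choose_spec.continuous.measurable
  change Tendsto (fun n => ∫ x, f x ∂(Measure.map _ _)) atTop (𝓝 (∫ x, f x ∂(Measure.map _ _)))
  rw [integral_map hXm.aemeasurable hf.aestronglyMeasurable]
  refine (h k T f hC hK).congr fun n => ?_
  rw [integral_map (hm n).aemeasurable hf.aestronglyMeasurable]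
  exact ((𝒜 n).integral_densityArray (r n) (hr n) hf).symm

theorem IsDensityArray.exists_boundedSequence (hX : IsDensityArray μ X) :
    ∃ C : ℕ → FiniteMarkovChain, IsBoundedSequence C ∧
      ∃ π : ∀ n, PMF (C n).State, (∀ n, (C n).IsStationary (π n)) ∧
        ArrayTendstoInDistribution (fun n => (C n).sampleMeasure (π n))
          (fun n => (C n).densityArray (π n)) μ X := by
  have : Countable ratTimes := countable_ratTimes.to_subtype
  obtain ⟨S, _, _, ν, p, d, _, hp, hd, h⟩ :=
    exists_kernel_representation (D := ratTimes) hX half_mem_ratTimes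
  have hrep : Represents ν p d ratTimes μ X := h
  have hK := hrep.isKernelSemigroup hX hp hd add_mem_ratTimes
  obtain ⟨w, b, -⟩ := exists_hilbertBasis ℝ (Lp ℝ 2 ν)
  have : Fact ((2 : ENNReal) ≠ ⊤) := ⟨by norm_num⟩
  have hw : Countable w := b.countable
  have htrace : ∀ q : ℚ, 0 < q → trace ν d q = ∫ ω, X 0 0 ω (ratTime q) ∂μ := by
    intro q hq
    have h1 := congrArg (fun m => ∫ x : ratTimes → ℝ, x ⟨ratTime q, ratTime_mem hq⟩ ∂m)
      (hrep.map_diag hX.measurable_apply hp hd)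
    beta_reduce at h1
    have hm : Measurable fun x : ratTimes → ℝ => x ⟨ratTime q, ratTime_mem hq⟩ :=
      measurable_pi_apply _
    have hmd : Measurable fun x (t : ratTimes) => d t x := measurable_pi_lambda _ fun t => hd t
    have hmX : Measurable fun ω (t : ratTimes) => X 0 0 ω t :=
      measurable_pi_lambda _ fun t => hX.measurable_apply 0 0 t
    rwa [integral_map hmd.aemeasurable hm.aestronglyMeasurable,
      integral_map hmX.aemeasurable hm.aestronglyMeasurable] at h1
  have hone : ratTime 1 = 1 := by
    apply Subtype.ext
    rw [ratTime_coe one_pos]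
    exact Rat.cast_one
  have htrace1 : trace ν d 1 = 2 := by
    rw [htrace 1 one_pos, hone]
    exact hX.normal.2
  -- continuity from the left of the trace, at rational times
  have hcont : ∀ t : ℚ, 0 < t → ∀ η > 0,
      ∃ t' : ℚ, 0 < t' ∧ t' < t ∧ trace ν d t' ≤ trace ν d t + η := by
    intro t ht η hη
    obtain ⟨δ, hδ, h1⟩ := Metric.tendsto_nhds_nhds.1
      (hX.continuous_integral_diag.tendsto (ratTime t)) η hη
    have ht0 : (0 : ℝ) < t := by exact_mod_cast ht
    obtain ⟨q, hq1, hq2⟩ := exists_rat_btwn (max_lt ht0 (sub_lt_self (t : ℝ) hδ))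
    have hq : 0 < q := by exact_mod_cast (le_max_left _ _).trans_lt hq1
    have h3 := (le_max_right _ _).trans_lt hq1
    refine ⟨q, hq, by exact_mod_cast hq2, ?_⟩
    have h4 := h1 (x := ratTime q) (by
      rw [Subtype.dist_eq, ratTime_coe hq, ratTime_coe ht, Real.dist_eq, abs_lt]
      constructor <;> linarith)
    rw [← htrace q hq, ← htrace t ht, Real.dist_eq, abs_lt] at h4
    linarith [h4.2]
  obtain ⟨𝒜', hform, hup⟩ := hK.exists_seq_approximation b
  have hlim := fun (t : ℚ) (ht : 0 < t) => hK.tendsto_integral_ker_sub_sq b hcont hform hup ht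
  have htr' : ∀ q : ℚ, 0 < q → Tendsto (fun n => (𝒜' n).tr q) atTop (𝓝 (trace ν d q)) := by
    intro q hq
    simpa only [add_halves] using (hlim (q / 2) (half_pos hq)).2
  have hdiag' : ∀ q : ℚ, 0 < q → Tendsto
      (fun n => ∫ x, |(𝒜' n).ker q x x - d (ratTime q) x| ∂ν) atTop (𝓝 0) := by
    intro q hq
    have h1 := hlim (q / 2) (half_pos hq)
    simpa only [add_halves] using hK.tendsto_integral_abs_ker_diag_sub (half_pos hq) h1.1 h1.2
  obtain ⟨N, r, hr, hr1⟩ := exists_speed hK b htr' htrace1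
  have hr0 : ∀ n, 0 < r n := fun n => one_half_pos.trans_le (hr n).1
  set 𝒜 : ℕ → Approximation ν := fun n => 𝒜' (n + N) with h𝒜
  have hshift := tendsto_add_atTop_nat N
  have htr : ∀ q : ℚ, 0 < q → Tendsto (fun n => (𝒜 n).tr q) atTop (𝓝 (trace ν d q)) :=
    fun q hq => (htr' q hq).comp hshift
  refine ⟨fun n => (𝒜 n).chain (r n) (hr0 n), ⟨fun n => (𝒜 n).stoch.isIrreducible _,
    fun n => (𝒜 n).stoch.isReversible _, fun n => ?_, fun t ht => ?_⟩,
    fun n => (𝒜 n).law (r n) (hr0 n), fun n => (𝒜 n).stoch.isStationary _,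
    arrayTendstoInDistribution hr0 hX.measurable_apply fun k T f hC hL => ?_⟩
  · rw [FiniteMarkovChain.IsNormalized, Approximation.chain_G, mul_one]
    exact (hr n).2
  · obtain ⟨q, hq1, hq2⟩ := exists_rat_btwn (half_pos ht)
    obtain ⟨B, hB⟩ := (htr q (by exact_mod_cast hq1)).bddAbove_range
    refine ⟨B, fun n => ?_⟩
    rw [Approximation.chain_G]
    refine ((𝒜 n).tr_anti ?_).trans (hB ⟨n, rfl⟩)
    -- the speeds are at least `1 / 2`
    nlinarith [(hr n).1]
  · obtain ⟨C, hC⟩ := hC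
    obtain ⟨K, hL⟩ := hL
    exact tendsto_integral_densityArray hX hrep hK htrace
      (fun q hq => (hlim q hq).1.comp hshift) (fun q hq => (hdiag' q hq).comp hshift) htr hr1 hC hL

end main

end MarkovLimit

end

theorem theorem3p4 {Ω : Type*} [MeasurableSpace Ω] (μ : MeasureTheory.Measure Ω)
    [MeasureTheory.IsProbabilityMeasure μ] (X : ℕ → ℕ → Ω → MarkovLimit.PosReal → ℝ)
    (hX : MarkovLimit.IsDensityArray μ X) :
    ∃ C : ℕ → MarkovLimit.FiniteMarkovChain, MarkovLimit.IsBoundedSequence C ∧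
      ∃ π : ∀ n, PMF (C n).State,
        (∀ n, (C n).IsStationary (π n)) ∧
        MarkovLimit.ArrayTendstoInDistribution (fun n => (C n).sampleMeasure (π n))
          (fun n => (C n).densityArray (π n)) μ X := by
  exact hX.exists_boundedSequence
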